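/- Let $M$ be a smooth manifold (Hausdorff, second countable), let $E\to M$ be an oriented real vector bundle of rank $n\ge 1$ with a Riemannian metric (for instance $E=TM$, $M$ an oriented $n$-dimensional Riemannian manifold), and let $\pi\colon SO(E)\to M$ be its bundle of oriented orthonormal frames. The $\mathrm{Spin}^{\mathbb C}$ (resp. $\mathrm{Spin}$) lifting bundle gerbe $L\to SO(E)^{[2]}=SO(E)\times_M SO(E)$ is the pullback, along the canonical map $g\colon SO(E)^{[2]}\to SO(n)$, $f'=f\,g(f,f')$, of the central extension $U(1)\to \mathrm{Spin}^{\mathbb C}(n)\to SO(n)$ (resp. $\mathbb Z_2\to \mathrm{Spin}(n)\to SO(n)$), with the product induced by that of the group. Let $V$ be a nonzero finite-dimensional smooth representation of $\mathrm{Spin}^{\mathbb C}(n)$ over $\mathbb C$ (resp. of $\mathrm{Spin}(n)$ over $\mathbb R$) on which the central $U(1)$ (resp. $\mathbb Z_2=\{\pm1\}$) acts by scalar multiplication, for example an irreducible such representation. A spinor bundle gerbe module of type $V$ is a vector bundle $\mathcal S\to SO(E)$ with an action of $L$, by isomorphisms $\mathcal S_{f'}\to\mathcal S_f$ for $l\in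 L_{(f,f')}$, that is linear in the scalars and compatible with the product of $L$, together with a lift $\widehat{\pi^*SO(E)}$ of the structure group of $\pi^*SO(E)$ to $\mathrm{Spin}^{\mathbb C}(n)$ (resp. $\mathrm{Spin}(n)$), an action of $L$ on this lift that covers the identity of the frames in $\pi^*SO(E)$ and commutes with the structure group, and an $L$-equivariant identification of $\mathcal S$ with the associated bundle $\widehat{\pi^*SO(E)}\times_{\mathrm{Spin}^{\mathbb C}(n)}V$ (resp. $\widehat{\pi^*SO(E)}\times_{\mathrm{Spin}(n)}V$). Isomorphisms of spinor modules are isomorphisms of $L$-modules induced by $L$-equivariant isomorphisms of the lifts. All bundles and actions are smooth. Then: 1. The Dixmier–Douady class in $H^3(M,\mathbb Z)$ of the $\mathrm{Spin}^{\mathbb C}$ bundle gerbe is $W_3(E)=\beta w_2(E)$, where $\beta\colon H^2(M,\mathbb Z_2)\to H^3(M,\mathbb Z)$ is the Bockstein homomorphism; the real ($\mathbb Z_2$-valued) Dixmier–Douady class of the $\mathrm{Spin}$ bundle gerbe is $w_2(E)\in H^2(M,\mathbb Z_2)$. 2. For the $\mathrm{Spin}^{\mathbb C}$ bundle gerbe: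 irreducible representations $V$ as above exist. For every $V$ as above spinor modules of type $V$ exist. For a spinor module $\mathcal S$ and a complex line bundle $\mathcal L\to M$, $\mathcal S\otimes\pi^*\mathcal L$, with $L$ acting trivially on $\pi^*\mathcal L$, is again a spinor module of type $V$, well defined up to isomorphism. For any two spinor modules $\mathcal S_1,\mathcal S_2$ of type $V$ there is a complex line bundle $\mathcal L$ on $M$, unique up to isomorphism, with $\mathcal S_2\cong\mathcal S_1\otimes\pi^*\mathcal L$. Complex line bundles on $M$ are classified up to isomorphism by $c_1\in H^2(M,\mathbb Z)$, every element of $H^2(M,\mathbb Z)$ occurs, and thus the group $H^2(M,\mathbb Z)$ acts simply transitively on the set of isomorphism classes of spinor modules of type $V$. 3. For the $\mathrm{Spin}$ bundle gerbe the same holds with real line bundles on $M$, the first Stiefel–Whitney class $w_1$ and the group $H^1(M,\mathbb Z_2)$ in place of complex line bundles, $c_1$ and $H^2(M,\mathbb Z)$. -/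

import Mathlib

open Bundle Manifold ContDiff TensorProduct Topology

noncomputable section

namespace SpinorGerbe

/-- Euclidean space `ℝᵏ`. -/
abbrev Eu (k : ℕ) := EuclideanSpace ℝ (Fin k)

/-! ### Smooth families

The total space of a frame bundle and the group `Spin^c(n)` are used through their smooth families:
`P k γ O` says that `γ`, restricted to the open set `O ⊆ ℝᵏ`, is a smooth map into `X`.  For a
manifold these are the usual smooth maps, and a map out of it is smooth if and only if it takes
smooth families to smooth families. -/

/-- A specification of which maps from open sets of Euclidean spaces to `X` are smooth. -/
abbrev Plots (X : Type*) := ∀ k : ℕ, (Eu k → X) → Set (Eu k) → Prop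

/-- `f` is a smooth vector-valued function on the subset `W` of `X`. -/
def SmoothFun {X : Type*} (P : Plots X) (W : Set X) {T : Type*} [NormedAddCommGroup T]
    [NormedSpace ℝ T] (f : X → T) : Prop :=
  ∀ (k : ℕ) (γ : Eu k → X) (O : Set (Eu k)), IsOpen O → P k γ O → Set.MapsTo γ O W →
    ContDiffOn ℝ ∞ (fun t => f (γ t)) O

/-- The smooth families of points of a manifold. -/
def manifoldPlots (m : ℕ) (M : Type*) [TopologicalSpace M] [ChartedSpace (Eu m) M] : Plots M :=
  fun k γ O => ContMDiffOn (𝓡 k) (𝓡 m) ∞ γ O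

/-! ### Vector bundles and principal bundles -/

/-- A smooth `K`-vector bundle over `X` with typical fibre `F`: a family of vector spaces with an
atlas of local frames whose transition functions are smooth.  (A local frame over `U` is recorded
as a function on all of `X`; its values outside `U` are irrelevant.) -/
structure SmoothVB (K : Type) [RCLike K] {X : Type*} [TopologicalSpace X] (P : Plots X)
    (F : Type) [AddCommGroup F] [Module K F] where
  fiber : X → Type
  [addCommGroup : ∀ x, AddCommGroup (fiber x)]
  [module : ∀ x, Module K (fiber x)]
  frames : Set (Set X × ∀ x, F ≃ₗ[K] fiber x)
  isOpen_dom : ∀ e ∈ frames, IsOpen e.1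
  cover : ∀ x, ∃ e ∈ frames, x ∈ e.1
  transition : ∀ e ∈ frames, ∀ e' ∈ frames, ∀ (v : F) (φ : F →ₗ[K] K),
    SmoothFun P (e.1 ∩ e'.1) (fun x => φ ((e'.2 x).symm (e.2 x v)))

attribute [instance] SmoothVB.addCommGroup SmoothVB.module

namespace SmoothVB

variable {K : Type} [RCLike K] {X : Type*} [TopologicalSpace X] {P : Plots X}
  {F : Type} [AddCommGroup F] [Module K F]

/-- `s` is a smooth section of `B` on the subset `W`. -/
def SmoothSection (B : SmoothVB K P F) (W : Set X) (s : ∀ x, B.fiber x) : Prop :=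
  ∀ e ∈ B.frames, ∀ φ : F →ₗ[K] K, SmoothFun P (W ∩ e.1) (fun x => φ ((e.2 x).symm (s x)))

/-- A fibrewise linear map between two bundles over `X` is smooth. -/
def SmoothHom (B B' : SmoothVB K P F) (A : ∀ x, B.fiber x →ₗ[K] B'.fiber x) : Prop :=
  ∀ e ∈ B.frames, ∀ v : F, B'.SmoothSection e.1 (fun x => A x (e.2 x v))

/-- `B` and `B'` are isomorphic vector bundles. -/
def IsIso (B B' : SmoothVB K P F) : Prop :=
  ∃ A : ∀ x, B.fiber x ≃ₗ[K] B'.fiber x, SmoothHom B B' fun x => (A x).toLinearMap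

end SmoothVB

/-- A smooth principal bundle with structure group `G` over `X`: a family of right `G`-torsors with
an atlas of local sections whose transition functions are smooth. -/
structure PrincipalBundle {X : Type*} [TopologicalSpace X] (P : Plots X) (G : Type) [Group G]
    (PG : Plots G) where
  carrier : X → Type
  mul : ∀ {x : X}, carrier x → G → carrier x
  mul_one : ∀ {x : X} (u : carrier x), mul u 1 = u
  mul_mul : ∀ {x : X} (u : carrier x) (g h : G), mul u (g * h) = mul (mul u g) h
  simply_transitive : ∀ {x : X} (u u' : carrier x), ∃! g : G, mul u g = u'
  sections : Set (Set X × ∀ x, carrier x)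
  isOpen_dom : ∀ s ∈ sections, IsOpen s.1
  cover : ∀ x, ∃ s ∈ sections, x ∈ s.1
  transition : ∀ s ∈ sections, ∀ s' ∈ sections, ∀ (k : ℕ) (γ : Eu k → X) (O : Set (Eu k)),
    IsOpen O → P k γ O → Set.MapsTo γ O (s.1 ∩ s'.1) →
    ∀ g : Eu k → G, (∀ t ∈ O, mul (s.2 (γ t)) (g t) = s'.2 (γ t)) → PG k g O

/-- The family `u` of elements of `Q` over the family `γ` of base points is smooth on `O`. -/
def PrincipalBundle.SmoothFamily {X : Type*} [TopologicalSpace X] {P : Plots X} {G : Type} [Group G]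
    {PG : Plots G} (Q : PrincipalBundle P G PG) {k : ℕ} (γ : Eu k → X)
    (u : ∀ t, Q.carrier (γ t)) (O : Set (Eu k)) : Prop :=
  P k γ O ∧ ∀ s ∈ Q.sections, ∀ O' ⊆ O, IsOpen O' → Set.MapsTo γ O' s.1 →
    ∀ g : Eu k → G, (∀ t ∈ O', Q.mul (s.2 (γ t)) (g t) = u t) → PG k g O'

/-! ### The groups `Spin(n)` and `Spin^c(n)` -/

/-- The quadratic form `v ↦ -‖v‖²` on `ℝⁿ`. -/
def quad (n : ℕ) : QuadraticForm ℝ (Eu n) :=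
  -LinearMap.BilinMap.toQuadraticMap (innerₗ (Eu n))

/-- The Clifford algebra of `ℝⁿ`. -/
abbrev Cl (n : ℕ) := CliffordAlgebra (quad n)

/-- The Clifford algebra with scalars extended to `K`. -/
abbrev ClK (K : Type) [RCLike K] (n : ℕ) := K ⊗[ℝ] Cl n

/-- The vector `v ∈ ℝⁿ` as an element of the Clifford algebra over `K`. -/
def vec (K : Type) [RCLike K] {n : ℕ} (v : Eu n) : ClK K n := 1 ⊗ₜ CliffordAlgebra.ι (quad n) v

/-- The group of products `z a` with `a ∈ Spin(n)` and `z ∈ K` a scalar of absolute value one, inside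
the units of the Clifford algebra over `K`.  For `K = ℂ` it is
`Spin^c(n) = Spin(n) ×_{ℤ/2} U(1)`; for `K = ℝ`, `n ≥ 1` it is `Spin(n)`, which contains `±1`. -/
def spinK (K : Type) [RCLike K] (n : ℕ) : Subgroup (ClK K n)ˣ :=
  ((Units.map (algebraMap K (ClK K n) : K →* ClK K n)).comp Unitary.toUnits).range ⊔
  ((Units.map ((Algebra.TensorProduct.includeRight : Cl n →ₐ[ℝ] ClK K n) : Cl n →* ClK K n)).comp
    spinGroup.toUnits).range

/-- The central scalars of absolute value one: `U(1)` for `K = ℂ`, `{±1}` for `K = ℝ`. -/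
def unitScalar {K : Type} [RCLike K] {n : ℕ} (z : unitary K) : spinK K n :=
  ⟨Units.map (algebraMap K (ClK K n) : K →* ClK K n) (Unitary.toUnits z),
    Subgroup.mem_sup_left ⟨z, rfl⟩⟩

/-- An element of the Clifford algebra over `K`, seen as the value of an element of `spinK K n`. -/
def spinVal {K : Type} [RCLike K] {n : ℕ} (a : spinK K n) : ClK K n := ((a : (ClK K n)ˣ) : ClK K n)

/-- The smooth families in `spinK K n`, as a closed subgroup of a finite dimensional algebra. -/
def spinPlots (K : Type) [RCLike K] (n : ℕ) : Plots (spinK K n) :=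
  fun _ γ O => ∀ φ : ClK K n →ₗ[K] K, ContDiffOn ℝ ∞ (fun t => φ (spinVal (γ t))) O

/-- `a` lies over the rotation `g` under the projection to `SO(n)`: `a v a⁻¹ = g v`. -/
def Covers {K : Type} [RCLike K] {n : ℕ} (a : spinK K n) (g : Eu n ≃ₗᵢ[ℝ] Eu n) : Prop :=
  ∀ v : Eu n, spinVal a * vec K v = vec K (g v) * spinVal a

/-- A nonzero finite dimensional smooth representation of `Spin^c(n)` (or `Spin(n)`) on which the
central scalars act by scalar multiplication, so that associated bundles are modules for the lifting
bundle gerbe.  The irreducible representations with this property (the spin and half spin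
representations among them) are included, for `K = ℝ` also the complex ones, regarded as real. -/
structure IsSpinRep {K : Type} [RCLike K] {n : ℕ} {V : Type} [AddCommGroup V] [Module K V]
    (ρ : Representation K (spinK K n) V) : Prop where
  finite : FiniteDimensional K V
  nontrivial : Nontrivial V
  scalar : ∀ (z : unitary K) (v : V), ρ (unitScalar z) v = (z : K) • v
  smooth : ∀ (v : V) (φ : V →ₗ[K] K), SmoothFun (spinPlots K n) Set.univ (fun a => φ (ρ a v))

/-! ### The oriented orthonormal frame bundle -/

section Frames

variable {m n : ℕ} {M : Type*} [TopologicalSpace M] [ChartedSpace (Eu m) M]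
  {E : M → Type*} [TopologicalSpace (TotalSpace (Eu n) E)]
  [∀ x, NormedAddCommGroup (E x)] [∀ x, InnerProductSpace ℝ (E x)]
  [FiberBundle (Eu n) E]

/-- The fibrewise orientations `o` vary continuously: locally there are continuous oriented
frames. -/
def IsOrientation (o : ∀ x, Orientation ℝ (E x) (Fin n)) : Prop :=
  ∀ x₀, ∃ U : Set M, IsOpen U ∧ x₀ ∈ U ∧ ∃ b : ∀ x, Module.Basis (Fin n) ℝ (E x),
    (∀ i, ContinuousOn (fun x => (⟨x, b x i⟩ : TotalSpace (Eu n) E)) U) ∧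
    ∀ x ∈ U, (b x).orientation = o x

/-- Oriented orthonormal frames of the fibre at `x`. -/
def OFrame (o : ∀ x, Orientation ℝ (E x) (Fin n)) (x : M) : Type _ :=
  {b : OrthonormalBasis (Fin n) ℝ (E x) // b.toBasis.orientation = o x}

/-- The total space `SO(E)` of the bundle of oriented orthonormal frames; the projection to `M` is
the first component. -/
structure SO (o : ∀ x, Orientation ℝ (E x) (Fin n)) where
  pt : M
  fr : OFrame o pt

variable {o : ∀ x, Orientation ℝ (E x) (Fin n)}

/-- The `i`-th vector of a frame as a point of the total space of `E`. -/
def SO.vector (i : Fin n) (y : SO o) : TotalSpace (Eu n) E := ⟨y.1, y.2.1 i⟩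

/-- `SO(E)` is a subspace of the `n`-fold product of the total space of `E`. -/
instance : TopologicalSpace (SO o) := ⨅ i, TopologicalSpace.induced (SO.vector i) inferInstance

/-- A family of frames is smooth if each of its vectors is smooth in the total space of `E`. -/
def framePlots (m : ℕ) [ChartedSpace (Eu m) M] (o : ∀ x, Orientation ℝ (E x) (Fin n)) :
    Plots (SO o) :=
  fun k γ O => ∀ i, ContMDiffOn (𝓡 k) ((𝓡 m).prod 𝓘(ℝ, Eu n)) ∞ (fun t => SO.vector i (γ t)) O

/-- The canonical map `SO(E)^[2] → SO(n)`: the rotation `g` with `f' = f ∘ g`. -/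
def rot {x : M} (f f' : OFrame o x) : Eu n ≃ₗᵢ[ℝ] Eu n := f'.1.repr.symm.trans f.1.repr

/-! ### The lifting bundle gerbe and its modules -/

/-- The fibre `L_(f,f')` over `(f,f') ∈ SO(E)^[2]` of the lifting bundle gerbe: the elements of
`Spin^c(n)` (for `K = ℂ`) or `Spin(n)` (for `K = ℝ`) over the rotation taking `f` to `f'`. -/
def Gerbe (K : Type) [RCLike K] {x : M} (f f' : OFrame o x) : Type :=
  {a : spinK K n // Covers a (rot f f')}

/-- The product `L_(f,f') × L_(f',f'') → L_(f,f'')`. -/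
def Gerbe.mul {K : Type} [RCLike K] {x : M} {f f' f'' : OFrame o x} (l : Gerbe K f f')
    (l' : Gerbe K f' f'') : Gerbe K f f'' :=
  ⟨l.1 * l'.1, fun v => by
    have h := l.2 (rot f' f'' v)
    have h' := l'.2 v
    have e : rot f f' (rot f' f'' v) = rot f f'' v := by simp [rot]
    have e' : spinVal (l.1 * l'.1) = spinVal l.1 * spinVal l'.1 := rfl
    rw [e', mul_assoc, h', ← mul_assoc, h, e, mul_assoc]⟩

/-- The action of the scalars of absolute value one on the fibres of `L`. -/
def Gerbe.smul {K : Type} [RCLike K] {x : M} {f f' : OFrame o x} (z : unitary K)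
    (l : Gerbe K f f') : Gerbe K f f' :=
  ⟨unitScalar z * l.1, fun v => by
    have h := l.2 v
    have e' : spinVal (unitScalar z * l.1) = algebraMap K (ClK K n) (z : K) * spinVal l.1 := rfl
    rw [e', mul_assoc, h, ← mul_assoc, Algebra.commutes, mul_assoc]⟩

/-- A smooth family of elements of `L`, over smooth families of frames. -/
def SmoothGerbeFamily (m : ℕ) [ChartedSpace (Eu m) M] {K : Type} [RCLike K] {k : ℕ} {x : Eu k → M}
    {f f' : ∀ t, OFrame o (x t)} (l : ∀ t, Gerbe K (f t) (f' t)) (O : Set (Eu k)) : Prop :=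
  framePlots m o k (fun t => ⟨x t, f t⟩) O ∧ framePlots m o k (fun t => ⟨x t, f' t⟩) O ∧
    spinPlots K n k (fun t => (l t).1) O

/-- A module for the lifting bundle gerbe `L → SO(E)^[2]`: a vector bundle `S` on `SO(E)` with a
smooth action of `L` by isomorphisms `S_f' → S_f` for `l ∈ L_(f,f')`, linear in the scalars of `L` and
compatible with the product of `L`. -/
structure GerbeModule (K : Type) [RCLike K] (m : ℕ) [ChartedSpace (Eu m) M]
    (o : ∀ x, Orientation ℝ (E x) (Fin n)) (V : Type) [AddCommGroup V] [Module K V] where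
  vb : SmoothVB K (framePlots m o) V
  act : ∀ {x : M} {f f' : OFrame o x}, Gerbe K f f' → (vb.fiber ⟨x, f'⟩ ≃ₗ[K] vb.fiber ⟨x, f⟩)
  act_mul : ∀ {x : M} {f f' f'' : OFrame o x} (l : Gerbe K f f') (l' : Gerbe K f' f'')
    (s : vb.fiber ⟨x, f''⟩), act (l.mul l') s = act l (act l' s)
  act_smul : ∀ {x : M} {f f' : OFrame o x} (z : unitary K) (l : Gerbe K f f')
    (s : vb.fiber ⟨x, f'⟩), act (l.smul z) s = (z : K) • act l s
  act_smooth : ∀ {k : ℕ} {x : Eu k → M} {f f' : ∀ t, OFrame o (x t)}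
    (l : ∀ t, Gerbe K (f t) (f' t)) (O : Set (Eu k)), IsOpen O → SmoothGerbeFamily m l O →
    ∀ e ∈ vb.frames, ∀ e' ∈ vb.frames, (∀ t ∈ O, (⟨x t, f t⟩ : SO o) ∈ e.1) →
    (∀ t ∈ O, (⟨x t, f' t⟩ : SO o) ∈ e'.1) → ∀ (v : V) (φ : V →ₗ[K] K),
    ContDiffOn ℝ ∞
      (fun t => φ ((e.2 ⟨x t, f t⟩).symm (act (l t) (e'.2 ⟨x t, f' t⟩ v)))) O

/-- A lift to `Spin^c(n)` (or `Spin(n)`) of the structure group of the pullback of the frame bundle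
`SO(E) → M` to `SO(E)`: a principal bundle `Q` over `SO(E)` with a smooth bundle map `proj` to the
pullback, whose fibre over `(x,f)` is the set of frames at `x`, covering the projection to
`SO(n)`. -/
structure Lift (K : Type) [RCLike K] (m : ℕ) [ChartedSpace (Eu m) M]
    (o : ∀ x, Orientation ℝ (E x) (Fin n)) extends
    PrincipalBundle (framePlots m o) (spinK K n) (spinPlots K n) where
  proj : ∀ {x : M} {f : OFrame o x}, carrier ⟨x, f⟩ → OFrame o x
  proj_mul : ∀ {x : M} {f : OFrame o x} (u : carrier ⟨x, f⟩) (a : spinK K n),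
    Covers a (rot (proj u) (proj (mul u a)))
  proj_smooth : ∀ {k : ℕ} (γ : Eu k → SO o) (u : ∀ t, carrier (γ t)) (O : Set (Eu k)), IsOpen O →
    toPrincipalBundle.SmoothFamily γ u O →
    framePlots m o k (fun t => ⟨(γ t).1, proj (f := (γ t).2) (u t)⟩) O

/-- A spinor bundle gerbe module with typical fibre the representation `V`: a module `S` for `L`
identified, by means of the frames `frame u : V → S_f` given by the elements `u` of `Q`, with the
bundle `Q ×_{Spin^c(n)} V` associated to a lift `Q` of the structure group of the pullback of `SO(E)`;
the gerbe `L` acts on `S` through a smooth action on `Q` by isomorphisms over the pullback of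
`SO(E)`. -/
structure SpinorModule {K : Type} [RCLike K] (m : ℕ) [ChartedSpace (Eu m) M]
    (o : ∀ x, Orientation ℝ (E x) (Fin n)) {V : Type} [AddCommGroup V] [Module K V]
    (ρ : Representation K (spinK K n) V) where
  S : GerbeModule K m o V
  Q : Lift K m o
  frame : ∀ {y : SO o}, Q.carrier y → (V ≃ₗ[K] S.vb.fiber y)
  frame_mul : ∀ {y : SO o} (u : Q.carrier y) (a : spinK K n) (v : V),
    frame (Q.mul u a) v = frame u (ρ a v)
  frame_smooth : ∀ s ∈ Q.sections, ∀ v : V,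
    S.vb.SmoothSection s.1 (fun y => frame (s.2 y) v)
  actQ : ∀ {x : M} {f f' : OFrame o x}, Gerbe K f f' → Q.carrier ⟨x, f'⟩ → Q.carrier ⟨x, f⟩
  actQ_mul : ∀ {x : M} {f f' f'' : OFrame o x} (l : Gerbe K f f') (l' : Gerbe K f' f'')
    (u : Q.carrier ⟨x, f''⟩), actQ (l.mul l') u = actQ l (actQ l' u)
  actQ_right : ∀ {x : M} {f f' : OFrame o x} (l : Gerbe K f f') (u : Q.carrier ⟨x, f'⟩)
    (a : spinK K n), actQ l (Q.mul u a) = Q.mul (actQ l u) a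
  actQ_proj : ∀ {x : M} {f f' : OFrame o x} (l : Gerbe K f f') (u : Q.carrier ⟨x, f'⟩),
    Q.proj (actQ l u) = Q.proj u
  actQ_frame : ∀ {x : M} {f f' : OFrame o x} (l : Gerbe K f f') (u : Q.carrier ⟨x, f'⟩) (v : V),
    frame (actQ l u) v = S.act l (frame u v)
  actQ_smooth : ∀ {k : ℕ} {x : Eu k → M} {f f' : ∀ t, OFrame o (x t)}
    (l : ∀ t, Gerbe K (f t) (f' t)) (u : ∀ t, Q.carrier ⟨x t, f' t⟩) (O : Set (Eu k)), IsOpen O →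
    SmoothGerbeFamily m l O → Q.SmoothFamily (fun t => ⟨x t, f' t⟩) u O →
    Q.SmoothFamily (fun t => ⟨x t, f t⟩) (fun t => actQ (l t) (u t)) O

variable {K : Type} [RCLike K] {V : Type} [AddCommGroup V] [Module K V]
  {ρ : Representation K (spinK K n) V}

/-- An isomorphism of spinor modules: an isomorphism of gerbe modules together with the isomorphism
of lifts that induces it. -/
structure SpinorIso (S₁ S₂ : SpinorModule m o ρ) where
  lin : ∀ y : SO o, S₁.S.vb.fiber y ≃ₗ[K] S₂.S.vb.fiber y
  lin_smooth : SmoothVB.SmoothHom S₁.S.vb S₂.S.vb fun y => (lin y).toLinearMap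
  lin_act : ∀ {x : M} {f f' : OFrame o x} (l : Gerbe K f f') (s : S₁.S.vb.fiber ⟨x, f'⟩),
    lin ⟨x, f⟩ (S₁.S.act l s) = S₂.S.act l (lin ⟨x, f'⟩ s)
  map : ∀ {y : SO o}, S₁.Q.carrier y → S₂.Q.carrier y
  map_mul : ∀ {y : SO o} (u : S₁.Q.carrier y) (a : spinK K n),
    map (S₁.Q.mul u a) = S₂.Q.mul (map u) a
  map_proj : ∀ {x : M} {f : OFrame o x} (u : S₁.Q.carrier ⟨x, f⟩),
    S₂.Q.proj (map u) = S₁.Q.proj u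
  map_frame : ∀ {y : SO o} (u : S₁.Q.carrier y) (v : V),
    S₂.frame (map u) v = lin y (S₁.frame u v)
  map_actQ : ∀ {x : M} {f f' : OFrame o x} (l : Gerbe K f f') (u : S₁.Q.carrier ⟨x, f'⟩),
    map (S₁.actQ l u) = S₂.actQ l (map u)
  map_smooth : ∀ {k : ℕ} (γ : Eu k → SO o) (u : ∀ t, S₁.Q.carrier (γ t)) (O : Set (Eu k)),
    IsOpen O → S₁.Q.SmoothFamily γ u O → S₂.Q.SmoothFamily γ (fun t => map (u t)) O

/-- Isomorphic spinor modules. -/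
def SpinorModule.IsIso (S₁ S₂ : SpinorModule m o ρ) : Prop := Nonempty (SpinorIso S₁ S₂)

/-- The isomorphism classes of spinor modules. -/
def SpinorClasses (m : ℕ) [ChartedSpace (Eu m) M] (o : ∀ x, Orientation ℝ (E x) (Fin n))
    (ρ : Representation K (spinK K n) V) := Quot (SpinorModule.IsIso (m := m) (o := o) (ρ := ρ))

/-- The isomorphism class of a spinor module. -/
def SpinorModule.toClass (S : SpinorModule m o ρ) : SpinorClasses m o ρ := Quot.mk _ S

end Frames

/-! ### Line bundles on the base -/

section LineBundles

variable {m : ℕ} {M : Type*} [TopologicalSpace M] [ChartedSpace (Eu m) M]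

/-- Smooth `K`-line bundles on `M`. -/
abbrev LineBundle (K : Type) [RCLike K] (m : ℕ) (M : Type*) [TopologicalSpace M]
    [ChartedSpace (Eu m) M] := SmoothVB K (manifoldPlots m M) K

/-- A smooth Hermitian (for `K = ℝ`: Euclidean) metric on a line bundle, through its norm. -/
structure LineMetric {K : Type} [RCLike K] (N : LineBundle K m M) where
  norm : ∀ {x : M}, N.fiber x → ℝ
  norm_smul : ∀ {x : M} (c : K) (w : N.fiber x), norm (c • w) = ‖c‖ * norm w
  norm_pos : ∀ {x : M} (w : N.fiber x), w ≠ 0 → 0 < norm w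
  smooth : ∀ e ∈ N.frames, SmoothFun (manifoldPlots m M) e.1 (fun x => norm (e.2 x 1))

variable {n : ℕ} {E : M → Type*} [TopologicalSpace (TotalSpace (Eu n) E)]
  [∀ x, NormedAddCommGroup (E x)] [∀ x, InnerProductSpace ℝ (E x)]
  [FiberBundle (Eu n) E] {o : ∀ x, Orientation ℝ (E x) (Fin n)}
  {K : Type} [RCLike K] {V : Type} [AddCommGroup V] [Module K V]
  {ρ : Representation K (spinK K n) V}

/-- An identification of the spinor module `S₂` with the tensor product of `S₁` and the pullback of
the line bundle `N` on `M`.  On vector bundles it is an isomorphism `lin` from the tensor product, on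
which `L` acts through the first factor; on lifts, after the choice of a metric on `N`, an
identification of `Q₂` with the product of `Q₁` and the bundle of unit vectors of `N`, the frame
given by `u` and `w` being `v ↦ frame u v ⊗ w`. -/
structure SpinorTensor (S₁ : SpinorModule m o ρ) (N : LineBundle K m M)
    (S₂ : SpinorModule m o ρ) where
  metric : LineMetric N
  lin : ∀ {x : M} (f : OFrame o x), S₁.S.vb.fiber ⟨x, f⟩ ⊗[K] N.fiber x ≃ₗ[K] S₂.S.vb.fiber ⟨x, f⟩
  lin_smooth : ∀ e ∈ S₁.S.vb.frames, ∀ η ∈ N.frames, ∀ v : V,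
    S₂.S.vb.SmoothSection (e.1 ∩ {y | y.1 ∈ η.1})
      (fun y => lin y.2 (e.2 y v ⊗ₜ η.2 y.1 1))
  lin_act : ∀ {x : M} {f f' : OFrame o x} (l : Gerbe K f f') (s : S₁.S.vb.fiber ⟨x, f'⟩)
    (w : N.fiber x), lin f (S₁.S.act l s ⊗ₜ w) = S₂.S.act l (lin f' (s ⊗ₜ w))
  map : ∀ {x : M} {f : OFrame o x}, S₁.Q.carrier ⟨x, f⟩ → {w : N.fiber x // metric.norm w = 1} →
    S₂.Q.carrier ⟨x, f⟩
  map_mul : ∀ {x : M} {f : OFrame o x} (u : S₁.Q.carrier ⟨x, f⟩)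
    (w : {w : N.fiber x // metric.norm w = 1}) (a : spinK K n),
    map (S₁.Q.mul u a) w = S₂.Q.mul (map u w) a
  map_proj : ∀ {x : M} {f : OFrame o x} (u : S₁.Q.carrier ⟨x, f⟩)
    (w : {w : N.fiber x // metric.norm w = 1}), S₂.Q.proj (map u w) = S₁.Q.proj u
  map_frame : ∀ {x : M} {f : OFrame o x} (u : S₁.Q.carrier ⟨x, f⟩)
    (w : {w : N.fiber x // metric.norm w = 1}) (v : V),
    S₂.frame (map u w) v = lin f (S₁.frame u v ⊗ₜ w.1)
  map_actQ : ∀ {x : M} {f f' : OFrame o x} (l : Gerbe K f f') (u : S₁.Q.carrier ⟨x, f'⟩)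
    (w : {w : N.fiber x // metric.norm w = 1}), map (S₁.actQ l u) w = S₂.actQ l (map u w)
  map_smooth : ∀ {k : ℕ} (γ : Eu k → SO o) (u : ∀ t, S₁.Q.carrier (γ t)) (O : Set (Eu k)),
    IsOpen O → S₁.Q.SmoothFamily γ u O →
    ∀ (W : Set M) (w : ∀ x, {w : N.fiber x // metric.norm w = 1}),
    IsOpen W → N.SmoothSection W (fun x => (w x).1) → (∀ t ∈ O, (γ t).1 ∈ W) →
    S₂.Q.SmoothFamily γ (fun t => map (f := (γ t).2) (u t) (w (γ t).1)) O

/-- `S₂` is isomorphic to the tensor product of `S₁` and the pullback of `N`. -/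
def IsTensor (S₁ : SpinorModule m o ρ) (N : LineBundle K m M) (S₂ : SpinorModule m o ρ) : Prop :=
  Nonempty (SpinorTensor S₁ N S₂)

end LineBundles

/-! ### Čech cohomology

Every open cover is refined by one of the form `(U_p)` indexed by the points of `X`, with `p ∈ U_p`,
and such covers are directed under pointwise inclusion.  A cochain is a family of functions
`c_{p₀…p_k}`, of which only the values on `U_{p₀} ∩ … ∩ U_{p_k}` for small enough `U` matter. -/

section Cech

/-- A choice of an open neighbourhood of every point. -/
def IsNbhds {X : Type*} [TopologicalSpace X] (U : X → Set X) : Prop :=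
  ∀ p, IsOpen (U p) ∧ p ∈ U p

/-- The intersection `U_{σ 0} ∩ … ∩ U_{σ k}`. -/
def overlap {X : Type*} (U : X → Set X) {k : ℕ} (σ : Fin (k + 1) → X) : Set X := ⋂ i, U (σ i)

lemma IsNbhds.inter {X : Type*} [TopologicalSpace X] {U U' : X → Set X} (h : IsNbhds U)
    (h' : IsNbhds U') : IsNbhds fun p => U p ∩ U' p :=
  fun p => ⟨(h p).1.inter (h' p).1, (h p).2, (h' p).2⟩

lemma overlap_inter {X : Type*} {U U' : X → Set X} {k : ℕ} {σ : Fin (k + 1) → X} {x : X}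
    (hx : x ∈ overlap (fun p => U p ∩ U' p) σ) : x ∈ overlap U σ ∧ x ∈ overlap U' σ := by
  simp only [overlap, Set.mem_iInter] at hx ⊢
  exact ⟨fun i => (hx i).1, fun i => (hx i).2⟩

/-- Families of functions indexed by `(k+1)`-tuples of points. -/
abbrev PreCochain (X : Type*) (A : Type*) (k : ℕ) := (Fin (k + 1) → X) → X → A

/-- The Čech coboundary. -/
def cechDelta {X A : Type*} [AddCommGroup A] {k : ℕ} : PreCochain X A k →+ PreCochain X A (k + 1) where
  toFun c σ x := ∑ i : Fin (k + 2), (-1 : ℤ) ^ (i : ℕ) • c (fun j => σ (i.succAbove j)) x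
  map_zero' := by ext; simp
  map_add' c c' := by ext; simp [Finset.sum_add_distrib]

variable (X : Type*) [TopologicalSpace X] (A : Type*) [AddCommGroup A] (k : ℕ)

/-- Čech cochains with coefficients in the constant sheaf `A`. -/
def cechC : AddSubgroup (PreCochain X A k) where
  carrier := {c | ∃ U, IsNbhds U ∧ ∀ σ, ∀ x ∈ overlap U σ, ∀ᶠ y in 𝓝 x, c σ y = c σ x}
  zero_mem' := ⟨fun _ => Set.univ, fun _ => ⟨isOpen_univ, trivial⟩, fun _ _ _ => by simp⟩
  add_mem' := by
    rintro c c' ⟨U, hU, h⟩ ⟨U', hU', h'⟩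
    refine ⟨_, hU.inter hU', fun σ x hx => ?_⟩
    filter_upwards [h σ x (overlap_inter hx).1, h' σ x (overlap_inter hx).2] with y hy hy'
    simp [hy, hy']
  neg_mem' := by
    rintro c ⟨U, hU, h⟩
    refine ⟨U, hU, fun σ x hx => ?_⟩
    filter_upwards [h σ x hx] with y hy
    simp [hy]

/-- The cochains that vanish after refinement of the cover. -/
def cechNull : AddSubgroup (PreCochain X A k) where
  carrier := {c | ∃ U, IsNbhds U ∧ ∀ σ, ∀ x ∈ overlap U σ, c σ x = 0}
  zero_mem' := ⟨fun _ => Set.univ, fun _ => ⟨isOpen_univ, trivial⟩, fun _ _ _ => by simp⟩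
  add_mem' := by
    rintro c c' ⟨U, hU, h⟩ ⟨U', hU', h'⟩
    refine ⟨_, hU.inter hU', fun σ x hx => ?_⟩
    simp [h σ x (overlap_inter hx).1, h' σ x (overlap_inter hx).2]
  neg_mem' := by
    rintro c ⟨U, hU, h⟩
    exact ⟨U, hU, fun σ x hx => by simp [h σ x hx]⟩

/-- Čech cocycles. -/
def cechZ : AddSubgroup (PreCochain X A k) := cechC X A k ⊓ (cechNull X A (k + 1)).comap cechDelta

/-- Čech coboundaries in degree `k + 1`. -/
def cechB : AddSubgroup (PreCochain X A (k + 1)) :=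
  (cechC X A k).map cechDelta ⊔ cechNull X A (k + 1)

/-- The Čech cohomology group `H^(k+1)(X, A)`. -/
abbrev cechH : Type _ := cechZ X A (k + 1) ⧸ (cechB X A k).addSubgroupOf (cechZ X A (k + 1))

abbrev H1 := cechH X A 0
abbrev H2 := cechH X A 1
abbrev H3 := cechH X A 2

variable {X A k}

/-- The cohomology class of a cocycle. -/
def cechClass (c : cechZ X A (k + 1)) : cechH X A k := QuotientAddGroup.mk c

/-- `d` is the image of `w` under the Bockstein homomorphism of `0 → ℤ → ℤ → ℤ/2 → 0`: lift a cocycle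
for `w` to an integral cochain; its coboundary is twice a cocycle for `d`. -/
def IsBockstein (w : H2 X (ZMod 2)) (d : H3 X ℤ) : Prop :=
  ∃ (U : X → Set X) (b : PreCochain X ℤ 2) (c : cechZ X (ZMod 2) 2) (z : cechZ X ℤ 3),
    IsNbhds U ∧ b ∈ cechC X ℤ 2 ∧ cechClass c = w ∧ cechClass z = d ∧
    (∀ σ, ∀ x ∈ overlap U σ, ((b σ x : ℤ) : ZMod 2) = c.1 σ x) ∧
    (∀ σ, ∀ x ∈ overlap U σ, cechDelta b σ x = 2 * z.1 σ x)

end Cech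

/-! ### Characteristic classes -/

section Classes

variable {m n : ℕ} {M : Type*} [TopologicalSpace M] [ChartedSpace (Eu m) M]

/-- `c` is the first Chern class of the complex line bundle `N`: for local frames `s_p` with
`s_q = exp(2πi r_pq) s_p`, it is the class of the coboundary of `r`. -/
def IsChernClass (N : LineBundle ℂ m M) (c : H2 M ℤ) : Prop :=
  ∃ (U : M → Set M) (s : M → ∀ x, N.fiber x) (r : PreCochain M ℂ 1) (z : cechZ M ℤ 2),
    IsNbhds U ∧ (∀ p, N.SmoothSection (U p) (s p) ∧ ∀ x ∈ U p, s p x ≠ 0) ∧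
    (∀ σ, ContinuousOn (r σ) (overlap U σ)) ∧
    (∀ σ, ∀ x ∈ overlap U σ,
      s (σ 1) x = Complex.exp (2 * Real.pi * Complex.I * r σ x) • s (σ 0) x) ∧
    (∀ σ, ∀ x ∈ overlap U σ, cechDelta r σ x = (z.1 σ x : ℂ)) ∧ cechClass z = c

/-- `c` is the first Stiefel–Whitney class of the real line bundle `N`: the class of the signs of
the transition functions. -/
def IsSW1 (N : LineBundle ℝ m M) (c : H1 M (ZMod 2)) : Prop :=
  ∃ (U : M → Set M) (s : M → ∀ x, N.fiber x) (z : cechZ M (ZMod 2) 1),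
    IsNbhds U ∧ (∀ p, N.SmoothSection (U p) (s p) ∧ ∀ x ∈ U p, s p x ≠ 0) ∧
    (∀ σ, ∀ x ∈ overlap U σ, ∃ g : ℝ, 0 < g ∧
      s (σ 1) x = ((-1) ^ (z.1 σ x).val * g) • s (σ 0) x) ∧ cechClass z = c

variable {E : M → Type*} [TopologicalSpace (TotalSpace (Eu n) E)]
  [∀ x, NormedAddCommGroup (E x)] [∀ x, InnerProductSpace ℝ (E x)]
  [FiberBundle (Eu n) E]

/-- The `s p` are smooth local sections of `SO(E)` over the sets `U p`. -/
def IsLocalSections (m : ℕ) [ChartedSpace (Eu m) M] {o : ∀ x, Orientation ℝ (E x) (Fin n)}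
    (U : M → Set M) (s : M → ∀ x, OFrame o x) : Prop :=
  ∀ p i, ContMDiffOn (𝓡 m) ((𝓡 m).prod 𝓘(ℝ, Eu n)) ∞
    (fun x => (⟨x, (s p x).1 i⟩ : TotalSpace (Eu n) E)) (U p)

/-- The `a σ`, `σ = (p, q)`, are smooth local sections over `U p ∩ U q` of the pullback of the lifting
bundle gerbe under `(s p, s q)`. -/
def IsGerbeSections (m : ℕ) [ChartedSpace (Eu m) M] {K : Type} [RCLike K]
    {o : ∀ x, Orientation ℝ (E x) (Fin n)} (U : M → Set M) (s : M → ∀ x, OFrame o x)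
    (a : PreCochain M (spinK K n) 1) : Prop :=
  ∀ σ, (∀ x ∈ overlap U σ, Covers (a σ x) (rot (s (σ 0) x) (s (σ 1) x))) ∧
    ∀ φ : ClK K n →ₗ[K] K, ContMDiffOn (𝓡 m) 𝓘(ℝ, K) ∞ (fun x => φ (spinVal (a σ x))) (overlap U σ)

/-- `d` is the Dixmier–Douady class of the `Spin^c` lifting bundle gerbe: for local sections `s_p` of
`SO(E)` and sections `a_pq` of `L` over `(s_p, s_q)`, with `a_pq a_qt = exp(2πi r_pqt) a_pt`, it is the
class of the coboundary of `r`. -/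
def IsDDClass (m : ℕ) [ChartedSpace (Eu m) M] (o : ∀ x, Orientation ℝ (E x) (Fin n))
    (d : H3 M ℤ) : Prop :=
  ∃ (U : M → Set M) (s : M → ∀ x, OFrame o x) (a : PreCochain M (spinK ℂ n) 1)
    (r : PreCochain M ℝ 2) (z : cechZ M ℤ 3),
    IsNbhds U ∧ IsLocalSections m U s ∧ IsGerbeSections m U s a ∧
    (∀ σ, ContinuousOn (r σ) (overlap U σ)) ∧
    (∀ σ, ∀ x ∈ overlap U σ,
      spinVal (a ![σ 0, σ 1] x * a ![σ 1, σ 2] x) =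
        Complex.exp (2 * Real.pi * Complex.I * r σ x) • spinVal (a ![σ 0, σ 2] x)) ∧
    (∀ σ, ∀ x ∈ overlap U σ, cechDelta r σ x = (z.1 σ x : ℝ)) ∧ cechClass z = d

/-- `w` is the real version of the Dixmier–Douady class of the `Spin` lifting bundle gerbe. -/
def IsRealDDClass (m : ℕ) [ChartedSpace (Eu m) M] (o : ∀ x, Orientation ℝ (E x) (Fin n))
    (w : H2 M (ZMod 2)) : Prop :=
  ∃ (U : M → Set M) (s : M → ∀ x, OFrame o x) (a : PreCochain M (spinK ℝ n) 1)
    (z : cechZ M (ZMod 2) 2),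
    IsNbhds U ∧ IsLocalSections m U s ∧ IsGerbeSections m U s a ∧
    (∀ σ, ∀ x ∈ overlap U σ,
      spinVal (a ![σ 0, σ 1] x * a ![σ 1, σ 2] x) =
        (-1 : ℝ) ^ (z.1 σ x).val • spinVal (a ![σ 0, σ 2] x)) ∧ cechClass z = w

/-- `w` is the second Stiefel–Whitney class of the oriented bundle `E`: the transition functions
`g_pq` of local oriented orthonormal frames are lifted to maps `a_pq` into `Spin(n)`, and `w` is the
class of the `ℤ/2`-cocycle `a_pq a_qt a_pt⁻¹ = ± 1`. -/
def IsSW2 (m : ℕ) [ChartedSpace (Eu m) M] (o : ∀ x, Orientation ℝ (E x) (Fin n))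
    (w : H2 M (ZMod 2)) : Prop :=
  ∃ (U : M → Set M) (s : M → ∀ x, OFrame o x) (a : PreCochain M (spinGroup (quad n)) 1)
    (z : cechZ M (ZMod 2) 2),
    IsNbhds U ∧ IsLocalSections m U s ∧
    (∀ σ, ∀ x ∈ overlap U σ, ∀ v : Eu n,
      (a σ x : Cl n) * CliffordAlgebra.ι (quad n) v * ((a σ x)⁻¹ : spinGroup (quad n)) =
        CliffordAlgebra.ι (quad n) (rot (s (σ 0) x) (s (σ 1) x) v)) ∧
    (∀ σ, ∀ φ : Cl n →ₗ[ℝ] ℝ, ContMDiffOn (𝓡 m) 𝓘(ℝ, ℝ) ∞ (fun x => φ (a σ x)) (overlap U σ)) ∧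
    (∀ σ, ∀ x ∈ overlap U σ,
      (a ![σ 0, σ 1] x : Cl n) * a ![σ 1, σ 2] x =
        (-1 : ℝ) ^ (z.1 σ x).val • (a ![σ 0, σ 2] x : Cl n)) ∧ cechClass z = w

/-- `d` is the third integral Stiefel–Whitney class `W₃(E) = β w₂(E)`. -/
def IsW3 (m : ℕ) [ChartedSpace (Eu m) M] (o : ∀ x, Orientation ℝ (E x) (Fin n))
    (d : H3 M ℤ) : Prop :=
  ∃ w : H2 M (ZMod 2), IsSW2 m o w ∧ IsBockstein w d

end Classes

/-! ### The parametrisation of spinor modules -/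

section Parametrisation

variable {m n : ℕ} {M : Type*} [TopologicalSpace M] [ChartedSpace (Eu m) M]
  {E : M → Type*} [TopologicalSpace (TotalSpace (Eu n) E)]
  [∀ x, NormedAddCommGroup (E x)] [∀ x, InnerProductSpace ℝ (E x)]
  [FiberBundle (Eu n) E] {K : Type} [RCLike K] {V : Type} [AddCommGroup V] [Module K V]

/-- Spinor modules with typical fibre `ρ` exist, the line bundles on `M` act simply transitively on
their isomorphism classes by tensor product with the pullback, and the characteristic class `cls`
classifies line bundles by the group `H`, which therefore acts simply transitively too. -/
structure ParametrisedBy (m : ℕ) [ChartedSpace (Eu m) M]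
    (o : ∀ x, Orientation ℝ (E x) (Fin n)) (ρ : Representation K (spinK K n) V)
    {H : Type*} [AddCommGroup H] (cls : LineBundle K m M → H → Prop) : Prop where
  nonempty : Nonempty (SpinorModule m o ρ)
  tensor_exists : ∀ (S : SpinorModule m o ρ) (N : LineBundle K m M),
    ∃ S' : SpinorModule m o ρ, IsTensor S N S'
  tensor_unique : ∀ (S : SpinorModule m o ρ) (N : LineBundle K m M) (S' S'' : SpinorModule m o ρ),
    IsTensor S N S' → (IsTensor S N S'' ↔ S'.IsIso S'')
  transitive : ∀ S₁ S₂ : SpinorModule m o ρ, ∃ N : LineBundle K m M, IsTensor S₁ N S₂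
  free : ∀ (S₁ S₂ : SpinorModule m o ρ) (N N' : LineBundle K m M),
    IsTensor S₁ N S₂ → (IsTensor S₁ N' S₂ ↔ N.IsIso N')
  cls_exists_unique : ∀ N : LineBundle K m M, ∃! c : H, cls N c
  cls_surjective : ∀ c : H, ∃ N : LineBundle K m M, cls N c
  cls_iso : ∀ (N N' : LineBundle K m M) (c c' : H), cls N c → cls N' c' → (c = c' ↔ N.IsIso N')
  action : ∃ _ : AddAction H (SpinorClasses m o ρ),
    (∀ (c : H) (S S' : SpinorModule m o ρ),
      c +ᵥ S.toClass = S'.toClass ↔ ∃ N : LineBundle K m M, cls N c ∧ IsTensor S N S') ∧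
    ∀ a b : SpinorClasses m o ρ, ∃! c : H, c +ᵥ a = b

end Parametrisation

end SpinorGerbe

end

set_option linter.unusedSectionVars false

open Bundle Manifold ContDiff TensorProduct Topology
noncomputable section
namespace SpinorGerbe

/-! ### Clifford algebra: scalars as the graded centre, and the covering of rotations by the spin
group. -/

section Clifford

open CliffordAlgebra

variable {n : ℕ}

/-! The kernel of `spinK K n → SO(n)` consists of the unit scalars (`Covers.eq_unitScalar`), where
unit scalars means `U(1)` for `K = ℂ` and `{±1}` for `K = ℝ`. This rests on the fact that an even
Clifford element commuting with all vectors is a scalar. Smooth local lifts along this projection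
come from averaging inside the Clifford algebra instead of covering space theory
(`exists_local_spin_lift`).

Classification of spinor modules. Over a point `x` of `M` the gerbe and the structure group together
act transitively on all elements of a lift, so an equivariant isomorphism is fixed by the image of
one element, and that image must have the same frame as projection. Hence, smoothness aside, two
spinor modules are always isomorphic (`AlgIso.nonempty`), and two isomorphisms differ by a function
on `M` with values in the unit scalars (`AlgIso.exists_twist`). Near every point such a function can
be chosen to make a given isomorphism smooth (`AlgIso.exists_twist_smoothOn`). The local corrections
are the local sections of a principal bundle of unit scalars on `M` (a `UAtlas`), the difference of
the two modules. It exists (`exists_isDiff`), is unique up to equivalence (`IsDiff.iff_equiv`), and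
every such bundle occurs (`isDiff_twist`). Passing to unit vectors identifies line bundles with
these bundles, and tensor products with differences (`IsAt.isIso_iff`, `IsAt.isTensor_iff`). Modules
exist without any obstruction because they live on `SO(E)`: the elements of `L` are elements of the
spin group and act on the trivial bundle with fibre `V` (`canonicalModule`).

Classes of unit bundles. For `U(1)` the exponential sequence and partitions of unity show that `c₁`
is well defined, injective and surjective (`isClassifying_isChern`). For `{±1}` the transition
functions already are a Čech cocycle (`isClassifying_isSW1`).

Classes of the gerbes. Lifts of the transition functions of frames to `Spin(n)` multiply up to signs
`(-1)^c`, and `c` represents `w₂` as well as the real Dixmier–Douady class. In `Spin^c(n)` the same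
sign is `exp(2πi · c̃/2)` with `c̃` an integral lift of `c`, so the Dixmier–Douady cocycle is
`δ(c̃)/2`, which is the Bockstein cocycle of `c` (`exists_isDDClass`). Independence of choices
follows by comparing two systems of local data through scalar functions
(`IsGerbeSections.exists_comparison`). -/

lemma quad_apply (v : Eu n) : quad n v = -(‖v‖ ^ 2) := by
  simp [quad]

lemma ι_mul_self (v : Eu n) : ι (quad n) v * ι (quad n) v = algebraMap ℝ (Cl n) (-(‖v‖ ^ 2)) := by
  rw [ι_sq_scalar, quad_apply]

lemma ι_mul_add_swap (v w : Eu n) :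
    ι (quad n) v * ι (quad n) w + ι (quad n) w * ι (quad n) v =
      algebraMap ℝ (Cl n) (-2 * inner ℝ v w) := by
  rw [ι_mul_ι_add_swap, QuadraticMap.polar, quad_apply, quad_apply, quad_apply,
    norm_add_sq_real]
  congr 1; ring

lemma ι_injective : Function.Injective (ι (quad n)) := by
  refine (injective_iff_map_eq_zero _).2 fun v hv => ?_
  have h : ∀ d : Module.Dual ℝ (Eu n), d v = 0 := fun d => by
    have h1 := contractLeft_ι (Q := quad n) d v
    rw [hv, map_zero] at h1
    exact ((algebraMap ℝ (Cl n)).injective (by rw [← h1, map_zero]))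
  exact (Module.forall_dual_apply_eq_zero_iff ℝ v).1 h

/-- The Clifford generator given by the `i`-th standard basis vector. -/
def cgen (i : Fin n) : Cl n := ι (quad n) (EuclideanSpace.basisFun (Fin n) ℝ i)

lemma cgen_mul_self (i : Fin n) : cgen i * cgen i = -1 := by
  rw [cgen, ι_mul_self]; simp

lemma cgen_mul_swap {i j : Fin n} (h : i ≠ j) : cgen i * cgen j = -(cgen j * cgen i) := by
  have := ι_mul_add_swap (EuclideanSpace.basisFun (Fin n) ℝ i) (EuclideanSpace.basisFun (Fin n) ℝ j)
  rw [(EuclideanSpace.basisFun (Fin n) ℝ).inner_eq_zero h] at this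
  simp only [mul_zero, map_zero] at this
  exact eq_neg_of_add_eq_zero_left this

/-- The product of a word in the generators. -/
def word (l : List (Fin n)) : Cl n := (l.map cgen).prod

@[simp] lemma word_nil : word ([] : List (Fin n)) = 1 := rfl
@[simp] lemma word_cons (i : Fin n) (l : List (Fin n)) : word (i :: l) = cgen i * word l := by
  simp [word]

/-- Moving `cgen i` past a different generator costs a sign that the involution cancels. Past `cgen
i` itself only the sign of the involution remains. -/
lemma cgen_mul_involute_word (i : Fin n) (l : List (Fin n)) :
    cgen i * involute (word l) = (-1 : ℝ) ^ (l.count i) • (word l * cgen i) := by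
  induction l with
  | nil => simp
  | cons j l ih =>
    rw [word_cons, map_mul, show involute (cgen j) = -cgen j from involute_ι _, List.count_cons]
    by_cases h : j = i
    · subst h
      rw [neg_mul, mul_neg, ← neg_mul, mul_assoc] at *
      simp only [beq_self_eq_true, if_true, pow_succ]
      rw [neg_mul, ih]; simp
    · rw [neg_mul, mul_neg, ← mul_assoc, cgen_mul_swap (Ne.symm h), neg_mul, neg_neg, mul_assoc, ih]
      simp [h, mul_assoc]

lemma cgen_mul_word_of_mem {i : Fin n} {l : List (Fin n)} (h : i ∈ l) :
    ∃ c : ℝ, cgen i * word l = c • word (l.erase i) := by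
  induction l with
  | nil => simp at h
  | cons j l ih =>
    by_cases hj : j = i
    · subst hj
      refine ⟨-1, ?_⟩
      rw [word_cons, ← mul_assoc, cgen_mul_self]; simp
    · obtain ⟨c, hc⟩ := ih (by simpa [Ne.symm hj] using h)
      refine ⟨-c, ?_⟩
      rw [word_cons, ← mul_assoc, cgen_mul_swap (Ne.symm hj), neg_mul, mul_assoc, hc,
        List.erase_cons_tail (by simpa using hj), word_cons]
      simp

/-- The span of the words without repetitions is the whole Clifford algebra. -/
lemma span_nodup_words :
    Submodule.span ℝ (Set.range fun l : {l : List (Fin n) // l.Nodup} => word l.1) = ⊤ := by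
  set S := Submodule.span ℝ (Set.range fun l : {l : List (Fin n) // l.Nodup} => word l.1) with hS
  have hgen : ∀ (i : Fin n), ∀ x ∈ S, cgen i * x ∈ S := fun i x hx => by
    induction hx using Submodule.span_induction with
    | mem x h =>
      obtain ⟨⟨l, hl⟩, rfl⟩ := h
      by_cases hi : i ∈ l
      · obtain ⟨c, hc⟩ := cgen_mul_word_of_mem hi
        simp only [hc]
        exact S.smul_mem _ (Submodule.subset_span ⟨⟨_, hl.erase i⟩, rfl⟩)
      · exact Submodule.subset_span ⟨⟨i :: l, List.nodup_cons.2 ⟨hi, hl⟩⟩, by simp⟩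
    | zero => simp
    | add x y _ _ hx hy => rw [mul_add]; exact S.add_mem hx hy
    | smul c x _ hx => rw [mul_smul_comm]; exact S.smul_mem _ hx
  have hι : ∀ (v : Eu n), ∀ x ∈ S, ι (quad n) v * x ∈ S := fun v x hx => by
    rw [← (EuclideanSpace.basisFun (Fin n) ℝ).sum_repr v, map_sum, Finset.sum_mul]
    refine S.sum_mem fun i _ => ?_
    rw [map_smul, smul_mul_assoc]
    exact S.smul_mem _ (hgen i x hx)
  have h1 : (1 : Cl n) ∈ S := Submodule.subset_span ⟨⟨[], List.nodup_nil⟩, rfl⟩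
  refine eq_top_iff.2 fun x _ => ?_
  -- Stability of `S` under left multiplication, unlike membership in `S`, passes to products of
  -- elements.
  suffices ∀ y ∈ S, x * y ∈ S by simpa using this 1 h1
  induction x using CliffordAlgebra.induction with
  | algebraMap r => intro y hy; rw [← Algebra.smul_def]; exact S.smul_mem _ hy
  | ι v => exact hι v
  | mul a b ha hb => intro y hy; rw [mul_assoc]; exact ha trivial _ (hb trivial _ hy)
  | add a b ha hb => intro y hy; rw [add_mul]; exact S.add_mem (ha trivial _ hy) (hb trivial _ hy)

/-- Smoothness is tested through linear functionals, and products of such maps are smooth only in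
finite dimension (`WSm.mul`). Duplicate-free words over `Fin n` are finite in number. -/
instance : Module.Finite ℝ (Cl n) := by
  have : Finite {l : List (Fin n) // l.Nodup} := Finite.of_fintype _
  exact ⟨Submodule.fg_def.2 ⟨_, Set.finite_range _, span_nodup_words⟩⟩

/-- The projection to the elements that commute with `cgen i` in the graded sense. -/
def gproj (i : Fin n) : Cl n →ₗ[ℝ] Cl n :=
  (2⁻¹ : ℝ) • (LinearMap.id - (LinearMap.mulLeft ℝ (cgen i) ∘ₗ LinearMap.mulRight ℝ (cgen i)) ∘ₗ
    involute.toLinearMap)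

lemma gproj_apply (i : Fin n) (x : Cl n) :
    gproj i x = (2⁻¹ : ℝ) • (x - cgen i * (involute x * cgen i)) := rfl

lemma gproj_word (i : Fin n) (l : List (Fin n)) :
    gproj i (word l) = if Even (l.count i) then word l else 0 := by
  rw [gproj_apply, ← mul_assoc, cgen_mul_involute_word, smul_mul_assoc, mul_assoc, cgen_mul_self]
  split_ifs with h
  · rw [h.neg_one_pow]; simp only [one_smul, mul_neg, mul_one, sub_neg_eq_add]
    rw [← two_smul ℝ, smul_smul]; norm_num
  · rw [(Nat.not_even_iff_odd.1 h).neg_one_pow]; simp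

/-- An element that commutes with all vectors in the graded sense is a scalar. -/
lemma mem_scalars_of_graded_central {x : Cl n}
    (hx : ∀ v, ι (quad n) v * involute x = x * ι (quad n) v) : ∃ r : ℝ, x = algebraMap ℝ (Cl n) r := by
  -- Composing the projections `gproj i` gives a map that fixes `x` but kills words. Linear
  -- independence of the words is therefore never needed: spanning is enough.
  have key : ∀ L : List (Fin n), ∃ T : Cl n →ₗ[ℝ] Cl n, T x = x ∧
      ∀ l, T (word l) = if ∀ i ∈ L, Even (l.count i) then word l else 0 := fun L => by
    induction L with
    | nil => exact ⟨LinearMap.id, rfl, by simp⟩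
    | cons i L ih =>
      obtain ⟨T, h1, h2⟩ := ih
      refine ⟨gproj i ∘ₗ T, ?_, fun l => ?_⟩
      · rw [LinearMap.comp_apply, h1, gproj_apply, ← mul_assoc, cgen, hx, mul_assoc]
        change (2⁻¹ : ℝ) • (x - x * (cgen i * cgen i)) = x
        rw [cgen_mul_self, mul_neg, mul_one, sub_neg_eq_add, ← two_smul ℝ, smul_smul]; norm_num
      · rw [LinearMap.comp_apply, h2]
        by_cases h : ∀ i ∈ L, Even (l.count i)
        · rw [if_pos h, gproj_word]; congr 1; rw [List.forall_mem_cons, and_iff_left h]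
        · rw [if_neg h, map_zero, if_neg]
          exact fun h' => h fun j hj => h' j (List.mem_cons_of_mem _ hj)
  obtain ⟨T, h1, h2⟩ := key (List.finRange n)
  -- A duplicate-free word in which every generator occurs an even number of times is empty, so only
  -- scalars survive `T`.
  have h3 : ∀ y : Cl n, T y ∈ LinearMap.range (Algebra.linearMap ℝ (Cl n)) := fun y => by
    have hy : y ∈ Submodule.span ℝ (Set.range fun l : {l : List (Fin n) // l.Nodup} => word l.1) := by
      rw [span_nodup_words]; trivial
    induction hy using Submodule.span_induction with
    | mem y h =>
      obtain ⟨⟨l, hl⟩, rfl⟩ := h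
      simp only [h2]
      cases l with
      | nil => simp only [List.count_nil, Even.zero, implies_true, if_true]; exact ⟨1, by simp⟩
      | cons i l =>
        rw [if_neg]
        · exact Submodule.zero_mem _
        · intro h
          have := h i (List.mem_finRange i)
          rw [List.count_eq_one_of_mem hl List.mem_cons_self] at this
          exact absurd this (by decide)
    | zero => simp
    | add a b _ _ ha hb => rw [map_add]; exact Submodule.add_mem _ ha hb
    | smul c a _ ha => rw [map_smul]; exact Submodule.smul_mem _ _ ha
  obtain ⟨r, hr⟩ := h3 x
  exact ⟨r, by rw [← h1, ← hr]; rfl⟩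

lemma mem_even_of_involute_eq {x : Cl n} (h : involute x = x) : x ∈ even (quad n) := by
  have hx : x ∈ evenOdd (quad n) 0 ⊔ evenOdd (quad n) 1 := by
    rw [(evenOdd_isCompl (quad n)).sup_eq_top]; trivial
  obtain ⟨a, ha, b, hb, rfl⟩ := Submodule.mem_sup.1 hx
  rw [map_add, involute_eq_of_mem_even ha, involute_eq_of_mem_odd hb] at h
  have : b = 0 := by
    have h' : -b = b := add_left_cancel h
    have h2 : (2 : ℝ) • b = 0 := by rw [two_smul]; nth_rewrite 1 [← h']; simp
    simpa using h2
  subst this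
  rw [add_zero]; exact ha

/-- With the sign convention of `quad`, a unit vector squares to `-1`, so its inverse is `-ι u`,
which is also its star. -/
lemma ι_mem_pinGroup {u : Eu n} (hu : ‖u‖ = 1) : ι (quad n) u ∈ pinGroup (quad n) := by
  have h1 : ι (quad n) u * ι (quad n) u = -1 := by rw [ι_mul_self, hu]; simp
  refine ⟨⟨⟨ι (quad n) u, -ι (quad n) u, by rw [mul_neg, h1, neg_neg], by rw [neg_mul, h1, neg_neg]⟩,
    Subgroup.subset_closure ⟨u, rfl⟩, rfl⟩, ?_⟩
  rw [SetLike.mem_coe, Unitary.mem_iff, star_ι]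
  constructor
  · rw [neg_mul, h1, neg_neg]
  · rw [mul_neg, h1, neg_neg]

/-- Every orthogonal transformation is covered by an element of the pin group, whose parity is the
determinant. -/
lemma exists_pin (g : Eu n ≃ₗᵢ[ℝ] Eu n) : ∃ x ∈ pinGroup (quad n), ∃ d : ℝ, (d = 1 ∨ d = -1) ∧
    LinearMap.det g.toLinearMap = d ∧ involute x = d • x ∧
    ∀ v, x * ι (quad n) v = d • (ι (quad n) (g v) * x) := by
  -- Cartan–Dieudonné: induction over a factorisation of `g` into reflections.
  obtain ⟨l, -, rfl⟩ := g.reflections_generate_dim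
  induction l with
  | nil => exact ⟨1, one_mem _, 1, Or.inl rfl, LinearMap.det_id, by simp, by simp⟩
  | cons w l ih =>
    obtain ⟨x, hx, d, hd, hdet, hinv, hcov⟩ := ih
    rw [List.map_cons, List.prod_cons]
    set g := (l.map fun v => (ℝ ∙ v)ᗮ.reflection).prod
    set s : Eu n ≃ₗᵢ[ℝ] Eu n := (ℝ ∙ w)ᗮ.reflection with hs
    have hdet' : LinearMap.det (s * g).toLinearMap = LinearMap.det s.toLinearMap * d := by
      rw [← hdet, ← LinearMap.det_comp]; rfl
    -- The factorisation may contain the zero vector, whose "reflection" is the identity and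
    -- contributes nothing.
    by_cases hw : w = 0
    · have hs1 : s = 1 := by
        ext1 v; rw [hs]; subst hw
        rw [Submodule.reflection_mem_subspace_eq_self]; · rfl
        · simp
      rw [hs1, one_mul]; exact ⟨x, hx, d, hd, hdet, hinv, hcov⟩
    · have hn : ‖w‖ ≠ 0 := norm_ne_zero_iff.2 hw
      obtain ⟨u, hu⟩ : ∃ u, u = (‖w‖⁻¹ : ℝ) • w := ⟨_, rfl⟩
      have hu1 : ‖u‖ = 1 := by rw [hu, norm_smul]; simp [hn]
      have hrefl : ∀ v, s v = v - (2 * inner ℝ u v : ℝ) • u := fun v => by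
        rw [hs, Submodule.reflection_orthogonal_apply, Submodule.reflection_singleton_apply]
        simp only [hu, inner_smul_left, smul_smul, map_inv₀, conj_trivial, RCLike.ofReal_real_eq_id, id]
        rw [neg_sub]
        congr 1
        rw [← Nat.cast_smul_eq_nsmul ℝ, smul_smul]
        congr 1
        push_cast
        field_simp
      -- The Clifford relation says that conjugation by a unit vector is minus the reflection. This
      -- sign is the determinant of the reflection, which is why `d` records both the determinant
      -- and the parity.
      have hc : ∀ v, ι (quad n) u * ι (quad n) v = -(ι (quad n) (s v) * ι (quad n) u) := fun v => by
        rw [hrefl, map_sub, map_smul, sub_mul, smul_mul_assoc, ι_mul_self, hu1,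
          eq_sub_of_add_eq (ι_mul_add_swap u v)]
        simp only [Algebra.smul_def, ← map_mul, neg_sub, neg_mul, one_pow, mul_neg, mul_one, map_neg]
      refine ⟨ι (quad n) u * x, mul_mem (ι_mem_pinGroup hu1) hx, -d, by grind, ?_, ?_, fun v => ?_⟩
      · rw [hdet', hs, Submodule.det_reflection, Submodule.orthogonal_orthogonal,
          finrank_span_singleton hw]; ring
      · rw [map_mul, involute_ι, hinv]; simp
      · rw [mul_assoc, hcov, mul_smul_comm, ← mul_assoc, hc]
        simp [mul_assoc]

lemma exists_spin (g : Eu n ≃ₗᵢ[ℝ] Eu n) (hg : LinearMap.det g.toLinearMap = 1) :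
    ∃ a ∈ spinGroup (quad n), ∀ v, a * ι (quad n) v = ι (quad n) (g v) * a := by
  obtain ⟨x, hx, d, -, hdet, hinv, hcov⟩ := exists_pin g
  rw [hg] at hdet; subst hdet
  simp only [one_smul] at hinv hcov
  exact ⟨x, ⟨hx, mem_even_of_involute_eq hinv⟩, hcov⟩

/-- If `g` had determinant `-1`, an odd pin element `x` would cover it. Then `star a * x` would be
odd and graded central, hence a scalar, hence zero, although it is invertible. -/
lemma det_eq_one_of_spin {a : Cl n} (ha : a ∈ spinGroup (quad n)) {g : Eu n ≃ₗᵢ[ℝ] Eu n}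
    (h : ∀ v, a * ι (quad n) v = ι (quad n) (g v) * a) : LinearMap.det g.toLinearMap = 1 := by
  obtain ⟨x, hx, d, hd, hdet, hinv, hcov⟩ := exists_pin g
  rcases hd with rfl | rfl
  · exact hdet
  exfalso
  have hs := spinGroup.star_mul_self_of_mem ha
  have hs' := spinGroup.mul_star_self_of_mem ha
  have hι : ∀ v, star a * ι (quad n) (g v) = ι (quad n) v * star a := fun v => by
    calc star a * ι (quad n) (g v) = star a * (ι (quad n) (g v) * a) * star a := by
          rw [mul_assoc, mul_assoc, hs', mul_one]
      _ = _ := by rw [← h, ← mul_assoc, hs, one_mul]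
  have hi : involute (star a * x) = -(star a * x) := by
    rw [map_mul, spinGroup.involute_eq (spinGroup.star_mem ha), hinv]; simp
  obtain ⟨r, hr⟩ := mem_scalars_of_graded_central (x := star a * x) fun v => by
    rw [hi, mul_assoc, hcov, mul_smul_comm, ← mul_assoc, hι]; simp [mul_assoc]
  have h0 : star a * x = 0 := by
    have h' : -(star a * x) = star a * x := by rw [← hi, hr]; simp
    have h2 : (2 : ℝ) • (star a * x) = 0 := by rw [two_smul]; nth_rewrite 1 [← h']; simp
    simpa using h2
  have : (1 : Cl n) = 0 := by
    calc (1 : Cl n) = a * (star a * x) * star x := by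
          rw [← mul_assoc, hs', one_mul, pinGroup.mul_star_self_of_mem hx]
      _ = 0 := by rw [h0]; simp
  exact one_ne_zero this

/-- Every element of the spin group covers a rotation. -/
lemma spin_covers {a : Cl n} (ha : a ∈ spinGroup (quad n)) :
    ∃ g : Eu n ≃ₗᵢ[ℝ] Eu n, ∀ v, a * ι (quad n) v = ι (quad n) (g v) * a := by
  have hs := spinGroup.star_mul_self_of_mem ha
  have hs' := spinGroup.mul_star_self_of_mem ha
  -- Elements of the Lipschitz group normalise the space of vectors, which defines the rotation.
  have hr : ∀ v, ∃ w, ι (quad n) w = a * ι (quad n) v * star a := fun v => by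
    have := spinGroup.conjAct_smul_ι_mem_range_ι (x := spinGroup.toUnits ⟨a, ha⟩) ha v
    exact this
  choose f hf using hr
  let gl : Eu n →ₗ[ℝ] Eu n :=
    { toFun := f
      map_add' := fun v w => ι_injective (by simp only [map_add, hf, mul_add, add_mul])
      map_smul' := fun c v => ι_injective (by simp [map_smul, hf]) }
  -- The norm is visible in the square of a vector, and conjugation fixes the scalar `ι v * ι v`.
  have hsq : ∀ v, ‖f v‖ = ‖v‖ := fun v => by
    have h1 : algebraMap ℝ (Cl n) (-(‖f v‖ ^ 2)) = algebraMap ℝ (Cl n) (-(‖v‖ ^ 2)) := by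
      rw [← ι_mul_self, hf]
      calc a * ι (quad n) v * star a * (a * ι (quad n) v * star a)
          = a * ι (quad n) v * (star a * a) * ι (quad n) v * star a := by simp only [mul_assoc]
        _ = a * (ι (quad n) v * ι (quad n) v) * star a := by rw [hs]; simp only [mul_assoc, mul_one]
        _ = _ := by rw [ι_mul_self, ← Algebra.commutes, mul_assoc, hs', mul_one]
    have h2 := (algebraMap ℝ (Cl n)).injective h1
    have h3 : ‖f v‖ ^ 2 = ‖v‖ ^ 2 := by linarith
    exact (sq_eq_sq₀ (norm_nonneg _) (norm_nonneg _)).1 h3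
  let gi : Eu n →ₗᵢ[ℝ] Eu n := ⟨gl, hsq⟩
  refine ⟨gi.toLinearIsometryEquiv rfl, fun v => ?_⟩
  change _ = ι (quad n) (f v) * a
  rw [hf, mul_assoc, hs, mul_one]

/-- For even elements graded and ordinary commutation with vectors agree. This determines the kernel
of the projection to `SO(n)`. -/
lemma spin_of_covers_one {a : Cl n} (ha : involute a = a)
    (h : ∀ v, a * ι (quad n) v = ι (quad n) v * a) : ∃ r : ℝ, a = algebraMap ℝ (Cl n) r :=
  mem_scalars_of_graded_central fun v => by rw [ha, h]

end Clifford

/-! ### Smooth maps into finite dimensional vector spaces -/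

section WeakSmooth

variable {k : ℕ} {X : Type*} [TopologicalSpace X] [ChartedSpace (Eu k) X]
  {K : Type} [RCLike K] {W W' : Type*} [AddCommGroup W] [Module K W] [AddCommGroup W'] [Module K W']

/-- `f` is smooth on `O` after composition with every linear functional. -/
def WSm (k : ℕ) {X : Type*} [TopologicalSpace X] [ChartedSpace (Eu k) X] (K : Type) [RCLike K]
    {W : Type*} [AddCommGroup W] [Module K W] (f : X → W) (O : Set X) : Prop :=
  ∀ φ : W →ₗ[K] K, ContMDiffOn (𝓡 k) 𝓘(ℝ, K) ∞ (fun x => φ (f x)) O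

variable {f g : X → W} {O O' : Set X}

lemma WSm.mono (h : WSm k K f O) (hO : O' ⊆ O) : WSm k K f O' := fun φ => (h φ).mono hO

lemma WSm.congr (h : WSm k K f O) (hg : ∀ x ∈ O, g x = f x) : WSm k K g O :=
  fun φ => (h φ).congr fun x hx => by rw [hg x hx]

lemma WSm.of_local (h : ∀ x ∈ O, ∃ U, IsOpen U ∧ x ∈ U ∧ WSm k K f (O ∩ U)) : WSm k K f O :=
  fun φ => contMDiffOn_of_locally_contMDiffOn fun x hx => by
    obtain ⟨U, h1, h2, h3⟩ := h x hx
    exact ⟨U, h1, h2, h3 φ⟩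

lemma wsm_const (w : W) : WSm k K (fun _ : X => w) O := fun _ => contMDiffOn_const

lemma WSm.sub (hf : WSm k K f O) (hg : WSm k K g O) : WSm k K (fun x => f x - g x) O := fun φ => by
  simp only [map_sub]
  exact (hf φ).sub (hg φ)

lemma wsm_sum {ι : Type*} {s : Finset ι} {F : ι → X → W} (h : ∀ i ∈ s, WSm k K (F i) O) :
    WSm k K (fun x => ∑ i ∈ s, F i x) O := fun φ => by
  simp only [map_sum]
  exact contMDiffOn_finsetSum fun i hi => h i hi φ

lemma _root_.ContMDiffOn.rmul {c d : X → K} (hc : ContMDiffOn (𝓡 k) 𝓘(ℝ, K) ∞ c O)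
    (hd : ContMDiffOn (𝓡 k) 𝓘(ℝ, K) ∞ d O) :
    ContMDiffOn (𝓡 k) 𝓘(ℝ, K) ∞ (fun x => c x * d x) O :=
  (show ContDiff ℝ ∞ fun p : K × K => p.1 * p.2 from
    (ContinuousLinearMap.mul ℝ K).isBoundedBilinearMap.contDiff).contMDiff.comp_contMDiffOn
      (hc.prodMk_space hd)

lemma WSm.smul {c : X → K} (hc : ContMDiffOn (𝓡 k) 𝓘(ℝ, K) ∞ c O) (hf : WSm k K f O) :
    WSm k K (fun x => c x • f x) O := fun φ => by
  simpa only [map_smul, smul_eq_mul] using hc.rmul (hf φ)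

lemma wsm_self {c : X → K} : WSm k K c O ↔ ContMDiffOn (𝓡 k) 𝓘(ℝ, K) ∞ c O :=
  ⟨fun h => h LinearMap.id, fun h φ => by
    have : ∀ x, φ (c x) = c x * φ 1 := fun x => by
      rw [← smul_eq_mul, ← map_smul]; simp
    simp only [this]
    exact h.rmul contMDiffOn_const⟩

lemma WSm.linear (hf : WSm k K f O) (T : W →ₗ[K] W') : WSm k K (fun x => T (f x)) O :=
  fun φ => hf (φ ∘ₗ T)

/-- Expanding the first argument in a finite basis leaves a sum of smooth functions times smooth
maps. Finite dimension of one factor is enough. -/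
lemma WSm.bilin {W₁ W₂ : Type*} [AddCommGroup W₁] [Module K W₁] [AddCommGroup W₂] [Module K W₂]
    [FiniteDimensional K W₁] {f : X → W₁} {g : X → W₂} (hf : WSm k K f O) (hg : WSm k K g O)
    (B : W₁ →ₗ[K] W₂ →ₗ[K] W) : WSm k K (fun x => B (f x) (g x)) O := by
  let b := Module.finBasis K W₁
  refine (wsm_sum (s := Finset.univ) (F := fun i x => b.coord i (f x) • B (b i) (g x))
    fun i _ => WSm.smul (hf _) (hg.linear _)).congr fun x _ => ?_
  conv_lhs => rw [← b.sum_repr (f x)]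
  simp only [map_sum, map_smul, LinearMap.sum_apply, LinearMap.smul_apply, Module.Basis.coord_apply]

lemma WSm.mul {A : Type*} [Ring A] [Algebra K A] [FiniteDimensional K A] {f g : X → A}
    (hf : WSm k K f O) (hg : WSm k K g O) : WSm k K (fun x => f x * g x) O :=
  hf.bilin hg (LinearMap.mul K A)

/-- Real linear maps out of a real vector space preserve smoothness. -/
lemma WSm.realLinear {W : Type*} [AddCommGroup W] [Module ℝ W] [FiniteDimensional ℝ W] {f : X → W}
    (hf : WSm k ℝ f O) [Module ℝ W'] [IsScalarTower ℝ K W'] (T : W →ₗ[ℝ] W') :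
    WSm k K (fun x => T (f x)) O := by
  let b := Module.finBasis ℝ W
  refine (wsm_sum (s := Finset.univ)
    (F := fun i x => ((b.coord i (f x) : ℝ) : K) • T (b i)) fun i _ => WSm.smul ?_ (wsm_const _)).congr
      fun x _ => ?_
  · exact (RCLike.ofRealCLM (K := K)).contMDiff.comp_contMDiffOn (hf (b.coord i))
  · conv_lhs => rw [← b.sum_repr (f x)]
    simp only [map_sum, map_smul, Module.Basis.coord_apply]
    refine Finset.sum_congr rfl fun i _ => ?_
    rw [← RCLike.real_smul_eq_coe_smul]
    
/-- Conjugate linear maps preserve smoothness. -/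
lemma WSm.conjLinear [FiniteDimensional K W] (hf : WSm k K f O) (T : W →+ W')
    (hT : ∀ (c : K) w, T (c • w) = (starRingEnd K c) • T w) : WSm k K (fun x => T (f x)) O := by
  let b := Module.finBasis K W
  refine (wsm_sum (s := Finset.univ)
    (F := fun i x => starRingEnd K (b.coord i (f x)) • T (b i)) fun i _ => WSm.smul ?_ (wsm_const _)).congr
      fun x _ => ?_
  · exact (RCLike.conjCLE (K := K)).contDiff.contMDiff.comp_contMDiffOn (hf (b.coord i))
  · conv_lhs => rw [← b.sum_repr (f x)]
    simp only [map_sum, hT, Module.Basis.coord_apply]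

end WeakSmooth

/-! ### Local smooth lifts to the spin group -/

section LocalLift

open CliffordAlgebra

variable {n : ℕ}

/-- Averaging over the generators in the list, to make `x` intertwine them with their images. -/
def intertwine (G : Fin n → Cl n) (a : Cl n) : List (Fin n) → Cl n
  | [] => a
  | i :: l => intertwine G a l - G i * intertwine G a l * cgen i

/-- Since `G i` and `cgen i` square to `-1`, the element `A - G i * A * cgen i` turns `G i` on the
left into `cgen i` on the right. For `j ≠ i` the two anticommutation signs cancel, so relations
achieved earlier are kept. -/
lemma intertwine_comm {G : Fin n → Cl n} (hG : ∀ i, G i * G i = -1)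
    (hG' : ∀ i j, i ≠ j → G i * G j = -(G j * G i)) (a : Cl n) (l : List (Fin n)) :
    ∀ i ∈ l, G i * intertwine G a l = intertwine G a l * cgen i := by
  induction l with
  | nil => simp
  | cons i l ih =>
    intro j hj
    simp only [intertwine]
    set A := intertwine G a l
    by_cases h : j = i
    · subst h
      rw [mul_sub, sub_mul, ← mul_assoc, ← mul_assoc, hG, mul_assoc (G j * A), cgen_mul_self]
      simp [sub_eq_add_neg, add_comm]
    · have hj' := ih j ((List.mem_cons.1 hj).resolve_left h)
      rw [mul_sub, sub_mul, hj', mul_assoc (G i), ← mul_assoc (G j), hG' j i h, neg_mul,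
        mul_assoc (G i) (G j), ← mul_assoc (G j) A, hj', mul_assoc A, cgen_mul_swap h]
      simp [mul_assoc]

lemma involute_intertwine {G : Fin n → Cl n} (hG : ∀ i, involute (G i) = -G i) {a : Cl n}
    (ha : involute a = a) (l : List (Fin n)) : involute (intertwine G a l) = intertwine G a l := by
  induction l with
  | nil => exact ha
  | cons i l ih =>
    simp only [intertwine, map_sub, map_mul, ih, hG]
    rw [show involute (cgen i) = -cgen i from involute_ι _]; simp

/-- An element that already intertwines is doubled by each averaging step. So the average is nonzero
at the base point of a local lift. -/
lemma intertwine_eq {G : Fin n → Cl n} {a : Cl n} (h : ∀ i, G i * a = a * cgen i)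
    (l : List (Fin n)) : intertwine G a l = (2 ^ l.length : ℝ) • a := by
  induction l with
  | nil => simp [intertwine]
  | cons i l ih =>
    rw [intertwine, ih, mul_smul_comm, h, smul_mul_assoc, mul_assoc, cgen_mul_self, List.length_cons,
      pow_succ, mul_smul, two_smul]
    simp

/-- It is the square of a generator, which exists because `n` is positive. -/
lemma neg_one_mem_spinGroup (hn : 0 < n) : (-1 : Cl n) ∈ spinGroup (quad n) := by
  have h : cgen ⟨0, hn⟩ ∈ pinGroup (quad n) := ι_mem_pinGroup (by simp)
  refine ⟨?_, mem_even_of_involute_eq (by simp)⟩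
  rw [← cgen_mul_self ⟨0, hn⟩]
  exact mul_mem h h

lemma star_mul_ι_of_covers {a : Cl n} (ha : a ∈ spinGroup (quad n)) {g : Eu n ≃ₗᵢ[ℝ] Eu n}
    (h : ∀ v, a * ι (quad n) v = ι (quad n) (g v) * a) (v : Eu n) :
    star a * ι (quad n) (g v) = ι (quad n) v * star a := by
  calc star a * ι (quad n) (g v) = star a * (ι (quad n) (g v) * a) * star a := by
        rw [mul_assoc, mul_assoc, spinGroup.mul_star_self_of_mem ha, mul_one]
    _ = _ := by rw [← h, ← mul_assoc, spinGroup.star_mul_self_of_mem ha, one_mul]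

lemma ι_eq_sum (v : Eu n) : ι (quad n) v = ∑ i, v i • cgen i := by
  conv_lhs => rw [← (EuclideanSpace.basisFun (Fin n) ℝ).sum_repr v]
  simp [cgen]

variable {k : ℕ} {X : Type*} [TopologicalSpace X] [ChartedSpace (Eu k) X]

lemma WSm.star {f : X → Cl n} {O : Set X} (hf : WSm k ℝ f O) : WSm k ℝ (fun x => star (f x)) O := by
  simp only [star_def]
  exact (hf.linear (involute (Q := quad n)).toLinearMap).linear (reverse (Q := quad n))

/-- A smooth map to `SO(n)` lifts locally to a smooth map to `Spin(n)`. -/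
lemma exists_local_spin_lift (hn : 0 < n) {g : X → Eu n ≃ₗᵢ[ℝ] Eu n} {O : Set X} (hO : IsOpen O)
    (hdet : ∀ x ∈ O, LinearMap.det (g x).toLinearMap = 1)
    (hg : ∀ i j, ContMDiffOn (𝓡 k) 𝓘(ℝ, ℝ) ∞
      (fun x => g x (EuclideanSpace.basisFun (Fin n) ℝ i) j) O) {x₀ : X} (hx₀ : x₀ ∈ O) :
    ∃ O' ⊆ O, IsOpen O' ∧ x₀ ∈ O' ∧ ∃ b : X → spinGroup (quad n),
      (∀ x ∈ O', ∀ v, (b x : Cl n) * ι (quad n) v = ι (quad n) (g x v) * b x) ∧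
      WSm k ℝ (fun x => (b x : Cl n)) O' := by
  -- The lift at `x₀` is averaged against the vectors `g x eᵢ`. The result `A x` depends smoothly on
  -- `x`, is a real multiple of a lift of `g x`, and only has to be normalised where it does not
  -- vanish.
  obtain ⟨a₀, ha₀, hc₀⟩ := exists_spin (g x₀) (hdet x₀ hx₀)
  let G : X → Fin n → Cl n := fun x i => ι (quad n) (g x (EuclideanSpace.basisFun (Fin n) ℝ i))
  let A : X → Cl n := fun x => intertwine (G x) a₀ (List.finRange n)
  have hGs : ∀ i, WSm k ℝ (fun x => G x i) O := fun i => by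
    simp only [G, ι_eq_sum (g _ _)]
    exact wsm_sum fun j _ => WSm.smul (hg i j) (wsm_const _)
  have hAs : WSm k ℝ A O := by
    suffices ∀ l, WSm k ℝ (fun x => intertwine (G x) a₀ l) O from this _
    intro l
    induction l with
    | nil => exact wsm_const _
    | cons i l ih => exact ih.sub (((hGs i).mul ih).mul (wsm_const _))
  -- Any functional normalised at `1` reads off the scalar `A x * star (A x)`.
  obtain ⟨τ, hτ⟩ : ∃ τ : Cl n →ₗ[ℝ] ℝ, τ 1 = 1 := Module.Projective.exists_dual_eq_one ℝ one_ne_zero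
  have hscal : ∀ x ∈ O, ∀ a ∈ spinGroup (quad n),
      (∀ v, a * ι (quad n) v = ι (quad n) (g x v) * a) → ∃ c : ℝ, A x = c • a := fun x hx a ha hc => by
    have hG1 : ∀ i, G x i * G x i = -1 := fun i => by
      simp only [G]; rw [ι_mul_self]; simp
    have hG2 : ∀ i j, i ≠ j → G x i * G x j = -(G x j * G x i) := fun i j hij => by
      have := ι_mul_add_swap (g x (EuclideanSpace.basisFun (Fin n) ℝ i))
        (g x (EuclideanSpace.basisFun (Fin n) ℝ j))
      rw [LinearIsometryEquiv.inner_map_map, (EuclideanSpace.basisFun (Fin n) ℝ).inner_eq_zero hij] at this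
      rw [mul_zero, map_zero] at this
      exact eq_neg_of_add_eq_zero_left this
    have hA : ∀ v, A x * ι (quad n) v = ι (quad n) (g x v) * A x := fun v => by
      have h1 := intertwine_comm hG1 hG2 a₀ (List.finRange n)
      conv_rhs => rw [← (EuclideanSpace.basisFun (Fin n) ℝ).sum_repr v]
      rw [ι_eq_sum, map_sum, map_sum, Finset.mul_sum, Finset.sum_mul]
      refine Finset.sum_congr rfl fun i _ => ?_
      rw [mul_smul_comm, ← h1 i (List.mem_finRange i), map_smul, map_smul, smul_mul_assoc]
      simp [G, A]
    -- A Schur argument: both `a` and `A x` intertwine `v` with `g x v`, so `star a * A x` is even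
    -- and central on vectors, hence a scalar.
    obtain ⟨c, hc'⟩ := spin_of_covers_one (a := star a * A x)
      (by
        rw [map_mul, spinGroup.involute_eq (spinGroup.star_mem ha),
          involute_intertwine (fun i => involute_ι _) (spinGroup.involute_eq ha₀)])
      (fun v => by rw [mul_assoc, hA, ← mul_assoc, star_mul_ι_of_covers ha hc, mul_assoc])
    refine ⟨c, ?_⟩
    calc A x = a * (star a * A x) := by rw [← mul_assoc, spinGroup.mul_star_self_of_mem ha, one_mul]
      _ = _ := by rw [hc', ← Algebra.commutes, Algebra.smul_def]
  let N : X → ℝ := fun x => τ (A x * star (A x))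
  have hNs : ContMDiffOn (𝓡 k) 𝓘(ℝ, ℝ) ∞ N O := (hAs.mul hAs.star) τ
  have hN : ∀ (x : X) (c : ℝ), ∀ a ∈ spinGroup (quad n), A x = c • a → N x = c ^ 2 := by
    intro x c a ha hc
    simp only [N, hc, CliffordAlgebra.star_smul, smul_mul_assoc, mul_smul_comm,
      spinGroup.mul_star_self_of_mem ha, map_smul, hτ, smul_eq_mul]
    ring
  refine ⟨O ∩ N ⁻¹' Set.Ioi 0, Set.inter_subset_left,
    hNs.continuousOn.isOpen_inter_preimage hO isOpen_Ioi, ⟨hx₀, ?_⟩, ?_⟩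
  · have h1 : A x₀ = (2 ^ (List.finRange n).length : ℝ) • a₀ :=
      intertwine_eq (fun i => (hc₀ _).symm) _
    rw [Set.mem_preimage, hN x₀ _ a₀ ha₀ h1, Set.mem_Ioi]
    positivity
  · have hmem : ∀ x ∈ O ∩ N ⁻¹' Set.Ioi 0, (Real.sqrt (N x))⁻¹ • A x ∈ spinGroup (quad n) ∧
        ∀ v, (Real.sqrt (N x))⁻¹ • A x * ι (quad n) v =
          ι (quad n) (g x v) * (Real.sqrt (N x))⁻¹ • A x := by
      rintro x ⟨hx, hx'⟩
      obtain ⟨a, ha, hc⟩ := exists_spin (g x) (hdet x hx)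
      obtain ⟨c, hA⟩ := hscal x hx a ha hc
      have hNx := hN x c a ha hA
      have hc0 : c ≠ 0 := by
        rintro rfl
        rw [Set.mem_preimage, hNx] at hx'; simp at hx'
      refine ⟨?_, fun v => by rw [hA, smul_smul, smul_mul_assoc, hc, mul_smul_comm]⟩
      rw [hNx, Real.sqrt_sq_eq_abs, hA, smul_smul]
      -- Normalising gives `a` or `-a`, according to the sign of `c`. The negative case stays in the
      -- spin group because `-1` belongs to it.
      rcases lt_or_gt_of_ne hc0 with h | h
      · rw [abs_of_neg h, inv_neg, neg_mul, inv_mul_cancel₀ hc0, neg_smul, one_smul, ← neg_one_mul]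
        exact mul_mem (neg_one_mem_spinGroup hn) ha
      · rw [abs_of_pos h, inv_mul_cancel₀ hc0, one_smul]; exact ha
    classical
    refine ⟨fun x => if hx : x ∈ O ∩ N ⁻¹' Set.Ioi 0 then ⟨_, (hmem x hx).1⟩ else 1,
      fun x hx v => ?_, ?_⟩
    · simp only [dif_pos hx]; exact (hmem x hx).2 v
    · have : ContMDiffOn (𝓡 k) 𝓘(ℝ, ℝ) ∞ (fun x => (Real.sqrt (N x))⁻¹) (O ∩ N ⁻¹' Set.Ioi 0) := by
        intro x hx
        have h1 : ContDiffAt ℝ ∞ (fun y : ℝ => (Real.sqrt y)⁻¹) (N x) :=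
          (Real.contDiffAt_sqrt (ne_of_gt hx.2)).inv (Real.sqrt_pos.2 hx.2).ne'
        exact h1.contMDiffAt.comp_contMDiffWithinAt x ((hNs x hx.1).mono Set.inter_subset_left)
      refine (WSm.smul this (hAs.mono Set.inter_subset_left)).congr fun x hx => ?_
      simp only [dif_pos hx]

end LocalLift

/-! ### The groups `spinK K n` -/

section SpinK

open CliffordAlgebra

variable {K : Type} [RCLike K] {n : ℕ}

@[simp] lemma spinVal_mul (a b : spinK K n) : spinVal (a * b) = spinVal a * spinVal b := rfl
@[simp] lemma spinVal_one : spinVal (1 : spinK K n) = 1 := rfl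
lemma spinVal_injective : Function.Injective (spinVal : spinK K n → ClK K n) :=
  fun _ _ h => Subtype.ext (Units.ext h)

lemma spinVal_mul_inv (a : spinK K n) : spinVal a * spinVal a⁻¹ = 1 := by
  rw [← spinVal_mul, mul_inv_cancel]; rfl
lemma spinVal_unitScalar (z : unitary K) :
    spinVal (unitScalar z : spinK K n) = algebraMap K (ClK K n) (z : K) := rfl

lemma spinVal_unitScalar_mul (z : unitary K) (a : spinK K n) :
    spinVal (unitScalar z * a) = (z : K) • spinVal a := by
  rw [spinVal_mul, spinVal_unitScalar, Algebra.smul_def]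

lemma unitScalar_comm (z : unitary K) (a : spinK K n) : unitScalar z * a = a * unitScalar z :=
  spinVal_injective (Algebra.commutes _ _)

lemma unitScalar_mul (z w : unitary K) :
    (unitScalar (z * w) : spinK K n) = unitScalar z * unitScalar w :=
  spinVal_injective (by simp [spinVal_unitScalar])

@[simp] lemma unitScalar_one : (unitScalar 1 : spinK K n) = 1 :=
  spinVal_injective (by rw [spinVal_unitScalar, OneMemClass.coe_one, map_one, spinVal_one])

lemma unitScalar_inv (z : unitary K) : (unitScalar z⁻¹ : spinK K n) = (unitScalar z)⁻¹ :=
  eq_inv_of_mul_eq_one_left (by rw [← unitScalar_mul]; simp)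

lemma unitScalar_injective : Function.Injective (unitScalar : unitary K → spinK K n) :=
  fun _ _ h => Subtype.ext ((algebraMap K (ClK K n)).injective (congrArg spinVal h))

/-- The inclusion of `Spin(n)`. -/
def ofSpin (K : Type) [RCLike K] {n : ℕ} (b : spinGroup (quad n)) : spinK K n :=
  ⟨Units.map ((Algebra.TensorProduct.includeRight : Cl n →ₐ[ℝ] ClK K n) : Cl n →* ClK K n)
    (spinGroup.toUnits b), Subgroup.mem_sup_right ⟨b, rfl⟩⟩

lemma spinVal_ofSpin (b : spinGroup (quad n)) : spinVal (ofSpin K b) = (1 : K) ⊗ₜ (b : Cl n) := rfl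

lemma ofSpin_mul (b c : spinGroup (quad n)) : ofSpin K (b * c) = ofSpin K b * ofSpin K c :=
  spinVal_injective (by simp [spinVal_ofSpin])

/-- The scalars are central, so the supremum of the two subgroups is the set of products. Statements
about `spinK K n` are thereby reduced to `Spin(n)`. -/
lemma exists_eq_unitScalar_mul_ofSpin (a : spinK K n) :
    ∃ (z : unitary K) (b : spinGroup (quad n)), a = unitScalar z * ofSpin K b := by
  obtain ⟨a, ha⟩ := a
  have hN : (((Units.map (algebraMap K (ClK K n) : K →* ClK K n)).comp Unitary.toUnits).range).Normal := by
    refine ⟨?_⟩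
    rintro _ ⟨z, rfl⟩ g
    refine ⟨z, ?_⟩
    rw [eq_mul_inv_iff_mul_eq]
    exact Units.ext (Algebra.commutes _ _)
  have ha' := ha
  rw [spinK, ← SetLike.mem_coe, Subgroup.normal_mul] at ha'
  obtain ⟨_, ⟨z, rfl⟩, _, ⟨b, rfl⟩, h⟩ := ha'
  exact ⟨z, b, Subtype.ext h.symm⟩

lemma one_tmul_injective : Function.Injective (fun x : Cl n => (1 : K) ⊗ₜ[ℝ] x) :=
  Algebra.TensorProduct.includeRight_injective (R := ℝ) (A := K) (B := Cl n)
    (algebraMap ℝ K).injective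

lemma vec_injective : Function.Injective (vec K : Eu n → ClK K n) :=
  one_tmul_injective.comp ι_injective

lemma covers_unitScalar_mul_ofSpin {z : unitary K} {b : spinGroup (quad n)} {g : Eu n ≃ₗᵢ[ℝ] Eu n} :
    Covers (unitScalar z * ofSpin K b) g ↔
      ∀ v, (b : Cl n) * ι (quad n) v = ι (quad n) (g v) * b := by
  refine forall_congr' fun v => ?_
  have hz : (z : K) ≠ 0 := fun h => by
    have := z.2.1; rw [h] at this; simp at this
  rw [spinVal_unitScalar_mul, smul_mul_assoc, mul_smul_comm, spinVal_ofSpin, vec, vec,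
    Algebra.TensorProduct.tmul_mul_tmul, Algebra.TensorProduct.tmul_mul_tmul, mul_one]
  exact ⟨fun h => one_tmul_injective (smul_right_injective _ hz h), fun h => by rw [h]⟩

lemma covers_ofSpin {b : spinGroup (quad n)} {g : Eu n ≃ₗᵢ[ℝ] Eu n} :
    Covers (ofSpin K b) g ↔ ∀ v, (b : Cl n) * ι (quad n) v = ι (quad n) (g v) * b := by
  have := covers_unitScalar_mul_ofSpin (K := K) (z := 1) (b := b) (g := g)
  rwa [unitScalar_one, one_mul] at this

lemma exists_covers (a : spinK K n) : ∃ g, Covers a g := by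
  obtain ⟨z, b, rfl⟩ := exists_eq_unitScalar_mul_ofSpin a
  obtain ⟨g, hg⟩ := spin_covers b.2
  exact ⟨g, covers_unitScalar_mul_ofSpin.2 hg⟩

lemma Covers.det {a : spinK K n} {g : Eu n ≃ₗᵢ[ℝ] Eu n} (h : Covers a g) :
    LinearMap.det g.toLinearMap = 1 := by
  obtain ⟨z, b, rfl⟩ := exists_eq_unitScalar_mul_ofSpin a
  exact det_eq_one_of_spin b.2 (covers_unitScalar_mul_ofSpin.1 h)

lemma exists_covering (K : Type) [RCLike K] {g : Eu n ≃ₗᵢ[ℝ] Eu n}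
    (hg : LinearMap.det g.toLinearMap = 1) : ∃ a : spinK K n, Covers a g := by
  obtain ⟨a, ha, h⟩ := exists_spin g hg
  exact ⟨ofSpin K ⟨a, ha⟩, covers_ofSpin.2 h⟩

lemma Covers.vec_eq {a : spinK K n} {g : Eu n ≃ₗᵢ[ℝ] Eu n} (h : Covers a g) (v : Eu n) :
    vec K (g v) = spinVal a * vec K v * spinVal a⁻¹ := by
  rw [h, mul_assoc, spinVal_mul_inv, mul_one]

lemma Covers.unique {a : spinK K n} {g g' : Eu n ≃ₗᵢ[ℝ] Eu n} (h : Covers a g) (h' : Covers a g') :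
    g = g' :=
  LinearIsometryEquiv.ext fun v => vec_injective (by rw [h.vec_eq, h'.vec_eq])

lemma covers_one : Covers (1 : spinK K n) (LinearIsometryEquiv.refl ℝ (Eu n)) := fun v => by simp

lemma Covers.mul {a b : spinK K n} {g g' : Eu n ≃ₗᵢ[ℝ] Eu n} (h : Covers a g) (h' : Covers b g') :
    Covers (a * b) (g'.trans g) := fun v => by
  rw [spinVal_mul, mul_assoc, h', ← mul_assoc, h, mul_assoc]; rfl

lemma Covers.inv {a : spinK K n} {g : Eu n ≃ₗᵢ[ℝ] Eu n} (h : Covers a g) : Covers a⁻¹ g.symm := by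
  obtain ⟨g', h'⟩ := exists_covers a⁻¹
  have h1 := (h.mul h').unique (by rw [mul_inv_cancel]; exact covers_one)
  have : g' = g.symm := by
    ext1 v
    apply g.injective
    simpa using congrArg (fun f => f v) h1
  rwa [← this]

lemma covers_unitScalar (z : unitary K) :
    Covers (unitScalar z : spinK K n) (LinearIsometryEquiv.refl ℝ (Eu n)) := fun _ =>
  Algebra.commutes _ _

/-- The kernel of the projection to `SO(n)` consists of the unit scalars. -/
lemma Covers.eq_unitScalar {a : spinK K n} (h : Covers a (LinearIsometryEquiv.refl ℝ (Eu n))) :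
    ∃ z, a = unitScalar z := by
  obtain ⟨z, b, rfl⟩ := exists_eq_unitScalar_mul_ofSpin a
  obtain ⟨r, hr⟩ := spin_of_covers_one (spinGroup.involute_eq b.2) (covers_unitScalar_mul_ofSpin.1 h)
  -- The spin part is a real scalar `r`. Being fixed by star and unitary, it squares to one and so
  -- is again a unit scalar.
  have h1 : r * r = 1 := by
    have := spinGroup.mul_star_self_of_mem b.2
    rw [hr, star_algebraMap, ← map_mul] at this
    exact (algebraMap ℝ (Cl n)).injective (by rw [this, map_one])
  have hu : (r : K) ∈ unitary K := by
    rw [Unitary.mem_iff]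
    simp only [RCLike.star_def, RCLike.conj_ofReal]
    have h2 : (r : K) * (r : K) = 1 := by exact_mod_cast h1
    exact ⟨h2, h2⟩
  refine ⟨z * ⟨(r : K), hu⟩, ?_⟩
  rw [unitScalar_mul]
  congr 1
  apply spinVal_injective
  rw [spinVal_ofSpin, hr, spinVal_unitScalar, Algebra.algebraMap_eq_smul_one, ← TensorProduct.smul_tmul,
    Algebra.TensorProduct.algebraMap_apply]
  simp [Algebra.smul_def]

/-- This is the principal bundle property of `L`: each fibre is a torsor under the unit scalars. -/
lemma Covers.exists_unitScalar {a b : spinK K n} {g : Eu n ≃ₗᵢ[ℝ] Eu n} (ha : Covers a g)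
    (hb : Covers b g) : ∃ z, b = unitScalar z * a := by
  obtain ⟨z, hz⟩ := Covers.eq_unitScalar (a := b * a⁻¹)
    ((hb.mul ha.inv).unique (by simpa using hb.mul ha.inv) ▸ (by
      have := hb.mul ha.inv
      simpa using this))
  exact ⟨z, by rw [← hz]; simp⟩

/-- Conjugation of the scalars combined with the star operation of the Clifford algebra. -/
def clConj (K : Type) [RCLike K] (n : ℕ) : ClK K n →ₗ[ℝ] ClK K n :=
  TensorProduct.map (RCLike.conjLIE (K := K)).toLinearEquiv.toLinearMap
    ((reverse (Q := quad n)) ∘ₗ (involute (Q := quad n)).toLinearMap)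

lemma clConj_tmul (z : K) (x : Cl n) : clConj K n (z ⊗ₜ x) = starRingEnd K z ⊗ₜ star x := rfl

lemma clConj_smul (c : K) (x : ClK K n) : clConj K n (c • x) = starRingEnd K c • clConj K n x := by
  induction x using TensorProduct.induction_on with
  | zero => simp
  | tmul z x => simp [TensorProduct.smul_tmul', clConj_tmul]
  | add x y hx hy => rw [smul_add, map_add, hx, hy, map_add, smul_add]

/-- On the group, inversion is the restriction of a conjugate linear map, so its smoothness is
immediate (`WSm.spin_inv`). -/
lemma spinVal_inv (a : spinK K n) : spinVal a⁻¹ = clConj K n (spinVal a) := by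
  obtain ⟨z, b, rfl⟩ := exists_eq_unitScalar_mul_ofSpin a
  have h : spinVal (unitScalar z * ofSpin K b)⁻¹ =
      spinVal (unitScalar z⁻¹ * ofSpin K b⁻¹) := by
    congr 1
    rw [inv_eq_iff_mul_eq_one, mul_assoc, ← mul_assoc (ofSpin K b), ← unitScalar_comm, mul_assoc,
      ← mul_assoc, ← unitScalar_mul, ← ofSpin_mul, mul_inv_cancel, mul_inv_cancel, unitScalar_one,
      one_mul]
    exact spinVal_injective rfl
  rw [h, spinVal_unitScalar_mul, spinVal_unitScalar_mul, clConj_smul, spinVal_ofSpin, spinVal_ofSpin,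
    clConj_tmul, map_one]
  rfl

/-- Linear functionals that read off the coordinates of a vector. -/
lemma exists_coord (K : Type) [RCLike K] (n : ℕ) (j : Fin n) :
    ∃ ψ : ClK K n →ₗ[K] K, ∀ v : Eu n, ψ (vec K v) = ((v j : ℝ) : K) := by
  obtain ⟨p, hp⟩ := (ι (quad n)).exists_leftInverse_of_injective (LinearMap.ker_eq_bot.2 ι_injective)
  let q : Cl n →ₗ[ℝ] ℝ := (EuclideanSpace.proj j : Eu n →L[ℝ] ℝ).toLinearMap ∘ₗ p
  refine ⟨(TensorProduct.AlgebraTensorModule.rid ℝ K K).toLinearMap ∘ₗ q.baseChange K, fun v => ?_⟩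
  have h : p (ι (quad n) v) = v := congrArg (fun f => f v) hp
  simp [vec, q, h, Algebra.smul_def]

variable {k : ℕ} {X : Type*} [TopologicalSpace X] [ChartedSpace (Eu k) X] {O : Set X}

lemma WSm.spin_mul {a b : X → spinK K n} (ha : WSm k K (fun x => spinVal (a x)) O)
    (hb : WSm k K (fun x => spinVal (b x)) O) : WSm k K (fun x => spinVal (a x * b x)) O :=
  ha.mul hb

lemma WSm.spin_inv {a : X → spinK K n} (ha : WSm k K (fun x => spinVal (a x)) O) :
    WSm k K (fun x => spinVal (a x)⁻¹) O := by
  simp only [spinVal_inv]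
  exact ha.conjLinear (clConj K n).toAddMonoidHom clConj_smul

lemma wsm_unitScalar {z : X → unitary K} :
    WSm k K (fun x => spinVal (unitScalar (z x) : spinK K n)) O ↔
      ContMDiffOn (𝓡 k) 𝓘(ℝ, K) ∞ (fun x => (z x : K)) O := by
  constructor
  · intro h
    obtain ⟨τ, hτ⟩ := Module.Projective.exists_dual_eq_one K (one_ne_zero (α := ClK K n))
    refine (h τ).congr fun x _ => ?_
    simp only [spinVal_unitScalar, Algebra.algebraMap_eq_smul_one, map_smul, hτ, smul_eq_mul, mul_one]
  · intro h
    simp only [spinVal_unitScalar, Algebra.algebraMap_eq_smul_one]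
    exact WSm.smul h (wsm_const _)

/-- The rotations covered by a smooth family are smooth. -/
lemma WSm.rotation_smooth {a : X → spinK K n} (ha : WSm k K (fun x => spinVal (a x)) O)
    {g : X → Eu n ≃ₗᵢ[ℝ] Eu n} (hg : ∀ x ∈ O, Covers (a x) (g x)) (v : Eu n) (j : Fin n) :
    ContMDiffOn (𝓡 k) 𝓘(ℝ, ℝ) ∞ (fun x => g x v j) O := by
  obtain ⟨ψ, hψ⟩ := exists_coord K n j
  have h : ContMDiffOn (𝓡 k) 𝓘(ℝ, K) ∞
      (fun x => ψ (spinVal (a x) * vec K v * spinVal (a x)⁻¹)) O :=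
    ((ha.mul (wsm_const _)).mul ha.spin_inv) ψ
  refine ((RCLike.reCLM (K := K)).contMDiff.comp_contMDiffOn h).congr fun x hx => ?_
  simp only [Function.comp]
  rw [← (hg x hx).vec_eq, hψ]; simp

lemma WSm.ofSpin {b : X → spinGroup (quad n)} (hb : WSm k ℝ (fun x => (b x : Cl n)) O) :
    WSm k K (fun x => spinVal (ofSpin K (b x))) O :=
  hb.realLinear (TensorProduct.mk ℝ K (Cl n) 1)

/-- Local smooth lifts to `spinK K n`. -/
lemma exists_local_lift (K : Type) [RCLike K] (hn : 0 < n) {g : X → Eu n ≃ₗᵢ[ℝ] Eu n} {O : Set X}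
    (hO : IsOpen O) (hdet : ∀ x ∈ O, LinearMap.det (g x).toLinearMap = 1)
    (hg : ∀ i j, ContMDiffOn (𝓡 k) 𝓘(ℝ, ℝ) ∞
      (fun x => g x (EuclideanSpace.basisFun (Fin n) ℝ i) j) O) {x₀ : X} (hx₀ : x₀ ∈ O) :
    ∃ O' ⊆ O, IsOpen O' ∧ x₀ ∈ O' ∧ ∃ a : X → spinK K n, (∀ x ∈ O, Covers (a x) (g x)) ∧
      WSm k K (fun x => spinVal (a x)) O' := by
  obtain ⟨O', hO', h1, h2, b, hb, hb'⟩ := exists_local_spin_lift hn hO hdet hg hx₀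
  classical
  -- The lift has to cover `g` on all of `O` but to be smooth only on `O'`. On the remainder of `O`
  -- it is chosen pointwise, and outside `O` its value is arbitrary.
  have hex : ∀ x, ∃ a : spinK K n, (x ∈ O → Covers a (g x)) ∧ (x ∈ O' → a = ofSpin K (b x)) := by
    intro x
    by_cases hx' : x ∈ O'
    · exact ⟨ofSpin K (b x), fun _ => covers_ofSpin.2 (hb x hx'), fun _ => rfl⟩
    · by_cases hx : x ∈ O
      · obtain ⟨a, ha⟩ := exists_covering K (hdet x hx)
        exact ⟨a, fun _ => ha, fun h => absurd h hx'⟩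
      · exact ⟨1, fun h => absurd h hx, fun h => absurd h hx'⟩
  choose a ha using hex
  exact ⟨O', hO', h1, h2, a, fun x => (ha x).1, hb'.ofSpin.congr fun x hx => by rw [(ha x).2 hx]⟩

lemma spinPlots_iff {k : ℕ} {γ : Eu k → spinK K n} {O : Set (Eu k)} :
    spinPlots K n k γ O ↔ WSm k K (fun t => spinVal (γ t)) O :=
  forall_congr' fun _ => contMDiffOn_iff_contDiffOn.symm

/-- Irreducible representations with scalar action of the central scalars exist. -/
lemma exists_irreducible_spinRep (K : Type) [RCLike K] (n : ℕ) :
    ∃ (V : Type) (_ : AddCommGroup V) (_ : Module K V) (ρ : Representation K (spinK K n) V),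
      IsSpinRep ρ ∧ ρ.IsIrreducible := by
  -- In left multiplication on the Clifford algebra the unit scalars act as required, so any
  -- subrepresentation inherits this. A nonzero one of least dimension is irreducible.
  let reg : Representation K (spinK K n) (ClK K n) :=
    { toFun := fun a => LinearMap.mulLeft K (spinVal a)
      map_one' := by ext; simp
      map_mul' := fun a b => by ext; simp }
  have hP : ∃ d : ℕ, ∃ σ : Subrepresentation reg, σ.toSubmodule ≠ ⊥ ∧
      Module.finrank K σ.toSubmodule = d := ⟨_, ⟨⊤, fun _ _ _ => trivial⟩, top_ne_bot, rfl⟩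
  classical
  obtain ⟨σ, hσ, hd⟩ := Nat.find_spec hP
  have hmin : ∀ τ : Subrepresentation reg, τ.toSubmodule ≠ ⊥ →
      Module.finrank K σ.toSubmodule ≤ Module.finrank K τ.toSubmodule := fun τ hτ => by
    rw [hd]; exact Nat.find_min' hP ⟨τ, hτ, rfl⟩
  have hnt : Nontrivial σ.toSubmodule := Submodule.nontrivial_iff_ne_bot.2 hσ
  refine ⟨σ.toSubmodule, inferInstance, inferInstance, σ.toRepresentation, ⟨inferInstance, hnt,
    fun z v => Subtype.ext ?_, fun v φ k γ O hO hγ _ => ?_⟩, ?_⟩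
  · change algebraMap K (ClK K n) (z : K) * (v : ClK K n) = _
    rw [← Algebra.smul_def]; rfl
  · obtain ⟨ψ, hψ⟩ := φ.exists_extend
    have h : WSm k K (fun t => spinVal (γ t) * (v : ClK K n)) O := (spinPlots_iff.1 hγ).mul (wsm_const _)
    refine (contMDiffOn_iff_contDiffOn.1 (h ψ)).congr fun t _ => ?_
    rw [← hψ]; rfl
  · have hbt : (⊥ : Subrepresentation σ.toRepresentation) ≠ ⊤ := fun h =>
      bot_ne_top (congrArg Subrepresentation.toSubmodule h)
    refine { exists_pair_ne := ⟨_, _, hbt⟩, eq_bot_or_eq_top := fun τ => ?_ }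
    refine or_iff_not_imp_left.2 fun hτ => ?_
    have hτ' : τ.toSubmodule ≠ ⊥ := fun h => hτ (Subrepresentation.toSubmodule_injective h)
    let τ' : Subrepresentation reg :=
      ⟨τ.toSubmodule.map σ.toSubmodule.subtype, by
        rintro g _ ⟨x, hx, rfl⟩
        exact ⟨_, τ.apply_mem_toSubmodule g hx, rfl⟩⟩
    have h1 := hmin τ' (by
      change τ.toSubmodule.map σ.toSubmodule.subtype ≠ ⊥
      exact fun h => hτ' ((Submodule.map_injective_of_injective σ.toSubmodule.injective_subtype)
        (by rw [h, Submodule.map_bot])))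
    have h2 : Module.finrank K τ'.toSubmodule = Module.finrank K τ.toSubmodule :=
      ((Submodule.equivMapOfInjective _ σ.toSubmodule.injective_subtype _).finrank_eq).symm
    refine Subrepresentation.toSubmodule_injective ?_
    exact Submodule.eq_top_of_finrank_eq (le_antisymm (Submodule.finrank_le _) (h2 ▸ h1))

end SpinK

/-! ### The frame bundle -/

section FrameBundle

variable {m n : ℕ} {M : Type*} [TopologicalSpace M] [ChartedSpace (Eu m) M]
  {E : M → Type*} [TopologicalSpace (TotalSpace (Eu n) E)]
  [∀ x, NormedAddCommGroup (E x)] [∀ x, InnerProductSpace ℝ (E x)]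
  [FiberBundle (Eu n) E] {o : ∀ x, Orientation ℝ (E x) (Fin n)}
  {k : ℕ} {X : Type*} [TopologicalSpace X] [ChartedSpace (Eu k) X]

lemma rot_apply {x : M} (f f' : OFrame o x) (i j : Fin n) :
    rot f f' (EuclideanSpace.basisFun (Fin n) ℝ i) j = inner ℝ (f.1 j) (f'.1 i) := by
  simp [rot, OrthonormalBasis.repr_apply_apply]

lemma rot_refl {x : M} (f : OFrame o x) : rot f f = LinearIsometryEquiv.refl ℝ (Eu n) := by
  ext1 v; simp [rot]

lemma rot_trans {x : M} (f f' f'' : OFrame o x) : (rot f' f'').trans (rot f f') = rot f f'' := by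
  ext1 v; simp [rot]

lemma rot_symm {x : M} (f f' : OFrame o x) : (rot f f').symm = rot f' f := by
  ext1 v; simp [rot]

lemma rot_injective {x : M} {f f' f'' : OFrame o x} (h : rot f f' = rot f f'') : f' = f'' := by
  apply Subtype.ext
  have h2 : f'.1.repr.symm = f''.1.repr.symm := by
    ext1 v
    exact f.1.repr.injective (congrArg (fun g => g v) h)
  have h1 : f'.1.repr = f''.1.repr := by
    rw [← f'.1.repr.symm_symm, h2, f''.1.repr.symm_symm]
  exact OrthonormalBasis.repr_injective h1

/-- In the standard basis `rot f f'` is the change of basis matrix between two orthonormal bases of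
the same orientation. -/
lemma det_rot {x : M} (f f' : OFrame o x) : LinearMap.det (rot f f').toLinearMap = 1 := by
  have h := f.1.det_to_matrix_orthonormalBasis_of_same_orientation f'.1 (f.2.trans f'.2.symm)
  rw [Module.Basis.det_apply] at h
  rw [← LinearMap.det_toMatrix (EuclideanSpace.basisFun (Fin n) ℝ).toBasis, ← h]
  congr 1
  ext i j
  rw [LinearMap.toMatrix_apply, Module.Basis.toMatrix_apply]
  have := rot_apply f f' j i
  simp only [OrthonormalBasis.coe_toBasis, OrthonormalBasis.coe_toBasis_repr_apply,
    EuclideanSpace.basisFun_repr]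
  rw [OrthonormalBasis.repr_apply_apply]
  exact this

/-- The frame `f ∘ g`. -/
def OFrame.rotate {x : M} (f : OFrame o x) (g : Eu n ≃ₗᵢ[ℝ] Eu n)
    (hg : LinearMap.det g.toLinearMap = 1) : OFrame o x :=
  ⟨OrthonormalBasis.ofRepr (f.1.repr.trans g.symm), by
    refine Eq.trans (Eq.symm ?_) f.2
    rw [Module.Basis.orientation_eq_iff_det_pos, Module.Basis.det_apply]
    rw [← LinearMap.det_toMatrix (EuclideanSpace.basisFun (Fin n) ℝ).toBasis] at hg
    have : f.1.toBasis.toMatrix (OrthonormalBasis.ofRepr (f.1.repr.trans g.symm)).toBasis =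
        LinearMap.toMatrix (EuclideanSpace.basisFun (Fin n) ℝ).toBasis
          (EuclideanSpace.basisFun (Fin n) ℝ).toBasis g.toLinearMap := by
      ext i j
      rw [LinearMap.toMatrix_apply, Module.Basis.toMatrix_apply]
      simp [OrthonormalBasis.coe_toBasis_repr_apply]
    rw [this, hg]; exact one_pos⟩

lemma rot_rotate {x : M} (f : OFrame o x) (g : Eu n ≃ₗᵢ[ℝ] Eu n)
    (hg : LinearMap.det g.toLinearMap = 1) : rot f (f.rotate g hg) = g := by
  ext1 v; simp [rot, OFrame.rotate]

lemma rotate_apply {x : M} (f : OFrame o x) (g : Eu n ≃ₗᵢ[ℝ] Eu n)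
    (hg : LinearMap.det g.toLinearMap = 1) (i : Fin n) :
    (f.rotate g hg).1 i = ∑ j, (g (EuclideanSpace.basisFun (Fin n) ℝ i) j) • f.1 j := by
  have h : (f.rotate g hg).1 i = f.1.repr.symm (g (EuclideanSpace.basisFun (Fin n) ℝ i)) := by
    rw [← OrthonormalBasis.repr_symm_single]
    simp [OFrame.rotate]
  rw [h, ← f.1.sum_repr (f.1.repr.symm _)]
  simp

variable (m) in
/-- The frames `f t` over the points `x t` depend smoothly on `t` in `O`. -/
def FSm (k : ℕ) {X : Type*} [TopologicalSpace X] [ChartedSpace (Eu k) X] (x : X → M)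
    (f : ∀ t, OFrame o (x t)) (O : Set X) : Prop :=
  ∀ i, ContMDiffOn (𝓡 k) ((𝓡 m).prod 𝓘(ℝ, Eu n)) ∞
    (fun t => (⟨x t, (f t).1 i⟩ : TotalSpace (Eu n) E)) O

lemma framePlots_iff {γ : Eu k → SO o} {O : Set (Eu k)} :
    framePlots m o k γ O ↔ FSm m k (fun t => (γ t).1) (fun t => (γ t).2) O := Iff.rfl

lemma FSm.mono {x : X → M} {f : ∀ t, OFrame o (x t)} {O O' : Set X} (h : FSm m k x f O)
    (hO : O' ⊆ O) : FSm m k x f O' := fun i => (h i).mono hO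

lemma FSm.congr {x : X → M} {f f' : ∀ t, OFrame o (x t)} {O : Set X} (h : FSm m k x f O)
    (h' : ∀ t ∈ O, f' t = f t) : FSm m k x f' O :=
  fun i => (h i).congr fun t ht => by rw [h' t ht]

lemma FSm.comp {l : ℕ} {Y : Type*} [TopologicalSpace Y] [ChartedSpace (Eu l) Y] {x : X → M}
    {f : ∀ t, OFrame o (x t)} {O : Set X} (h : FSm m k x f O) {y : Y → X} {O' : Set Y}
    (hy : ContMDiffOn (𝓡 l) (𝓡 k) ∞ y O') (hO : Set.MapsTo y O' O) :
    FSm m l (fun t => x (y t)) (fun t => f (y t)) O' :=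
  fun i => (h i).comp hy hO

section Topology

lemma SO.continuous_vector (i : Fin n) : Continuous (SO.vector i : SO o → TotalSpace (Eu n) E) :=
  continuous_iff_le_induced.2 (iInf_le _ i)

/-- The topology of `SO(E)` only sees the vectors of a frame. The base point is recovered as the
foot of the vector with index `0`, which needs `n` positive. -/
lemma SO.continuous_pt (hn : 0 < n) : Continuous (SO.pt : SO o → M) :=
  (FiberBundle.continuous_proj (Eu n) E).comp (SO.continuous_vector ⟨0, hn⟩)

lemma framePlots.continuousOn {γ : Eu k → SO o} {O : Set (Eu k)} (h : framePlots m o k γ O) :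
    ContinuousOn γ O := by
  rw [continuousOn_iff_continuous_domRestrict, continuous_iInf_rng]
  intro i
  rw [continuous_induced_rng]
  exact continuousOn_iff_continuous_domRestrict.1 (h i).continuousOn

end Topology

variable [VectorBundle ℝ (Eu n) E]

lemma FSm.base (hn : 0 < n) [IsManifold (𝓡 m) ∞ M] [ContMDiffVectorBundle ∞ (Eu n) E (𝓡 m)]
    {x : X → M} {f : ∀ t, OFrame o (x t)}
    {O : Set X} (h : FSm m k x f O) : ContMDiffOn (𝓡 k) (𝓡 m) ∞ x O := fun t ht =>
  ((Bundle.contMDiffWithinAt_totalSpace).1 (h ⟨0, hn⟩ t ht)).1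

/-- Linear combinations of smooth families of vectors over the same family of points are smooth. -/
lemma contMDiffOn_sum_smul {x : X → M} {O : Set X} {ι : Type*} {s : Finset ι}
    (hx : ContMDiffOn (𝓡 k) (𝓡 m) ∞ x O) {v : ι → ∀ t, E (x t)} {c : ι → X → ℝ}
    (hv : ∀ i ∈ s, ContMDiffOn (𝓡 k) ((𝓡 m).prod 𝓘(ℝ, Eu n)) ∞
      (fun t => (⟨x t, v i t⟩ : TotalSpace (Eu n) E)) O)
    (hc : ∀ i ∈ s, ContMDiffOn (𝓡 k) 𝓘(ℝ, ℝ) ∞ (c i) O) :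
    ContMDiffOn (𝓡 k) ((𝓡 m).prod 𝓘(ℝ, Eu n)) ∞
      (fun t => (⟨x t, ∑ i ∈ s, c i t • v i t⟩ : TotalSpace (Eu n) E)) O := by
  intro t ht
  rw [Bundle.contMDiffWithinAt_totalSpace]
  refine ⟨hx t ht, ?_⟩
  have h1 : ∀ i ∈ s, ContMDiffWithinAt (𝓡 k) 𝓘(ℝ, Eu n) ∞
      (fun t' => c i t' • (trivializationAt (Eu n) E (x t) ⟨x t', v i t'⟩).2) O t := fun i hi =>
    (hc i hi t ht).smul ((Bundle.contMDiffWithinAt_totalSpace).1 (hv i hi t ht)).2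
  refine (ContMDiffWithinAt.sum h1).congr_of_eventuallyEq_of_mem ?_ ht
  have h2 : ∀ᶠ t' in 𝓝[O] t, x t' ∈ (trivializationAt (Eu n) E (x t)).baseSet :=
    (hx t ht).continuousWithinAt.eventually
      ((trivializationAt (Eu n) E (x t)).open_baseSet.mem_nhds (mem_baseSet_trivializationAt _ _ _))
  filter_upwards [h2] with t' ht'
  have hl := (trivializationAt (Eu n) E (x t)).linear ℝ ht'
  have := map_sum (hl.mk' _) (fun i => c i t' • v i t') s
  simp only [map_smul] at this
  exact this

variable [IsManifold (𝓡 m) ∞ M] [ContMDiffVectorBundle ∞ (Eu n) E (𝓡 m)]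
  [IsContMDiffRiemannianBundle (𝓡 m) ∞ (Eu n) E]

lemma FSm.rot_smooth {x : X → M} {f f' : ∀ t, OFrame o (x t)} {O : Set X} (h : FSm m k x f O)
    (h' : FSm m k x f' O) (i j : Fin n) : ContMDiffOn (𝓡 k) 𝓘(ℝ, ℝ) ∞
      (fun t => rot (f t) (f' t) (EuclideanSpace.basisFun (Fin n) ℝ i) j) O := by
  simp only [rot_apply]
  exact (h j).inner_bundle (h' i)

lemma FSm.rotate {x : X → M} {f : ∀ t, OFrame o (x t)} {O : Set X}
    (hx : ContMDiffOn (𝓡 k) (𝓡 m) ∞ x O) (h : FSm m k x f O) {g : X → Eu n ≃ₗᵢ[ℝ] Eu n}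
    (hg : ∀ t, LinearMap.det (g t).toLinearMap = 1)
    (hgs : ∀ i j, ContMDiffOn (𝓡 k) 𝓘(ℝ, ℝ) ∞
      (fun t => g t (EuclideanSpace.basisFun (Fin n) ℝ i) j) O) :
    FSm m k x (fun t => (f t).rotate (g t) (hg t)) O := fun i => by
  simp only [rotate_apply]
  exact contMDiffOn_sum_smul hx (fun j _ => h j) fun j _ => hgs i j

lemma finrank_fiber (x : M) : Module.finrank ℝ (E x) = n := by
  have e := (trivializationAt (Eu n) E x).linearEquivAt ℝ x (mem_baseSet_trivializationAt _ _ _)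
  rw [e.finrank_eq, finrank_euclideanSpace_fin]

lemma OFrame.nonempty (hn : 0 < n) (x : M) : Nonempty (OFrame o x) :=
  ⟨⟨(o x).finOrthonormalBasis hn (finrank_fiber x), (o x).finOrthonormalBasis_orientation hn _⟩⟩

lemma contMDiffOn_inv_real {f : X → ℝ} {O : Set X} (hf : ContMDiffOn (𝓡 k) 𝓘(ℝ, ℝ) ∞ f O)
    (h0 : ∀ x ∈ O, f x ≠ 0) : ContMDiffOn (𝓡 k) 𝓘(ℝ, ℝ) ∞ (fun x => (f x)⁻¹) O := fun x hx =>
  ((contDiffAt_inv ℝ (h0 x hx)).contMDiffAt (n := ∞)).comp_contMDiffWithinAt x (hf x hx)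

lemma contMDiffOn_sqrt {f : X → ℝ} {O : Set X} (hf : ContMDiffOn (𝓡 k) 𝓘(ℝ, ℝ) ∞ f O)
    (h0 : ∀ x ∈ O, f x ≠ 0) : ContMDiffOn (𝓡 k) 𝓘(ℝ, ℝ) ∞ (fun x => Real.sqrt (f x)) O := fun x hx =>
  ((Real.contDiffAt_sqrt (h0 x hx)).contMDiffAt (n := ∞)).comp_contMDiffWithinAt x (hf x hx)

/-- Gram–Schmidt orthonormalisation of a smooth frame is smooth. -/
lemma contMDiffOn_gramSchmidt {U : Set M} {v : Fin n → ∀ x, E x}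
    (hv : ∀ i, ContMDiffOn (𝓡 m) ((𝓡 m).prod 𝓘(ℝ, Eu n)) ∞
      (fun x => (⟨x, v i x⟩ : TotalSpace (Eu n) E)) U)
    (hli : ∀ x ∈ U, LinearIndependent ℝ fun i => v i x) (i : Fin n) :
    ContMDiffOn (𝓡 m) ((𝓡 m).prod 𝓘(ℝ, Eu n)) ∞
      (fun x => (⟨x, InnerProductSpace.gramSchmidt ℝ (fun i => v i x) i⟩ : TotalSpace (Eu n) E)) U := by
  induction i using WellFoundedLT.induction with
  | ind i ih =>
    -- The Gram–Schmidt vector is written as one linear combination: the index `none` stands for `v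
    -- i` and `some j` for the projection onto the earlier vector `j`.
    let c : Option (Fin n) → M → ℝ := fun j x => match j with
      | none => 1
      | some j => -((inner ℝ (InnerProductSpace.gramSchmidt ℝ (fun i => v i x) j) (v i x)) *
          (inner ℝ (InnerProductSpace.gramSchmidt ℝ (fun i => v i x) j)
            (InnerProductSpace.gramSchmidt ℝ (fun i => v i x) j))⁻¹)
    let w : Option (Fin n) → ∀ x, E x := fun j x => match j with
      | none => v i x
      | some j => InnerProductSpace.gramSchmidt ℝ (fun i => v i x) j
    refine (contMDiffOn_sum_smul (s := Finset.insertNone (Finset.Iio i)) (c := c) (v := w) contMDiffOn_id ?_ ?_).congr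
      fun x hx => ?_
    · rintro (_ | j) hj
      · exact hv i
      · exact ih j (Finset.mem_Iio.1 (Finset.some_mem_insertNone.1 hj))
    · rintro (_ | j) hj
      · exact contMDiffOn_const
      · have hj' := ih j (Finset.mem_Iio.1 (Finset.some_mem_insertNone.1 hj))
        refine ((hj'.inner_bundle (hv i)).mul (contMDiffOn_inv_real (hj'.inner_bundle hj')
          fun x hx => ?_)).neg
        exact inner_self_ne_zero.2 (InnerProductSpace.gramSchmidt_ne_zero j (hli x hx))
    · have h := InnerProductSpace.gramSchmidt_def'' ℝ (fun i => v i x) i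
      simp only [Finset.sum_insertNone, c, w, one_smul]
      congr 1
      rw [eq_sub_of_add_eq h.symm, sub_eq_add_neg, ← Finset.sum_neg_distrib]
      simp only [← neg_smul, real_inner_self_eq_norm_sq, div_eq_mul_inv]
      rfl

/-- Smooth local sections of the bundle of oriented orthonormal frames exist. -/
lemma exists_local_section (hn : 0 < n) (ho : IsOrientation o) (p : M) :
    ∃ U : Set M, IsOpen U ∧ p ∈ U ∧ ∃ s : ∀ x, OFrame o x, FSm m m id s U := by
  have : IsContinuousRiemannianBundle (Eu n) E := by
    obtain ⟨g, hg, h⟩ :=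
      IsContMDiffRiemannianBundle.exists_contMDiff (IB := 𝓡 m) (n := ∞) (F := Eu n) (E := E)
    exact ⟨g, hg.continuous, h⟩
  obtain ⟨U₀, hU₀, hp₀, b, hb, hbo⟩ := ho p
  have hfd : ∀ x, FiniteDimensional ℝ (E x) := fun x =>
    Module.finite_of_finrank_pos (by rw [finrank_fiber (n := n) x]; exact hn)
  obtain ⟨f⟩ := OFrame.nonempty (o := o) hn p
  let e := trivializationAt (Eu n) E p
  have hpe : p ∈ e.baseSet := mem_baseSet_trivializationAt _ _ _
  -- Reading the chosen frame `f` in the trivialisation gives a local frame whose value at `p` is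
  -- `f`. It is already orthonormal and oriented there, so Gram–Schmidt leaves it unchanged at `p`.
  let β : Module.Basis (Fin n) ℝ (Eu n) := f.1.toBasis.map (e.linearEquivAt ℝ p hpe)
  let v : Fin n → ∀ x, E x := e.localFrame β
  have hv : ∀ i, ContMDiffOn (𝓡 m) ((𝓡 m).prod 𝓘(ℝ, Eu n)) ∞
      (fun x => (⟨x, v i x⟩ : TotalSpace (Eu n) E)) e.baseSet :=
    fun i => e.contMDiffOn_localFrame_baseSet ∞ β i
  have hve : ∀ x (hx : x ∈ e.baseSet), (fun i => v i x) = e.basisAt β hx := fun x hx => by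
    ext i; simp [v, hx]
  have hli : ∀ x ∈ e.baseSet, LinearIndependent ℝ fun i => v i x := fun x hx => by
    rw [hve x hx]; exact (e.basisAt β hx).linearIndependent
  have hvp : (fun i => v i p) = f.1 := by
    rw [hve p hpe]; ext i
    simpa [β, Bundle.Trivialization.basisAt] using e.symm_apply_apply_mk hpe (f.1 i)
  let s : ∀ x, OrthonormalBasis (Fin n) ℝ (E x) := fun x =>
    InnerProductSpace.gramSchmidtOrthonormalBasis ((finrank_fiber x).trans (Fintype.card_fin n).symm)
      fun i => v i x
  have hs : ∀ i, ContMDiffOn (𝓡 m) ((𝓡 m).prod 𝓘(ℝ, Eu n)) ∞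
      (fun x => (⟨x, s x i⟩ : TotalSpace (Eu n) E)) e.baseSet := fun i => by
    have hg := contMDiffOn_gramSchmidt hv hli i
    have hne : ∀ x ∈ e.baseSet, InnerProductSpace.gramSchmidt ℝ (fun i => v i x) i ≠ 0 :=
      fun x hx => InnerProductSpace.gramSchmidt_ne_zero i (hli x hx)
    have hpos : ∀ x ∈ e.baseSet, inner ℝ (InnerProductSpace.gramSchmidt ℝ (fun i => v i x) i)
        (InnerProductSpace.gramSchmidt ℝ (fun i => v i x) i) ≠ 0 := fun x hx =>
      inner_self_ne_zero.2 (hne x hx)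
    refine (contMDiffOn_sum_smul (s := {i}) (v := fun i x => InnerProductSpace.gramSchmidt ℝ (fun i => v i x) i)
      (c := fun i x => (Real.sqrt (inner ℝ (InnerProductSpace.gramSchmidt ℝ (fun i => v i x) i)
        (InnerProductSpace.gramSchmidt ℝ (fun i => v i x) i)))⁻¹) contMDiffOn_id ?_ ?_).congr
      fun x hx => ?_
    · intro j hj; rw [Finset.mem_singleton.1 hj]; exact hg
    · intro j hj; rw [Finset.mem_singleton.1 hj]
      refine contMDiffOn_inv_real (contMDiffOn_sqrt (hg.inner_bundle hg) hpos) fun x hx => ?_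
      rw [← norm_eq_sqrt_real_inner]; exact norm_ne_zero_iff.2 (hne x hx)
    · rw [Finset.sum_singleton]
      congr 1
      simp only [s]
      rw [InnerProductSpace.gramSchmidtOrthonormalBasis_apply, InnerProductSpace.gramSchmidtNormed,
        ← norm_eq_sqrt_real_inner]
      · rfl
      · exact fun h => by
          have := InnerProductSpace.gramSchmidtNormed_unit_length i (hli x hx)
          rw [h] at this; simp at this
  have hsp : s p = f.1 := by
    refine DFunLike.coe_injective (funext fun i => ?_)
    simp only [s]
    have horth : Pairwise fun i j => inner ℝ (v i p) (v j p) = 0 := fun i j hij => by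
      change inner ℝ (v i p) (v j p) = 0
      rw [congrFun hvp i, congrFun hvp j]; exact f.1.inner_eq_zero hij
    rw [InnerProductSpace.gramSchmidtOrthonormalBasis_apply_of_orthogonal _ horth,
      congrFun hvp i]
    · simp
    · rw [congrFun hvp i]; exact f.1.toBasis.ne_zero i
  -- The sign of `D` compares `s` with the continuous oriented frame `b`. It is positive at `p`,
  -- hence nearby, and there `s` is oriented.
  let D : M → ℝ := fun x => (Matrix.of fun i j => inner ℝ (s x i) (b x j)).det
  have hD : ∀ x, D x = (s x).toBasis.det (b x) := fun x => by
    rw [Module.Basis.det_apply]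
    change Matrix.det _ = Matrix.det _
    congr 1
    ext i j
    simp [Module.Basis.toMatrix_apply, OrthonormalBasis.repr_apply_apply]
  have hDc : ContinuousOn D (U₀ ∩ e.baseSet) := by
    have hc : ContinuousOn (fun x => Matrix.of fun i j => inner ℝ (s x i) (b x j)) (U₀ ∩ e.baseSet) :=
      continuousOn_pi.2 fun i => continuousOn_pi.2 fun j =>
        ((hs i).continuousOn.mono Set.inter_subset_right).inner_bundle
          ((hb j).mono Set.inter_subset_left)
    exact (Continuous.matrix_det continuous_id).comp_continuousOn hc
  have hDo : ∀ x, 0 < D x ↔ (s x).toBasis.orientation = (b x).orientation := fun x => by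
    rw [hD, Module.Basis.orientation_eq_iff_det_pos]
  have hopen : IsOpen (U₀ ∩ e.baseSet ∩ D ⁻¹' Set.Ioi 0) :=
    hDc.isOpen_inter_preimage (hU₀.inter e.open_baseSet) isOpen_Ioi
  classical
  let s' : ∀ x, OFrame o x := fun x => if hx : (s x).toBasis.orientation = o x then ⟨s x, hx⟩
    else (OFrame.nonempty hn x).some
  refine ⟨_, hopen, ⟨⟨hp₀, hpe⟩, ?_⟩, s', fun i => ?_⟩
  · rw [Set.mem_preimage, Set.mem_Ioi, hDo, hbo p hp₀, hsp]; exact f.2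
  · refine ((hs i).mono fun x hx => hx.1.2).congr fun x hx => ?_
    have h := ((hDo x).1 hx.2).trans (hbo x hx.1.1)
    rw [show s' x = ⟨s x, h⟩ from dif_pos h]
    rfl

end FrameBundle

/-! ### Smoothness on manifolds through families -/

section Plots

variable {m : ℕ} {M : Type*} [TopologicalSpace M] [ChartedSpace (Eu m) M] [IsManifold (𝓡 m) ∞ M]

/-- A map that is smooth along smooth families is smooth. -/
lemma contMDiffOn_of_plots {F H N : Type*} [NormedAddCommGroup F] [NormedSpace ℝ F]
    [TopologicalSpace H] {I : ModelWithCorners ℝ F H} [TopologicalSpace N] [ChartedSpace H N]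
    {f : M → N} {W : Set M} (hW : IsOpen W)
    (h : ∀ (γ : Eu m → M) (O : Set (Eu m)), IsOpen O → ContMDiffOn (𝓡 m) (𝓡 m) ∞ γ O →
      Set.MapsTo γ O W → ContMDiffOn (𝓡 m) I ∞ (fun t => f (γ t)) O) :
    ContMDiffOn (𝓡 m) I ∞ f W := by
  intro x hx
  let e := chartAt (Eu m) x
  -- The inverse of a chart is itself a smooth family, and testing along it suffices.
  have hO : IsOpen (e.target ∩ e.symm ⁻¹' W) := e.symm.isOpen_inter_preimage hW
  have h1 := h e.symm _ hO ((contMDiffOn_chart_symm (I := 𝓡 m) (n := ∞) (x := x)).mono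
    Set.inter_subset_left) fun t ht => ht.2
  have hxs : x ∈ e.source := mem_chart_source _ x
  have hex : e x ∈ e.target ∩ e.symm ⁻¹' W :=
    ⟨e.map_source hxs, by rw [Set.mem_preimage, e.left_inv hxs]; exact hx⟩
  have h2 : ContMDiffAt (𝓡 m) I ∞ (fun t => f (e.symm t)) (e x) := h1.contMDiffAt (hO.mem_nhds hex)
  have h3 : ContMDiffAt (𝓡 m) (𝓡 m) ∞ e x := contMDiffAt_of_mem_maximalAtlas
    (IsManifold.chart_mem_maximalAtlas x) hxs
  refine ((h2.comp x h3).congr_of_eventuallyEq ?_).contMDiffWithinAt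
  filter_upwards [e.open_source.mem_nhds hxs] with y hy
  simp [e.left_inv hy]

lemma smoothFun_iff {T : Type*} [NormedAddCommGroup T] [NormedSpace ℝ T] {f : M → T} {W : Set M}
    (hW : IsOpen W) : SmoothFun (manifoldPlots m M) W f ↔ ContMDiffOn (𝓡 m) 𝓘(ℝ, T) ∞ f W :=
  ⟨fun h => contMDiffOn_of_plots hW fun γ O hO hγ hm =>
    contMDiffOn_iff_contDiffOn.2 (h m γ O hO hγ hm),
  fun h _ _ _ _ hγ hm => contMDiffOn_iff_contDiffOn.1 (h.comp hγ hm)⟩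

end Plots

/-! ### Unitary functions and unitary atlases -/

section Unitary

variable {K : Type} [RCLike K] {k : ℕ} {X : Type*} [TopologicalSpace X] [ChartedSpace (Eu k) X]

/-- A smooth function with values in the scalars of absolute value one. -/
def USm (k : ℕ) {X : Type*} [TopologicalSpace X] [ChartedSpace (Eu k) X] {K : Type} [RCLike K]
    (z : X → unitary K) (W : Set X) : Prop :=
  ContMDiffOn (𝓡 k) 𝓘(ℝ, K) ∞ (fun x => (z x : K)) W

variable {z w : X → unitary K} {W W' : Set X}

lemma USm.mono (h : USm k z W) (hW : W' ⊆ W) : USm k z W' := ContMDiffOn.mono h hW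

lemma USm.congr (h : USm k z W) (hw : ∀ x ∈ W, w x = z x) : USm k w W :=
  ContMDiffOn.congr h fun x hx => by rw [hw x hx]

lemma usm_const (c : unitary K) : USm k (fun _ : X => c) W := contMDiffOn_const

lemma USm.mul (hz : USm k z W) (hw : USm k w W) : USm k (fun x => z x * w x) W :=
  ContMDiffOn.rmul hz hw

lemma USm.inv (hz : USm k z W) : USm k (fun x => (z x)⁻¹) W :=
  (RCLike.conjCLE (K := K)).contDiff.contMDiff.comp_contMDiffOn hz

lemma USm.of_local (h : ∀ x ∈ W, ∃ U, IsOpen U ∧ x ∈ U ∧ USm k z (W ∩ U)) : USm k z W :=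
  contMDiffOn_of_locally_contMDiffOn h

lemma USm.comp {l : ℕ} {Y : Type*} [TopologicalSpace Y] [ChartedSpace (Eu l) Y] (h : USm k z W)
    {y : Y → X} {O : Set Y} (hy : ContMDiffOn (𝓡 l) (𝓡 k) ∞ y O) (hO : Set.MapsTo y O W) :
    USm l (fun t => z (y t)) O := ContMDiffOn.comp (g := fun x => (z x : K)) h hy hO

lemma USm.unitScalar {n : ℕ} (h : USm k z W) :
    WSm k K (fun x => spinVal (unitScalar (z x) : spinK K n)) W := wsm_unitScalar.2 h

/-- A principal bundle with group the scalars of absolute value one, trivialised at every point: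
local sections, as functions with values in the group, which differ by smooth functions. -/
structure UAtlas (K : Type) [RCLike K] (m : ℕ) (M : Type*) [TopologicalSpace M]
    [ChartedSpace (Eu m) M] where
  U : M → Set M
  nbhds : IsNbhds U
  ζ : M → M → unitary K
  smooth : ∀ p q, USm m (fun x => (ζ p x)⁻¹ * ζ q x) (U p ∩ U q)

namespace UAtlas

variable {m : ℕ} {M : Type*} [TopologicalSpace M] [ChartedSpace (Eu m) M]

/-- Two unitary atlases describe isomorphic bundles. -/
def Equiv (A B : UAtlas K m M) : Prop :=
  ∃ h : M → unitary K, ∀ p q, USm m (fun x => (A.ζ p x)⁻¹ * B.ζ q x * h x) (A.U p ∩ B.U q)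

/-- The trivial bundle. -/
def one : UAtlas K m M where
  U := fun _ => Set.univ
  nbhds := fun _ => ⟨isOpen_univ, trivial⟩
  ζ := fun _ _ => 1
  smooth := fun _ _ => usm_const _

/-- The tensor product of two bundles. -/
def mul (A B : UAtlas K m M) : UAtlas K m M where
  U := fun p => A.U p ∩ B.U p
  nbhds := A.nbhds.inter B.nbhds
  ζ := fun p x => A.ζ p x * B.ζ p x
  smooth := fun p q => by
    have h1 := (A.smooth p q).mono (fun x (hx : x ∈ A.U p ∩ B.U p ∩ (A.U q ∩ B.U q)) =>
      ⟨hx.1.1, hx.2.1⟩)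
    have h2 := (B.smooth p q).mono (fun x (hx : x ∈ A.U p ∩ B.U p ∩ (A.U q ∩ B.U q)) =>
      ⟨hx.1.2, hx.2.2⟩)
    refine (h1.mul h2).congr fun x _ => ?_
    rw [mul_inv, mul_mul_mul_comm]

/-- It suffices to compare local sections with the same index. -/
lemma equiv_of_diag {A B : UAtlas K m M} {V : M → Set M} (hV : IsNbhds V) {h : M → unitary K}
    (hh : ∀ p, USm m (fun x => (A.ζ p x)⁻¹ * B.ζ p x * h x) (V p)) : A.Equiv B := by
  refine ⟨h, fun p q => USm.of_local fun x hx => ?_⟩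
  -- Near `x` the sections with indices `p` and `q` are compared through those with index `x`, where
  -- the hypothesis on the diagonal applies.
  refine ⟨V x ∩ (A.U x ∩ B.U x), (hV x).1.inter ((A.nbhds x).1.inter (B.nbhds x).1),
    ⟨(hV x).2, (A.nbhds x).2, (B.nbhds x).2⟩, ?_⟩
  have h1 := (A.smooth p x).mono
    (fun y (hy : y ∈ A.U p ∩ B.U q ∩ (V x ∩ (A.U x ∩ B.U x))) => ⟨hy.1.1, hy.2.2.1⟩)
  have h2 := (B.smooth x q).mono
    (fun y (hy : y ∈ A.U p ∩ B.U q ∩ (V x ∩ (A.U x ∩ B.U x))) => ⟨hy.2.2.2, hy.1.2⟩)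
  have h3 := (hh x).mono
    (fun y (hy : y ∈ A.U p ∩ B.U q ∩ (V x ∩ (A.U x ∩ B.U x))) => hy.2.1)
  refine ((h1.mul h3).mul h2).congr fun y _ => ?_
  rw [mul_right_comm ((A.ζ p y)⁻¹ * A.ζ x y)]
  simp [mul_assoc, mul_comm, mul_left_comm]

lemma Equiv.symm {A B : UAtlas K m M} (h : A.Equiv B) : B.Equiv A := by
  obtain ⟨h, hh⟩ := h
  refine ⟨fun x => (h x)⁻¹, fun p q => ?_⟩
  refine ((hh q p).inv.mono fun x hx => ⟨hx.2, hx.1⟩).congr fun x _ => ?_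
  simp [mul_comm]

end UAtlas

end Unitary

/-! ### Smooth families in principal bundles over the frame bundle -/

section Families

variable {m n : ℕ} {M : Type*} [TopologicalSpace M] [ChartedSpace (Eu m) M]
  {E : M → Type*} [TopologicalSpace (TotalSpace (Eu n) E)]
  [∀ x, NormedAddCommGroup (E x)] [∀ x, InnerProductSpace ℝ (E x)]
  [FiberBundle (Eu n) E] {o : ∀ x, Orientation ℝ (E x) (Fin n)}
  {K : Type} [RCLike K] {k : ℕ}

lemma framePlots.mono {γ : Eu k → SO o} {O O' : Set (Eu k)} (h : framePlots m o k γ O)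
    (hO : O' ⊆ O) : framePlots m o k γ O' := fun i => (h i).mono hO

lemma framePlots.of_local {γ : Eu k → SO o} {O : Set (Eu k)}
    (h : ∀ t ∈ O, ∃ O' ⊆ O, IsOpen O' ∧ t ∈ O' ∧ framePlots m o k γ O') : framePlots m o k γ O :=
  fun i => contMDiffOn_of_locally_contMDiffOn fun t ht => by
    obtain ⟨O', h1, h2, h3, h4⟩ := h t ht
    exact ⟨O', h2, h3, (h4 i).mono Set.inter_subset_right⟩

namespace PrincipalBundle

variable (Q : PrincipalBundle (framePlots m o) (spinK K n) (spinPlots K n))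

/-- The element of the group that takes `u` to `u'`. -/
def div {y : SO o} (u u' : Q.carrier y) : spinK K n := (Q.simply_transitive u u').choose

lemma mul_div {y : SO o} (u u' : Q.carrier y) : Q.mul u (Q.div u u') = u' :=
  (Q.simply_transitive u u').choose_spec.1

lemma mul_left_cancel {y : SO o} {u : Q.carrier y} {g h : spinK K n} (e : Q.mul u g = Q.mul u h) :
    g = h := (Q.simply_transitive u (Q.mul u h)).unique e rfl

lemma nonempty_carrier (y : SO o) : Nonempty (Q.carrier y) :=
  let ⟨s, _, _⟩ := Q.cover y; ⟨s.2 y⟩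

variable {Q} {γ : Eu k → SO o} {u u' : ∀ t, Q.carrier (γ t)} {O O' : Set (Eu k)}

lemma SmoothFamily.mono (h : Q.SmoothFamily γ u O) (hO : O' ⊆ O) : Q.SmoothFamily γ u O' :=
  ⟨framePlots.mono h.1 hO, fun s hs O'' hO'' => h.2 s hs O'' (hO''.trans hO)⟩

/-- A family is smooth if it is locally a smooth multiple of a local section. -/
lemma smoothFamily_of_local (h : ∀ t₀ ∈ O, ∃ O' ⊆ O, IsOpen O' ∧ t₀ ∈ O' ∧ framePlots m o k γ O' ∧
      ∃ s ∈ Q.sections, Set.MapsTo γ O' s.1 ∧ ∃ g : Eu k → spinK K n,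
        WSm k K (fun t => spinVal (g t)) O' ∧ ∀ t ∈ O', Q.mul (s.2 (γ t)) (g t) = u t) :
    Q.SmoothFamily γ u O := by
  refine ⟨framePlots.of_local fun t ht => ?_, fun s hs O₁ hO₁ hO₁' hm g hg => ?_⟩
  · obtain ⟨O', h1, h2, h3, h4, -⟩ := h t ht
    exact ⟨O', h1, h2, h3, h4⟩
  · rw [spinPlots_iff]
    refine WSm.of_local fun t ht => ?_
    obtain ⟨O', h1, h2, h3, h4, s', hs', hm', g', hg', hu⟩ := h t (hO₁ ht)
    refine ⟨O', h2, h3, ?_⟩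
    -- The coordinate of `u` with respect to `s` is the transition function from `s` to `s'` times
    -- the coordinate with respect to `s'`.
    have htr : WSm k K (fun t => spinVal (Q.div (s.2 (γ t)) (s'.2 (γ t)))) (O₁ ∩ O') :=
      spinPlots_iff.1 (Q.transition s hs s' hs' k γ (O₁ ∩ O') (hO₁'.inter h2)
        (framePlots.mono h4 Set.inter_subset_right) (fun t ht => ⟨hm ht.1, hm' ht.2⟩) _
        fun t _ => Q.mul_div _ _)
    refine (htr.spin_mul (hg'.mono Set.inter_subset_right)).congr fun t ht => ?_
    congr 1
    refine Q.mul_left_cancel (u := s.2 (γ t)) ?_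
    rw [hg t ht.1, Q.mul_mul, Q.mul_div, hu t ht.2]

lemma SmoothFamily.exists_local (h : Q.SmoothFamily γ u O) (hO : IsOpen O) {t₀ : Eu k} (ht₀ : t₀ ∈ O) :
    ∃ O' ⊆ O, IsOpen O' ∧ t₀ ∈ O' ∧ framePlots m o k γ O' ∧
      ∃ s ∈ Q.sections, Set.MapsTo γ O' s.1 ∧ ∃ g : Eu k → spinK K n,
        WSm k K (fun t => spinVal (g t)) O' ∧ ∀ t ∈ O', Q.mul (s.2 (γ t)) (g t) = u t := by
  obtain ⟨s, hs, hst⟩ := Q.cover (γ t₀)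
  have hop : IsOpen (O ∩ γ ⁻¹' s.1) :=
    (framePlots.continuousOn h.1).isOpen_inter_preimage hO (Q.isOpen_dom s hs)
  exact ⟨_, Set.inter_subset_left, hop, ⟨ht₀, hst⟩, framePlots.mono h.1 Set.inter_subset_left, s, hs,
    fun t ht => ht.2, fun t => Q.div (s.2 (γ t)) (u t),
    spinPlots_iff.1 (h.2 s hs _ Set.inter_subset_left hop (fun t ht => ht.2) _
      fun t _ => Q.mul_div _ _), fun t _ => Q.mul_div _ _⟩

lemma SmoothFamily.of_local (h : ∀ t ∈ O, ∃ O' ⊆ O, IsOpen O' ∧ t ∈ O' ∧ Q.SmoothFamily γ u O') :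
    Q.SmoothFamily γ u O := smoothFamily_of_local fun t ht => by
  obtain ⟨O', h1, h2, h3, h4⟩ := h t ht
  obtain ⟨O₂, h5, h6⟩ := h4.exists_local h2 h3
  exact ⟨O₂, h5.trans h1, h6⟩

lemma smoothFamily_section (hγ : framePlots m o k γ O) (hO : IsOpen O)
    {s : Set (SO o) × ∀ y, Q.carrier y} (hs : s ∈ Q.sections) (hm : Set.MapsTo γ O s.1) :
    Q.SmoothFamily γ (fun t => s.2 (γ t)) O :=
  smoothFamily_of_local fun _ ht => ⟨O, subset_rfl, hO, ht, hγ, s, hs, hm, fun _ => 1,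
    wsm_const _, fun _ _ => Q.mul_one _⟩

lemma SmoothFamily.mul (h : Q.SmoothFamily γ u O) (hO : IsOpen O) {g : Eu k → spinK K n}
    (hg : WSm k K (fun t => spinVal (g t)) O) : Q.SmoothFamily γ (fun t => Q.mul (u t) (g t)) O :=
  smoothFamily_of_local fun t ht => by
    obtain ⟨O', h1, h2, h3, h4, s, hs, hm, g', hg', hu⟩ := h.exists_local hO ht
    exact ⟨O', h1, h2, h3, h4, s, hs, hm, fun t => g' t * g t, hg'.spin_mul (hg.mono h1),
      fun t ht => by rw [Q.mul_mul, hu t ht]⟩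

/-- In terms of a local section `s`, with `u = s g'` and `u' = s h`, the ratio is `g'⁻¹ h`. -/
lemma SmoothFamily.ratio (h : Q.SmoothFamily γ u O) (h' : Q.SmoothFamily γ u' O) (hO : IsOpen O)
    {g : Eu k → spinK K n} (hg : ∀ t ∈ O, Q.mul (u t) (g t) = u' t) :
    WSm k K (fun t => spinVal (g t)) O := WSm.of_local fun t ht => by
  obtain ⟨O', h1, h2, h3, h4, s, hs, hm, g', hg', hu⟩ := h.exists_local hO ht
  have h5 := spinPlots_iff.1 (h'.2 s hs O' h1 h2 hm (fun t => Q.div (s.2 (γ t)) (u' t))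
    fun t _ => Q.mul_div _ _)
  refine ⟨O', h2, h3, ((hg'.spin_inv.spin_mul h5).mono Set.inter_subset_right).congr fun t ht => ?_⟩
  congr 1
  rw [eq_inv_mul_iff_mul_eq]
  refine Q.mul_left_cancel (u := s.2 (γ t)) ?_
  rw [Q.mul_div, Q.mul_mul, hu t ht.2, hg t ht.1]

lemma SmoothFamily.congr (h : Q.SmoothFamily γ u O) (hO : IsOpen O) (hu : ∀ t ∈ O, u' t = u t) :
    Q.SmoothFamily γ u' O := smoothFamily_of_local fun t ht => by
  obtain ⟨O', h1, h2, h3, h4, s, hs, hm, g, hg, hu'⟩ := h.exists_local hO ht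
  exact ⟨O', h1, h2, h3, h4, s, hs, hm, g, hg, fun t ht => by rw [hu' t ht, hu t (h1 ht)]⟩

end PrincipalBundle

end Families

/-! ### Isomorphisms of spinor modules without smoothness -/

section AlgIso

variable {m n : ℕ} {M : Type*} [TopologicalSpace M] [ChartedSpace (Eu m) M]
  {E : M → Type*} [TopologicalSpace (TotalSpace (Eu n) E)]
  [∀ x, NormedAddCommGroup (E x)] [∀ x, InnerProductSpace ℝ (E x)]
  [FiberBundle (Eu n) E] {o : ∀ x, Orientation ℝ (E x) (Fin n)}
  {K : Type} [RCLike K] {V : Type} [AddCommGroup V] [Module K V]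
  {ρ : Representation K (spinK K n) V}

lemma Gerbe.nonempty (K : Type) [RCLike K] {x : M} (f f' : OFrame o x) : Nonempty (Gerbe K f f') :=
  let ⟨a, ha⟩ := exists_covering K (det_rot f f'); ⟨⟨a, ha⟩⟩

lemma Gerbe.exists_smul {x : M} {f f' : OFrame o x} (l l' : Gerbe K f f') :
    ∃ z, l' = l.smul z :=
  let ⟨z, hz⟩ := l.2.exists_unitScalar l'.2; ⟨z, Subtype.ext hz⟩

namespace SpinorModule

variable (S : SpinorModule m o ρ)

lemma frame_unitScalar (hρ : IsSpinRep ρ) {y : SO o} (u : S.Q.carrier y) (z : unitary K) (v : V) :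
    S.frame (S.Q.mul u (unitScalar z)) v = (z : K) • S.frame u v := by
  rw [S.frame_mul, hρ.scalar, map_smul]

/-- Elements of the lift over the same frame differ by a scalar. -/
lemma exists_scalar {x : M} {f : OFrame o x} {u u' : S.Q.carrier ⟨x, f⟩}
    (h : S.Q.proj u = S.Q.proj u') : ∃ z, u' = S.Q.mul u (unitScalar z) := by
  have h1 := S.Q.proj_mul u (S.Q.div u u')
  rw [S.Q.mul_div, h, rot_refl] at h1
  obtain ⟨z, hz⟩ := h1.eq_unitScalar
  exact ⟨z, by rw [← hz, S.Q.mul_div]⟩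

lemma proj_eq_of_covers {x : M} {f : OFrame o x} {u : S.Q.carrier ⟨x, f⟩} {f' : OFrame o x}
    {a : spinK K n} (h : Covers a (rot (S.Q.proj u) f')) : S.Q.proj (S.Q.mul u a) = f' :=
  rot_injective ((S.Q.proj_mul u a).unique h)

/-- The action on the lift is not assumed to respect scalars. It does because it induces the action
on `S`, which is linear in the scalars, and a nonzero vector of `V` detects scalars. -/
lemma actQ_smul (hρ : IsSpinRep ρ) {x : M} {f f' : OFrame o x} (z : unitary K) (l : Gerbe K f f')
    (u : S.Q.carrier ⟨x, f'⟩) : S.actQ (l.smul z) u = S.Q.mul (S.actQ l u) (unitScalar z) := by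
  obtain ⟨z', hz'⟩ := S.exists_scalar (u := S.actQ l u) (u' := S.actQ (l.smul z) u)
    (by rw [S.actQ_proj, S.actQ_proj])
  have := hρ.nontrivial
  obtain ⟨v, hv⟩ := exists_ne (0 : V)
  have h1 : (z : K) • S.frame (S.actQ l u) v = (z' : K) • S.frame (S.actQ l u) v := by
    rw [← S.frame_unitScalar hρ (S.actQ l u) z', ← hz', S.actQ_frame, S.actQ_frame, S.S.act_smul]
  have h2 : (z : K) = z' := smul_left_injective K ((S.frame (S.actQ l u)).map_ne_zero_iff.2 hv) h1
  rw [hz', Subtype.ext h2]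

/-- All elements of the lift over a point of `M` are related by the two actions. -/
lemma exists_actQ_mul {x : M} {f f' : OFrame o x} (u : S.Q.carrier ⟨x, f'⟩)
    (u' : S.Q.carrier ⟨x, f⟩) :
    ∃ (l : Gerbe K f f') (a : spinK K n), u' = S.Q.mul (S.actQ l u) a := by
  obtain ⟨l⟩ := Gerbe.nonempty K f f'
  exact ⟨l, S.Q.div (S.actQ l u) u', (S.Q.mul_div _ _).symm⟩

end SpinorModule

/-- An isomorphism of lifts, compatible with the action of the gerbe, not necessarily smooth. -/
structure AlgIso (S₁ S₂ : SpinorModule m o ρ) where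
  map : ∀ {y : SO o}, S₁.Q.carrier y → S₂.Q.carrier y
  map_mul : ∀ {y : SO o} (u : S₁.Q.carrier y) (a : spinK K n),
    map (S₁.Q.mul u a) = S₂.Q.mul (map u) a
  map_proj : ∀ {x : M} {f : OFrame o x} (u : S₁.Q.carrier ⟨x, f⟩),
    S₂.Q.proj (map u) = S₁.Q.proj u
  map_actQ : ∀ {x : M} {f f' : OFrame o x} (l : Gerbe K f f') (u : S₁.Q.carrier ⟨x, f'⟩),
    map (S₁.actQ l u) = S₂.actQ l (map u)

namespace AlgIso

variable {S₁ S₂ S₃ : SpinorModule m o ρ}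

/-- The identity. -/
def refl (S : SpinorModule m o ρ) : AlgIso S S := ⟨fun u => u, fun _ _ => rfl, fun _ => rfl, fun _ _ => rfl⟩

/-- Composition. -/
def trans (Φ : AlgIso S₁ S₂) (Ψ : AlgIso S₂ S₃) : AlgIso S₁ S₃ where
  map := fun u => Ψ.map (Φ.map u)
  map_mul := fun u a => by rw [Φ.map_mul, Ψ.map_mul]
  map_proj := fun u => by rw [Ψ.map_proj, Φ.map_proj]
  map_actQ := fun l u => by rw [Φ.map_actQ, Ψ.map_actQ]

/-- Multiplication by a function with values in the scalars. -/
def twist (Φ : AlgIso S₁ S₂) (z : M → unitary K) : AlgIso S₁ S₂ where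
  map := fun {y} u => S₂.Q.mul (Φ.map u) (unitScalar (z y.1))
  map_mul := fun u a => by
    rw [Φ.map_mul, ← S₂.Q.mul_mul, ← S₂.Q.mul_mul, unitScalar_comm]
  map_proj := fun u => by
    rw [← Φ.map_proj u]
    exact S₂.proj_eq_of_covers (by rw [rot_refl]; exact covers_unitScalar _)
  map_actQ := fun l u => by rw [Φ.map_actQ, S₂.actQ_right]

lemma trans_map (Φ : AlgIso S₁ S₂) (Ψ : AlgIso S₂ S₃) {y : SO o} (u : S₁.Q.carrier y) :
    (Φ.trans Ψ).map u = Ψ.map (Φ.map u) := rfl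

lemma refl_map {S : SpinorModule m o ρ} {y : SO o} (u : S.Q.carrier y) : (refl S).map u = u := rfl

lemma twist_map (Φ : AlgIso S₁ S₂) (z : M → unitary K) {y : SO o} (u : S₁.Q.carrier y) :
    (Φ.twist z).map u = S₂.Q.mul (Φ.map u) (unitScalar (z y.1)) := rfl

lemma map_injective (Φ : AlgIso S₁ S₂) {y : SO o} {u u' : S₁.Q.carrier y} (e : Φ.map u = Φ.map u') :
    u = u' := by
  have h1 : S₂.Q.mul (Φ.map u) 1 = S₂.Q.mul (Φ.map u) (S₁.Q.div u u') := by
    rw [← Φ.map_mul u (S₁.Q.div u u'), S₁.Q.mul_div, S₂.Q.mul_one, e]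
  rw [← S₁.Q.mul_div u u', ← S₂.Q.mul_left_cancel h1, S₁.Q.mul_one]

/-- The inverse. -/
def symm (Φ : AlgIso S₁ S₂) : AlgIso S₂ S₁ :=
  have h : ∀ {y : SO o} (u : S₂.Q.carrier y), ∃ u', Φ.map u' = u := fun {y} u => by
    obtain ⟨u₀⟩ := S₁.Q.nonempty_carrier y
    exact ⟨S₁.Q.mul u₀ (S₂.Q.div (Φ.map u₀) u), by rw [Φ.map_mul, S₂.Q.mul_div]⟩
  { map := fun u => (h u).choose
    map_mul := fun u a => Φ.map_injective (by rw [Φ.map_mul, (h u).choose_spec, (h _).choose_spec])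
    map_proj := fun u => by rw [← Φ.map_proj, (h u).choose_spec]
    map_actQ := fun l u => Φ.map_injective (by rw [Φ.map_actQ, (h u).choose_spec, (h _).choose_spec]) }

lemma map_symm_map (Φ : AlgIso S₁ S₂) {y : SO o} (u : S₂.Q.carrier y) : Φ.map (Φ.symm.map u) = u :=
  Exists.choose_spec (p := fun u' => Φ.map u' = u) _

/-- Two isomorphisms differ by a function on `M` with values in the scalars. -/
lemma exists_twist (hF : ∀ x, Nonempty (OFrame o x)) (Φ Ψ : AlgIso S₁ S₂) :
    ∃ z : M → unitary K, ∀ {y : SO o} (u : S₁.Q.carrier y), Ψ.map u = (Φ.twist z).map u := by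
  have h : ∀ x, ∃ z : unitary K, ∀ (f : OFrame o x) (u : S₁.Q.carrier ⟨x, f⟩),
      Ψ.map u = S₂.Q.mul (Φ.map u) (unitScalar z) := fun x => by
    obtain ⟨f₀⟩ := hF x
    obtain ⟨u₀⟩ := S₁.Q.nonempty_carrier ⟨x, f₀⟩
    obtain ⟨z, hz⟩ := S₂.exists_scalar (u := Φ.map u₀) (u' := Ψ.map u₀)
      (by rw [Φ.map_proj, Ψ.map_proj])
    refine ⟨z, fun f u => ?_⟩
    -- The scalar found at one element over `x` serves for all of them, since the gerbe and the
    -- structure group connect them and both commute with scalars.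
    obtain ⟨l, a, rfl⟩ := S₁.exists_actQ_mul u₀ u
    rw [Φ.map_mul, Ψ.map_mul, Φ.map_actQ, Ψ.map_actQ, hz, S₂.actQ_right, ← S₂.Q.mul_mul,
      ← S₂.Q.mul_mul, unitScalar_comm]
  choose z hz using h
  exact ⟨z, fun {y} u => hz y.1 y.2 u⟩

/-- Any two spinor modules are isomorphic if smoothness is disregarded. -/
lemma nonempty (hρ : IsSpinRep ρ) (hF : ∀ x, Nonempty (OFrame o x)) (S₁ S₂ : SpinorModule m o ρ) :
    Nonempty (AlgIso S₁ S₂) := by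
  -- One pair of elements with equal projections is chosen over each point of `M`, and `u₁ ↦ u₂` is
  -- then extended equivariantly.
  have h : ∀ x, ∃ (f₀ : OFrame o x) (u₁ : S₁.Q.carrier ⟨x, f₀⟩) (u₂ : S₂.Q.carrier ⟨x, f₀⟩),
      S₂.Q.proj u₂ = S₁.Q.proj u₁ := fun x => by
    obtain ⟨f₀⟩ := hF x
    obtain ⟨u₁⟩ := S₁.Q.nonempty_carrier ⟨x, f₀⟩
    obtain ⟨u₂⟩ := S₂.Q.nonempty_carrier ⟨x, f₀⟩
    obtain ⟨a, ha⟩ := exists_covering K (det_rot (S₂.Q.proj u₂) (S₁.Q.proj u₁))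
    exact ⟨f₀, u₁, S₂.Q.mul u₂ a, S₂.proj_eq_of_covers ha⟩
  choose f₀ u₁ u₂ hu using h
  let l : ∀ y : SO o, Gerbe K y.2 (f₀ y.1) := fun y => (Gerbe.nonempty K _ _).some
  let b₁ : ∀ y : SO o, S₁.Q.carrier y := fun y => S₁.actQ (l y) (u₁ y.1)
  let b₂ : ∀ y : SO o, S₂.Q.carrier y := fun y => S₂.actQ (l y) (u₂ y.1)
  have key : ∀ {y : SO o} (a : spinK K n), S₁.Q.div (b₁ y) (S₁.Q.mul (b₁ y) a) = a := fun {y} a =>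
    S₁.Q.mul_left_cancel (S₁.Q.mul_div _ _)
  refine ⟨⟨fun {y} u => S₂.Q.mul (b₂ y) (S₁.Q.div (b₁ y) u), fun {y} u a => ?_, fun {x f} u => ?_,
    fun {x f f'} l' u => ?_⟩⟩
  · rw [← S₂.Q.mul_mul]
    congr 1
    refine S₁.Q.mul_left_cancel (u := b₁ y) ?_
    rw [S₁.Q.mul_div, S₁.Q.mul_mul, S₁.Q.mul_div]
  · refine S₂.proj_eq_of_covers ?_
    have h1 := S₁.Q.proj_mul (b₁ ⟨x, f⟩) (S₁.Q.div (b₁ ⟨x, f⟩) u)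
    rw [S₁.Q.mul_div] at h1
    have h2 : S₂.Q.proj (b₂ ⟨x, f⟩) = S₁.Q.proj (b₁ ⟨x, f⟩) := by
      simp only [b₁, b₂]
      rw [S₁.actQ_proj, S₂.actQ_proj, hu]
    rwa [h2]
  · obtain ⟨a, rfl⟩ : ∃ a, u = S₁.Q.mul (b₁ ⟨x, f'⟩) a := ⟨_, (S₁.Q.mul_div _ _).symm⟩
    -- The chosen gerbe elements are not multiplicative. The defect is a scalar, which acts in the
    -- same way on both lifts by `actQ_smul`.
    obtain ⟨z, hz⟩ := Gerbe.exists_smul (l ⟨x, f⟩) (l'.mul (l ⟨x, f'⟩))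
    have h1 : S₁.actQ l' (b₁ ⟨x, f'⟩) = S₁.Q.mul (b₁ ⟨x, f⟩) (unitScalar z) := by
      rw [← S₁.actQ_smul hρ, ← hz, S₁.actQ_mul]
    have h2 : S₂.actQ l' (b₂ ⟨x, f'⟩) = S₂.Q.mul (b₂ ⟨x, f⟩) (unitScalar z) := by
      rw [← S₂.actQ_smul hρ, ← hz, S₂.actQ_mul]
    rw [S₁.actQ_right, h1, ← S₁.Q.mul_mul, key, key, S₂.actQ_right, h2, ← S₂.Q.mul_mul]

/-- The isomorphism of vector spaces induced by an isomorphism of lifts. -/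
def lin (Φ : AlgIso S₁ S₂) (y : SO o) : S₁.S.vb.fiber y ≃ₗ[K] S₂.S.vb.fiber y :=
  (S₁.frame (S₁.Q.nonempty_carrier y).some).symm.trans (S₂.frame (Φ.map (S₁.Q.nonempty_carrier y).some))

/-- The structure group acts through `ρ` on both sides, so `Φ.lin` does not depend on the element
chosen in its definition. -/
lemma map_frame (Φ : AlgIso S₁ S₂) {y : SO o} (u : S₁.Q.carrier y) (v : V) :
    S₂.frame (Φ.map u) v = Φ.lin y (S₁.frame u v) := by
  set u₀ := (S₁.Q.nonempty_carrier y).some with hu₀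
  obtain ⟨a, rfl⟩ : ∃ a, u = S₁.Q.mul u₀ a := ⟨_, (S₁.Q.mul_div _ _).symm⟩
  rw [Φ.map_mul, S₁.frame_mul, S₂.frame_mul, lin, ← hu₀]
  simp

lemma lin_act (Φ : AlgIso S₁ S₂) {x : M} {f f' : OFrame o x} (l : Gerbe K f f')
    (s : S₁.S.vb.fiber ⟨x, f'⟩) :
    Φ.lin ⟨x, f⟩ (S₁.S.act l s) = S₂.S.act l (Φ.lin ⟨x, f'⟩ s) := by
  obtain ⟨u⟩ := S₁.Q.nonempty_carrier ⟨x, f'⟩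
  obtain ⟨v, rfl⟩ := (S₁.frame u).surjective s
  rw [← S₁.actQ_frame, ← Φ.map_frame, Φ.map_actQ, S₂.actQ_frame, Φ.map_frame]

/-- The isomorphism is smooth over the subset `W` of `M`. -/
def SmoothOn (Φ : AlgIso S₁ S₂) (W : Set M) : Prop :=
  ∀ ⦃k : ℕ⦄ (γ : Eu k → SO o) (u : ∀ t, S₁.Q.carrier (γ t)) (O : Set (Eu k)), IsOpen O →
    S₁.Q.SmoothFamily γ u O → (∀ t ∈ O, (γ t).1 ∈ W) → S₂.Q.SmoothFamily γ (fun t => Φ.map (u t)) O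

lemma SmoothOn.mono {Φ : AlgIso S₁ S₂} {W W' : Set M} (h : Φ.SmoothOn W) (hW : W' ⊆ W) :
    Φ.SmoothOn W' := fun _ γ u O hO hu hm => h γ u O hO hu fun t ht => hW (hm t ht)

lemma SmoothOn.trans {Φ : AlgIso S₁ S₂} {Ψ : AlgIso S₂ S₃} {W : Set M} (h : Φ.SmoothOn W)
    (h' : Ψ.SmoothOn W) : (Φ.trans Ψ).SmoothOn W := fun _ γ u O hO hu hm =>
  h' γ _ O hO (h γ u O hO hu hm) hm

lemma smoothOn_refl (S : SpinorModule m o ρ) (W : Set M) : (refl S).SmoothOn W :=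
  fun _ _ _ _ _ hu _ => hu

lemma SmoothOn.congr {Φ Ψ : AlgIso S₁ S₂} {W : Set M} (h : Φ.SmoothOn W)
    (e : ∀ {y : SO o} (u : S₁.Q.carrier y), y.1 ∈ W → Ψ.map u = Φ.map u) : Ψ.SmoothOn W :=
  fun _ γ u O hO hu hm => (h γ u O hO hu hm).congr hO fun t ht => e _ (hm t ht)

lemma SmoothOn.of_local (hn : 0 < n) {Φ : AlgIso S₁ S₂} {W : Set M}
    (h : ∀ p ∈ W, ∃ U, IsOpen U ∧ p ∈ U ∧ Φ.SmoothOn (W ∩ U)) : Φ.SmoothOn W :=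
  fun _ γ u O hO hu hm => PrincipalBundle.SmoothFamily.of_local fun t ht => by
    obtain ⟨U, h1, h2, h3⟩ := h _ (hm t ht)
    have hop : IsOpen (O ∩ γ ⁻¹' (SO.pt ⁻¹' U)) :=
      (framePlots.continuousOn hu.1).isOpen_inter_preimage hO (h1.preimage (SO.continuous_pt hn))
    exact ⟨_, Set.inter_subset_left, hop, ⟨ht, h2⟩, h3 γ u _ hop (hu.mono Set.inter_subset_left)
      fun t ht => ⟨hm t ht.1, ht.2⟩⟩

variable [VectorBundle ℝ (Eu n) E] [IsManifold (𝓡 m) ∞ M] [ContMDiffVectorBundle ∞ (Eu n) E (𝓡 m)]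
  [IsContMDiffRiemannianBundle (𝓡 m) ∞ (Eu n) E]

lemma SmoothOn.twist (hn : 0 < n) {Φ : AlgIso S₁ S₂} {W : Set M} (h : Φ.SmoothOn W)
    {z : M → unitary K} (hz : USm m z W) : (Φ.twist z).SmoothOn W := fun _ γ u O hO hu hm =>
  (h γ u O hO hu hm).mul hO (hz.comp (FSm.base hn (framePlots_iff.1 hu.1)) hm).unitScalar

/-- Smooth families of pairs of frames lift locally to smooth families in the gerbe. -/
lemma exists_local_gerbe (K : Type) [RCLike K] (hn : 0 < n) {k : ℕ} {X : Type*} [TopologicalSpace X]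
    [ChartedSpace (Eu k) X] [IsManifold (𝓡 k) ∞ X] {x : X → M} {f f' : ∀ t, OFrame o (x t)} {O : Set X} (hO : IsOpen O)
    (hf : FSm m k x f O) (hf' : FSm m k x f' O) {t₀ : X} (ht₀ : t₀ ∈ O) :
    ∃ O' ⊆ O, IsOpen O' ∧ t₀ ∈ O' ∧ ∃ l : ∀ t, Gerbe K (f t) (f' t),
      WSm k K (fun t => spinVal (l t).1) O' := by
  obtain ⟨O', h1, h2, h3, a, ha, hs⟩ := exists_local_lift K hn hO
    (fun t _ => det_rot (f t) (f' t)) (hf.rot_smooth hf') ht₀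
  have hl : ∀ t, ∃ l : Gerbe K (f t) (f' t), t ∈ O → l.1 = a t := fun t => by
    by_cases h : t ∈ O
    · exact ⟨⟨a t, ha t h⟩, fun _ => rfl⟩
    · exact ⟨(Gerbe.nonempty K _ _).some, fun h' => absurd h' h⟩
  choose l hl using hl
  exact ⟨O', h1, h2, h3, l, hs.congr fun t ht => by rw [hl t (h1 ht)]⟩

/-- A family of elements of the lift over a section of the frame bundle is smooth. -/
def SectionSmooth (S : SpinorModule m o ρ) {σ : ∀ x, OFrame o x} (u : ∀ x, S.Q.carrier ⟨x, σ x⟩)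
    (W : Set M) : Prop :=
  ∀ ⦃k : ℕ⦄ (x : Eu k → M) (O : Set (Eu k)), IsOpen O → ContMDiffOn (𝓡 k) (𝓡 m) ∞ x O →
    Set.MapsTo x O W → S.Q.SmoothFamily (fun t => ⟨x t, σ (x t)⟩) (fun t => u (x t)) O

lemma SectionSmooth.mono {S : SpinorModule m o ρ} {σ : ∀ x, OFrame o x}
    {u : ∀ x, S.Q.carrier ⟨x, σ x⟩} {W W' : Set M} (h : SectionSmooth S u W) (hW : W' ⊆ W) :
    SectionSmooth S u W' := fun _ x O hO hx hm => h x O hO hx fun _ ht => hW (hm ht)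

/-- Over a small open subset of `M` the lift of a spinor module has smooth sections over a
section of the frame bundle. -/
lemma exists_section (S : SpinorModule m o ρ) {U : Set M} (hU : IsOpen U) {σ : ∀ x, OFrame o x}
    (hσ : FSm m m id σ U) {p : M} (hp : p ∈ U) :
    ∃ W ⊆ U, IsOpen W ∧ p ∈ W ∧ ∃ u : ∀ x, S.Q.carrier ⟨x, σ x⟩, SectionSmooth S u W := by
  obtain ⟨s, hs, hps⟩ := S.Q.cover ⟨p, σ p⟩
  have hc : ContinuousOn (fun x => (⟨x, σ x⟩ : SO o)) U := by
    rw [continuousOn_iff_continuous_domRestrict, continuous_iInf_rng]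
    intro i
    rw [continuous_induced_rng]
    exact continuousOn_iff_continuous_domRestrict.1 (hσ i).continuousOn
  refine ⟨U ∩ (fun x => (⟨x, σ x⟩ : SO o)) ⁻¹' s.1, Set.inter_subset_left,
    hc.isOpen_inter_preimage hU (S.Q.isOpen_dom s hs), ⟨hp, hps⟩, fun x => s.2 ⟨x, σ x⟩,
    fun _ x O hO hx hm => ?_⟩
  exact PrincipalBundle.smoothFamily_section (γ := fun t => (⟨x t, σ (x t)⟩ : SO o))
    (hσ.comp hx fun t ht => (hm ht).1) hO hs fun t ht => (hm ht).2

lemma SectionSmooth.proj {S : SpinorModule m o ρ} {σ : ∀ x, OFrame o x}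
    {u : ∀ x, S.Q.carrier ⟨x, σ x⟩} {W : Set M} (hW : IsOpen W) (h : SectionSmooth S u W) :
    FSm m m id (fun x => S.Q.proj (u x)) W := fun i =>
  contMDiffOn_of_plots hW fun x O hO hx hm => S.Q.proj_smooth _ _ O hO (h x O hO hx hm) i

/-- Scalar functions that relate two smooth isomorphisms are smooth. -/
lemma SmoothOn.ratio (hn : 0 < n) (ho : IsOrientation o) {Φ Ψ : AlgIso S₁ S₂} {W : Set M}
    (hW : IsOpen W) (h : Φ.SmoothOn W) (h' : Ψ.SmoothOn W) {z : M → unitary K}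
    (hz : ∀ {y : SO o} (u : S₁.Q.carrier y), y.1 ∈ W → Ψ.map u = (Φ.twist z).map u) : USm m z W := by
  refine USm.of_local fun p hp => ?_
  obtain ⟨U₀, hU₀, hp₀, σ, hσ⟩ := exists_local_section (m := m) hn ho p
  obtain ⟨U, -, hU, hpU, u, hu⟩ := exists_section S₁ hU₀ hσ hp₀
  refine ⟨U, hU, hpU, contMDiffOn_of_plots (hW.inter hU) fun x O hO hx hm => ?_⟩
  have h0 := hu x O hO hx fun t ht => (hm ht).2
  have h1 := h _ _ O hO h0 fun t ht => (hm ht).1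
  have h2 := h' _ _ O hO h0 fun t ht => (hm ht).1
  exact wsm_unitScalar.1 (h1.ratio h2 hO (g := fun t => unitScalar (z (x t)))
    fun t ht => (hz _ (hm ht).1).symm)

/-- Isomorphisms which take one smooth section to a smooth section are smooth. -/
lemma smoothOn_of_section (hn : 0 < n) {Φ : AlgIso S₁ S₂} {W : Set M} {σ : ∀ x, OFrame o x}
    (hσ : FSm m m id σ W) {u₁ : ∀ x, S₁.Q.carrier ⟨x, σ x⟩} (h₁ : SectionSmooth S₁ u₁ W)
    (h₂ : SectionSmooth S₂ (fun x => Φ.map (u₁ x)) W) : Φ.SmoothOn W := by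
  intro k γ u O hO hu hm
  have hx : ContMDiffOn (𝓡 k) (𝓡 m) ∞ (fun t => (γ t).1) O := FSm.base hn (framePlots_iff.1 hu.1)
  have hf : FSm m k (fun t => (γ t).1) (fun t => σ (γ t).1) O := hσ.comp hx hm
  refine PrincipalBundle.SmoothFamily.of_local fun t ht => ?_
  -- A smooth family over arbitrary frames is locally a smooth family in the gerbe applied to the
  -- given section, times a smooth group element. The isomorphism commutes with both operations.
  obtain ⟨O', hO', h1, h2, l, hl⟩ := exists_local_gerbe K hn hO (framePlots_iff.1 hu.1) hf ht
  have hx' := hx.mono hO'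
  have hG : SmoothGerbeFamily m l O' := ⟨framePlots.mono hu.1 hO', hf.mono hO', spinPlots_iff.2 hl⟩
  have h3 := S₁.actQ_smooth l _ O' h1 hG (h₁ _ O' h1 hx' fun t ht => hm t (hO' ht))
  have h4 := S₂.actQ_smooth l _ O' h1 hG (h₂ _ O' h1 hx' fun t ht => hm t (hO' ht))
  have h5 := h3.ratio (hu.mono hO') h1
    (g := fun t => S₁.Q.div (S₁.actQ (l t) (u₁ (γ t).1)) (u t)) fun t _ => S₁.Q.mul_div _ _
  refine ⟨O', hO', h1, h2, (h4.mul h1 h5).congr h1 fun t _ => ?_⟩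
  rw [← Φ.map_actQ, ← Φ.map_mul, S₁.Q.mul_div]

/-- Every isomorphism becomes smooth locally after multiplication by a scalar function. -/
lemma exists_twist_smoothOn (hn : 0 < n) (ho : IsOrientation o) (Φ : AlgIso S₁ S₂)
    (p : M) : ∃ W : Set M, IsOpen W ∧ p ∈ W ∧ ∃ z : M → unitary K, (Φ.twist z).SmoothOn W := by
  obtain ⟨U₀, hU₀, hp₀, σ, hσ⟩ := exists_local_section (m := m) hn ho p
  obtain ⟨U₁, hs₁, hU₁, hp₁, u₁, hu₁⟩ := exists_section S₁ hU₀ hσ hp₀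
  obtain ⟨U, hs₂, hU, hp, u₂, hu₂⟩ := exists_section S₂ hU₁ (hσ.mono hs₁) hp₁
  replace hu₁ := hu₁.mono hs₂
  -- Multiplying `u₂` by `a` gives it the projection of `u₁`, and so of `Φ.map u₁`. The remaining
  -- scalar discrepancy `z` is the twist.
  obtain ⟨W, hWU, hW, hpW, a, ha⟩ := exists_local_gerbe K hn hU (hu₂.proj hU) (hu₁.proj hU) hp
  have hz : ∀ x, ∃ z, S₂.Q.mul (u₂ x) (a x).1 = S₂.Q.mul (Φ.map (u₁ x)) (unitScalar z) := fun x =>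
    S₂.exists_scalar (by rw [Φ.map_proj, S₂.proj_eq_of_covers (a x).2])
  choose z hz using hz
  refine ⟨W, hW, hpW, z, smoothOn_of_section hn (hσ.mono (hWU.trans (hs₂.trans hs₁))) (hu₁.mono hWU)
    fun _ x O hO hx hm => ?_⟩
  refine ((hu₂.mono hWU x O hO hx hm).mul hO (g := fun t => (a (x t)).1)
    fun φ => (ha φ).comp hx hm).congr hO fun t _ => ?_
  exact (hz _).symm

/-- Locally some twist of the inverse by a function `z` is smooth. Composing it with `Φ` gives
multiplication by `z`, so `z` is smooth by comparison with the identity, and the twist can be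
undone. -/
lemma SmoothOn.symm (hn : 0 < n) (ho : IsOrientation o) {Φ : AlgIso S₁ S₂} {W : Set M}
    (hW : IsOpen W) (h : Φ.SmoothOn W) : Φ.symm.SmoothOn W := by
  refine SmoothOn.of_local hn fun p hp => ?_
  obtain ⟨U, hU, hpU, z, hz⟩ := exists_twist_smoothOn hn ho Φ.symm p
  refine ⟨U, hU, hpU, ?_⟩
  have h1 : USm m z (W ∩ U) := ((hz.mono Set.inter_subset_right).trans
    (h.mono Set.inter_subset_left)).ratio hn ho (hW.inter hU) (smoothOn_refl S₂ _)
    (z := fun x => (z x)⁻¹) (fun {y} u hy => by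
      simp only [twist_map, trans_map, refl_map]
      rw [Φ.map_mul, map_symm_map, ← S₂.Q.mul_mul, ← unitScalar_mul, mul_inv_cancel, unitScalar_one,
        S₂.Q.mul_one]) |>.inv.congr fun x _ => (inv_inv _).symm
  refine ((hz.mono Set.inter_subset_right).twist hn h1.inv).congr fun {y} u hy => ?_
  simp only [twist_map]
  rw [← S₁.Q.mul_mul, ← unitScalar_mul, mul_inv_cancel, unitScalar_one, S₁.Q.mul_one]

end AlgIso

end AlgIso

/-! ### Smooth families of linear maps -/

section Linear

variable {k : ℕ} {X : Type*} [TopologicalSpace X] [ChartedSpace (Eu k) X] {K : Type} [RCLike K]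
  {W W' : Type*} [AddCommGroup W] [Module K W] [AddCommGroup W'] [Module K W'] {O : Set X}

lemma WSm.apply [FiniteDimensional K W] {A : X → W →ₗ[K] W'} {w : X → W}
    (hA : ∀ v, WSm k K (fun x => A x v) O) (hw : WSm k K w O) : WSm k K (fun x => A x (w x)) O := by
  let b := Module.finBasis K W
  refine (wsm_sum (s := Finset.univ) (F := fun i x => b.coord i (w x) • A x (b i))
    fun i _ => WSm.smul (hw _) (hA _)).congr fun x _ => ?_
  conv_lhs => rw [← b.sum_repr (w x), map_sum]
  simp only [map_smul, Module.Basis.coord_apply]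

lemma _root_.ContMDiffOn.rinv {c : X → K} (hc : ContMDiffOn (𝓡 k) 𝓘(ℝ, K) ∞ c O)
    (h0 : ∀ x ∈ O, c x ≠ 0) : ContMDiffOn (𝓡 k) 𝓘(ℝ, K) ∞ (fun x => (c x)⁻¹) O := fun x hx =>
  ContMDiffAt.comp_contMDiffWithinAt (g := fun z : K => z⁻¹) x
    (contDiffAt_inv ℝ (h0 x hx)).contMDiffAt (hc x hx)

lemma _root_.ContMDiffOn.rprod {ι : Type*} {s : Finset ι} {c : ι → X → K}
    (hc : ∀ i ∈ s, ContMDiffOn (𝓡 k) 𝓘(ℝ, K) ∞ (c i) O) :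
    ContMDiffOn (𝓡 k) 𝓘(ℝ, K) ∞ (fun x => ∏ i ∈ s, c i x) O := by
  classical
  induction s using Finset.induction_on with
  | empty => simpa using contMDiffOn_const
  | insert i s hi ih =>
    simp only [Finset.prod_insert hi]
    exact (hc i (Finset.mem_insert_self _ _)).rmul
      (ih fun j hj => hc j (Finset.mem_insert_of_mem hj))

lemma contMDiffOn_det {ι : Type*} [Fintype ι] [DecidableEq ι] {A : X → Matrix ι ι K}
    (hA : ∀ i j, ContMDiffOn (𝓡 k) 𝓘(ℝ, K) ∞ (fun x => A x i j) O) :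
    ContMDiffOn (𝓡 k) 𝓘(ℝ, K) ∞ (fun x => (A x).det) O := by
  simp only [Matrix.det_apply']
  exact contMDiffOn_finsetSum fun σ _ => contMDiffOn_const.rmul (.rprod fun i _ => hA _ _)

/-- The inverses of a smooth family of isomorphisms are smooth. -/
lemma WSm.symm_apply [FiniteDimensional K W] {A : X → W ≃ₗ[K] W}
    (hA : ∀ v, WSm k K (fun x => A x v) O) (v : W) : WSm k K (fun x => (A x).symm v) O := by
  let b := Module.finBasis K W
  let T : X → Matrix _ _ K := fun x => LinearMap.toMatrix b b (A x).toLinearMap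
  have hT : ∀ i j, ContMDiffOn (𝓡 k) 𝓘(ℝ, K) ∞ (fun x => T x i j) O := fun i j => by
    simp only [T, LinearMap.toMatrix_apply]
    exact hA (b j) (b.coord i)
  have hdet : ∀ x, (T x).det ≠ 0 := fun x => by
    simpa [T] using ((A x).isUnit_det').ne_zero
  -- Cramer's rule expresses the inverse by determinants, which are polynomials in the entries.
  have hinv : ∀ x i, b.coord i ((A x).symm v) = (T x).det⁻¹ * ∑ j, (T x).adjugate i j * b.coord j v := by
    intro x i
    have h1 : (T x).mulVec (b.repr ((A x).symm v)) = b.repr v := by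
      rw [LinearMap.toMatrix_mulVec_repr]; simp
    have h2 : (T x).adjugate.mulVec (b.repr v) = (T x).det • (b.repr ((A x).symm v) : _ → K) := by
      rw [← h1, Matrix.mulVec_mulVec, Matrix.adjugate_mul, Matrix.smul_mulVec, Matrix.one_mulVec]
    have h3 := congrFun h2 i
    simp only [Matrix.mulVec, dotProduct, Pi.smul_apply, smul_eq_mul] at h3
    rw [eq_inv_mul_iff_mul_eq₀ (hdet x)]
    exact h3.symm
  refine (wsm_sum (s := Finset.univ) (F := fun i x => b.coord i ((A x).symm v) • b i)
    fun i _ => WSm.smul ?_ (wsm_const _)).congr fun x _ => (b.sum_repr _).symm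
  simp only [hinv]
  refine ((contMDiffOn_det hT).rinv fun x _ => hdet x).rmul
    (contMDiffOn_finsetSum fun j _ => ContMDiffOn.rmul ?_ contMDiffOn_const)
  simp only [Matrix.adjugate_apply]
  refine contMDiffOn_det fun i' j' => ?_
  by_cases h : i' = j
  · subst h
    simpa using contMDiffOn_const
  · simpa [Matrix.updateRow_ne h] using hT i' j'

end Linear

/-! ### The difference of two spinor modules as a bundle of unit scalars on the base. -/

section Diff

variable {m n : ℕ} {M : Type*} [TopologicalSpace M] [ChartedSpace (Eu m) M]
  {E : M → Type*} [TopologicalSpace (TotalSpace (Eu n) E)]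
  [∀ x, NormedAddCommGroup (E x)] [∀ x, InnerProductSpace ℝ (E x)]
  [FiberBundle (Eu n) E] {o : ∀ x, Orientation ℝ (E x) (Fin n)}
  {K : Type} [RCLike K] {V : Type} [AddCommGroup V] [Module K V]
  {ρ : Representation K (spinK K n) V}

/-- Locally `u = s g`, and the frame of `s g` applied to `v` is the frame of `s` applied to `ρ g v`.
Smoothness of the representation enters here. -/
lemma SpinorModule.frame_smoothFamily (hρ : IsSpinRep ρ) (S : SpinorModule m o ρ) {k : ℕ}
    {γ : Eu k → SO o} {u : ∀ t, S.Q.carrier (γ t)} {O : Set (Eu k)} (hO : IsOpen O)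
    (hu : S.Q.SmoothFamily γ u O) {e : Set (SO o) × ∀ y, V ≃ₗ[K] S.S.vb.fiber y}
    (he : e ∈ S.S.vb.frames) (hm : Set.MapsTo γ O e.1) (v : V) :
    WSm k K (fun t => (e.2 (γ t)).symm (S.frame (u t) v)) O := WSm.of_local fun t ht => by
  have := hρ.finite
  obtain ⟨O', h1, h2, h3, h4, s, hs, hms, g, hg, hgu⟩ := hu.exists_local hO ht
  refine ⟨O', h2, h3, WSm.mono ?_ Set.inter_subset_right⟩
  refine (WSm.apply (A := fun t => ((S.frame (s.2 (γ t))).trans (e.2 (γ t)).symm).toLinearMap)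
    (w := fun t => ρ (g t) v) (fun v φ => ?_) fun φ => ?_).congr fun t ht => ?_
  · exact contMDiffOn_iff_contDiffOn.2
      (S.frame_smooth s hs v e he φ k γ O' h2 h4 fun t ht => ⟨hms ht, hm (h1 ht)⟩)
  · exact contMDiffOn_iff_contDiffOn.2
      (hρ.smooth v φ k g O' h2 (spinPlots_iff.2 hg) fun _ _ => trivial)
  · rw [← hgu t ht, S.frame_mul]
    rfl

/-- The identification of the fibres of two spinor modules given by smooth families of elements of
the lifts is smooth. -/
lemma SpinorModule.frame_ratio (hρ : IsSpinRep ρ) (S₁ S₂ : SpinorModule m o ρ) {k : ℕ}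
    {γ : Eu k → SO o} {u₁ : ∀ t, S₁.Q.carrier (γ t)} {u₂ : ∀ t, S₂.Q.carrier (γ t)} {O : Set (Eu k)}
    (hO : IsOpen O) (h₁ : S₁.Q.SmoothFamily γ u₁ O) (h₂ : S₂.Q.SmoothFamily γ u₂ O)
    {e : Set (SO o) × ∀ y, V ≃ₗ[K] S₁.S.vb.fiber y} (he : e ∈ S₁.S.vb.frames)
    (hm : Set.MapsTo γ O e.1) {e' : Set (SO o) × ∀ y, V ≃ₗ[K] S₂.S.vb.fiber y}
    (he' : e' ∈ S₂.S.vb.frames) (hm' : Set.MapsTo γ O e'.1) (v : V) :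
    WSm k K (fun t => (e'.2 (γ t)).symm (S₂.frame (u₂ t) ((S₁.frame (u₁ t)).symm (e.2 (γ t) v)))) O := by
  have := hρ.finite
  exact WSm.apply (A := fun t => ((S₂.frame (u₂ t)).trans (e'.2 (γ t)).symm).toLinearMap)
    (S₂.frame_smoothFamily hρ hO h₂ he' hm')
    (WSm.symm_apply (A := fun t => (S₁.frame (u₁ t)).trans (e.2 (γ t)).symm)
      (S₁.frame_smoothFamily hρ hO h₁ he hm) v)

variable {S₁ S₂ S₃ : SpinorModule m o ρ}

/-- For a local section `u` of the lift, the induced linear map is the frame of `Φ u` after the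
inverse of the frame of `u`. So smoothness on lifts implies smoothness on vector bundles. -/
lemma AlgIso.SmoothOn.lin_smooth (hρ : IsSpinRep ρ) {Φ : AlgIso S₁ S₂} {W : Set M}
    (h : Φ.SmoothOn W) {e : Set (SO o) × ∀ y, V ≃ₗ[K] S₁.S.vb.fiber y} (he : e ∈ S₁.S.vb.frames)
    (v : V) : S₂.S.vb.SmoothSection (e.1 ∩ {y | y.1 ∈ W}) fun y => Φ.lin y (e.2 y v) := by
  intro e' he' φ k γ O hO hγ hm
  rw [← contMDiffOn_iff_contDiffOn]
  refine WSm.of_local (f := fun t => (e'.2 (γ t)).symm (Φ.lin (γ t) (e.2 (γ t) v)))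
    (fun t ht => ?_) φ
  obtain ⟨s, hs, hst⟩ := S₁.Q.cover (γ t)
  have hop : IsOpen (O ∩ γ ⁻¹' s.1) :=
    (framePlots.continuousOn hγ).isOpen_inter_preimage hO (S₁.Q.isOpen_dom s hs)
  have h1 := PrincipalBundle.smoothFamily_section (framePlots.mono hγ Set.inter_subset_left) hop hs
    (fun t (ht : t ∈ O ∩ γ ⁻¹' s.1) => ht.2)
  have h2 := h _ _ _ hop h1 fun t ht => (hm ht.1).1.2
  refine ⟨_, hop, ⟨ht, hst⟩, ((S₁.frame_ratio hρ S₂ hop h1 h2 he (fun t ht => (hm ht.1).1.1) he'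
    (fun t ht => (hm ht.1).2) v).mono Set.inter_subset_right).congr fun t ht => ?_⟩
  rw [Φ.map_frame, LinearEquiv.apply_symm_apply]

/-- The spinor module `S₂` is the twist of `S₁` by the bundle `A`. -/
def IsDiff (S₁ S₂ : SpinorModule m o ρ) (A : UAtlas K m M) : Prop :=
  ∃ Φ : AlgIso S₁ S₂, ∀ p, (Φ.twist (A.ζ p)).SmoothOn (A.U p)

lemma AlgIso.twist_twist (Φ : AlgIso S₁ S₂) (z w : M → unitary K) {y : SO o} (u : S₁.Q.carrier y) :
    ((Φ.twist z).twist w).map u = (Φ.twist fun x => z x * w x).map u := by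
  simp only [twist_map]
  rw [← S₂.Q.mul_mul, ← unitScalar_mul]

lemma AlgIso.twist_one (Φ : AlgIso S₁ S₂) {y : SO o} (u : S₁.Q.carrier y) :
    (Φ.twist fun _ => 1).map u = Φ.map u := by
  rw [twist_map, unitScalar_one, S₂.Q.mul_one]

lemma isDiff_one_iff : IsDiff S₁ S₂ UAtlas.one ↔ ∃ Φ : AlgIso S₁ S₂, Φ.SmoothOn Set.univ := by
  constructor
  · rintro ⟨Φ, h⟩
    -- An atlas is indexed by the points of `M`, so an empty base offers no index and is treated
    -- apart. There are then no families at all.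
    by_cases hM : Nonempty M
    · exact ⟨Φ, (h hM.some).congr fun u _ => (Φ.twist_one u).symm⟩
    · exact ⟨Φ, fun _ γ _ _ _ _ _ => absurd ⟨(γ 0).1⟩ hM⟩
  · rintro ⟨Φ, h⟩
    exact ⟨Φ, fun p => h.congr fun u _ => Φ.twist_one u⟩

lemma isIso_iff_isDiff (hρ : IsSpinRep ρ) : S₁.IsIso S₂ ↔ IsDiff S₁ S₂ UAtlas.one := by
  rw [isDiff_one_iff]
  constructor
  · rintro ⟨Φ⟩
    exact ⟨⟨Φ.map, Φ.map_mul, Φ.map_proj, Φ.map_actQ⟩, fun _ γ u O hO hu _ => Φ.map_smooth γ u O hO hu⟩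
  · rintro ⟨Φ, h⟩
    exact ⟨⟨Φ.lin, fun e he v => by simpa using h.lin_smooth hρ he v, Φ.lin_act, Φ.map,
      Φ.map_mul, Φ.map_proj, Φ.map_frame, Φ.map_actQ,
      fun γ u O hO hu => h γ u O hO hu fun _ _ => trivial⟩⟩

lemma IsDiff.mul {A B : UAtlas K m M} (h : IsDiff S₁ S₂ A) (h' : IsDiff S₂ S₃ B) :
    IsDiff S₁ S₃ (A.mul B) := by
  obtain ⟨Φ, h⟩ := h
  obtain ⟨Ψ, h'⟩ := h'
  refine ⟨Φ.trans Ψ, fun p => (((h p).mono Set.inter_subset_left).trans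
    ((h' p).mono Set.inter_subset_right)).congr fun {y} u _ => ?_⟩
  simp only [AlgIso.twist_map, AlgIso.trans_map, UAtlas.mul]
  rw [Ψ.map_mul, ← S₃.Q.mul_mul, ← unitScalar_mul]

variable [VectorBundle ℝ (Eu n) E] [IsManifold (𝓡 m) ∞ M] [ContMDiffVectorBundle ∞ (Eu n) E (𝓡 m)]
  [IsContMDiffRiemannianBundle (𝓡 m) ∞ (Eu n) E]

/-- The scalar functions that make a fixed isomorphism smooth near the various points differ by
smooth functions, and so form an atlas. This yields transitivity. -/
lemma exists_isDiff (hn : 0 < n) (ho : IsOrientation o) (hρ : IsSpinRep ρ)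
    (S₁ S₂ : SpinorModule m o ρ) : ∃ A, IsDiff S₁ S₂ A := by
  obtain ⟨Φ⟩ := AlgIso.nonempty hρ (fun x => OFrame.nonempty hn x) S₁ S₂
  choose W hW hp z hz using Φ.exists_twist_smoothOn hn ho
  refine ⟨⟨W, fun p => ⟨hW p, hp p⟩, z, fun p q => ?_⟩, Φ, hz⟩
  refine ((hz p).mono Set.inter_subset_left).ratio hn ho ((hW p).inter (hW q))
    ((hz q).mono Set.inter_subset_right) fun u _ => ?_
  rw [AlgIso.twist_twist]
  simp only [mul_inv_cancel_left]

/-- Two isomorphisms that exhibit differences `A` and `B` are related by a function on `M`, and that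
function is the equivalence of atlases. This yields freeness. -/
lemma IsDiff.iff_equiv (hn : 0 < n) (ho : IsOrientation o) {A B : UAtlas K m M}
    (hA : IsDiff S₁ S₂ A) : IsDiff S₁ S₂ B ↔ A.Equiv B := by
  obtain ⟨Φ, h⟩ := hA
  constructor
  · rintro ⟨Ψ, h'⟩
    obtain ⟨w, hw⟩ := Φ.exists_twist (fun x => OFrame.nonempty hn x) Ψ
    refine ⟨w, fun p q => ((h p).mono Set.inter_subset_left).ratio hn ho
      ((A.nbhds p).1.inter (B.nbhds q).1) ((h' q).mono Set.inter_subset_right) fun {y} u _ => ?_⟩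
    rw [AlgIso.twist_twist]
    simp only [AlgIso.twist_map]
    rw [hw, AlgIso.twist_map, ← S₂.Q.mul_mul, ← unitScalar_mul, mul_assoc, mul_inv_cancel_left,
      mul_comm]
  · rintro ⟨w, hw⟩
    refine ⟨Φ.twist w, fun q => AlgIso.SmoothOn.of_local hn fun p hp => ⟨A.U p, (A.nbhds p).1,
      (A.nbhds p).2, ?_⟩⟩
    refine (((h p).mono (W' := B.U q ∩ A.U p) Set.inter_subset_right).twist hn
      ((hw p q).mono fun x hx => ⟨hx.2, hx.1⟩)).congr fun {y} u _ => ?_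
    rw [AlgIso.twist_twist, AlgIso.twist_twist]
    simp only [AlgIso.twist_map]
    rw [mul_assoc, mul_inv_cancel_left, mul_comm]

lemma isIso_refl (hρ : IsSpinRep ρ) (S : SpinorModule m o ρ) : S.IsIso S :=
  (isIso_iff_isDiff hρ).2 (isDiff_one_iff.2 ⟨_, AlgIso.smoothOn_refl S _⟩)

lemma isIso_symm (hn : 0 < n) (ho : IsOrientation o) (hρ : IsSpinRep ρ) (h : S₁.IsIso S₂) :
    S₂.IsIso S₁ := by
  rw [isIso_iff_isDiff hρ, isDiff_one_iff] at h ⊢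
  obtain ⟨Φ, h⟩ := h
  exact ⟨Φ.symm, h.symm hn ho isOpen_univ⟩

lemma isIso_trans (hρ : IsSpinRep ρ) (h : S₁.IsIso S₂) (h' : S₂.IsIso S₃) :
    S₁.IsIso S₃ := by
  rw [isIso_iff_isDiff hρ, isDiff_one_iff] at h h' ⊢
  obtain ⟨Φ, h⟩ := h
  obtain ⟨Ψ, h'⟩ := h'
  exact ⟨Φ.trans Ψ, h.trans h'⟩

lemma toClass_eq_iff (hn : 0 < n) (ho : IsOrientation o) (hρ : IsSpinRep ρ) :
    S₁.toClass = S₂.toClass ↔ S₁.IsIso S₂ := by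
  have he : _root_.Equivalence (SpinorModule.IsIso (m := m) (o := o) (ρ := ρ)) :=
    ⟨isIso_refl hρ, isIso_symm hn ho hρ, isIso_trans hρ⟩
  exact Quot.eq.trans he.eqvGen_iff

end Diff

/-! ### Existence of spinor modules -/

section Twist

variable {m n : ℕ} {M : Type*} [TopologicalSpace M] [ChartedSpace (Eu m) M]
  {E : M → Type*} [TopologicalSpace (TotalSpace (Eu n) E)]
  [∀ x, NormedAddCommGroup (E x)] [∀ x, InnerProductSpace ℝ (E x)]
  [FiberBundle (Eu n) E] {o : ∀ x, Orientation ℝ (E x) (Fin n)}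
  {K : Type} [RCLike K] {V : Type} [AddCommGroup V] [Module K V]
  {ρ : Representation K (spinK K n) V}

lemma coe_unitary_ne_zero (z : unitary K) : (z : K) ≠ 0 := fun h => by
  have := z.2.1
  rw [h] at this
  simp at this

/-- Multiplication by a scalar of absolute value one. -/
def unitSmul (z : unitary K) (W : Type*) [AddCommGroup W] [Module K W] : W ≃ₗ[K] W :=
  LinearEquiv.smulOfNeZero K W (z : K) (coe_unitary_ne_zero z)

lemma unitSmul_apply (z : unitary K) {W : Type*} [AddCommGroup W] [Module K W] (w : W) :
    unitSmul z W w = (z : K) • w := rfl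

lemma unitSmul_symm_apply (z : unitary K) {W : Type*} [AddCommGroup W] [Module K W] (w : W) :
    (unitSmul z W).symm w = ((z⁻¹ : unitary K) : K) • w := by
  rw [LinearEquiv.symm_apply_eq, unitSmul_apply, smul_smul, ← MulMemClass.coe_mul, mul_inv_cancel,
    OneMemClass.coe_one, one_smul]

/-- In a twisted frame every coordinate acquires a factor `z⁻¹ w`. In the applications this is a
transition function of the atlas, hence smooth. -/
lemma twisted_coord (z w : unitary K) {W W' : Type*} [AddCommGroup W] [Module K W]
    [AddCommGroup W'] [Module K W'] (e : W ≃ₗ[K] W') (φ : W →ₗ[K] K) (w' : W') :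
    φ ((e.trans (unitSmul z W')).symm ((w : K) • w')) = ((z⁻¹ * w : unitary K) : K) * φ (e.symm w') := by
  rw [LinearEquiv.trans_symm, LinearEquiv.trans_apply, unitSmul_symm_apply, smul_smul, map_smul,
    map_smul, ← MulMemClass.coe_mul, smul_eq_mul]

variable [VectorBundle ℝ (Eu n) E] [IsManifold (𝓡 m) ∞ M] [ContMDiffVectorBundle ∞ (Eu n) E (𝓡 m)]
  [IsContMDiffRiemannianBundle (𝓡 m) ∞ (Eu n) E]

lemma UAtlas.smooth_comp (A : UAtlas K m M) (hn : 0 < n) {k : ℕ} {γ : Eu k → SO o} {O : Set (Eu k)}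
    (hγ : framePlots m o k γ O) {p q : M} (hp : ∀ t ∈ O, (γ t).1 ∈ A.U p)
    (hq : ∀ t ∈ O, (γ t).1 ∈ A.U q) :
    USm k (fun t => (A.ζ p (γ t).1)⁻¹ * A.ζ q (γ t).1) O :=
  (A.smooth p q).comp (FSm.base hn (framePlots_iff.1 hγ)) fun t ht => ⟨hp t ht, hq t ht⟩

/-- A vector bundle on `SO(E)` twisted by a bundle on `M`. -/
def SmoothVB.twist (hn : 0 < n) (B : SmoothVB K (framePlots m o) V) (A : UAtlas K m M) :
    SmoothVB K (framePlots m o) V where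
  fiber := B.fiber
  -- The fibres stay the same. The twist consists in declaring other frames smooth, namely the old
  -- ones multiplied by the possibly discontinuous functions `A.ζ p`.
  frames := {e | ∃ e₀ ∈ B.frames, ∃ p, e = (e₀.1 ∩ SO.pt ⁻¹' A.U p,
    fun y => (e₀.2 y).trans (unitSmul (A.ζ p y.1) _))}
  isOpen_dom := by
    rintro _ ⟨e₀, he₀, p, rfl⟩
    exact (B.isOpen_dom e₀ he₀).inter ((A.nbhds p).1.preimage (SO.continuous_pt hn))
  cover := fun y => by
    obtain ⟨e₀, he₀, hy⟩ := B.cover y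
    exact ⟨_, ⟨e₀, he₀, y.1, rfl⟩, hy, (A.nbhds y.1).2⟩
  transition := by
    rintro _ ⟨e, he, p, rfl⟩ _ ⟨e', he', q, rfl⟩ v φ k γ O hO hγ hm
    have h1 := B.transition e he e' he' v φ k γ O hO hγ fun t ht => ⟨(hm ht).1.1, (hm ht).2.1⟩
    rw [← contMDiffOn_iff_contDiffOn] at h1 ⊢
    refine ContMDiffOn.congr (ContMDiffOn.rmul (A.smooth_comp hn hγ (p := q) (q := p)
      (fun t ht => (hm ht).2.2) fun t ht => (hm ht).1.2) h1) fun t _ => ?_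
    exact twisted_coord _ _ _ _ _

/-- A lift of the structure group twisted by a bundle on `M`. -/
def PrincipalBundle.twist (hn : 0 < n)
    (Q : PrincipalBundle (framePlots m o) (spinK K n) (spinPlots K n)) (A : UAtlas K m M) :
    PrincipalBundle (framePlots m o) (spinK K n) (spinPlots K n) where
  carrier := Q.carrier
  mul := Q.mul
  mul_one := Q.mul_one
  mul_mul := Q.mul_mul
  simply_transitive := Q.simply_transitive
  sections := {s | ∃ s₀ ∈ Q.sections, ∃ p, s = (s₀.1 ∩ SO.pt ⁻¹' A.U p,
    fun y => Q.mul (s₀.2 y) (unitScalar (A.ζ p y.1)))}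
  isOpen_dom := by
    rintro _ ⟨s₀, hs₀, p, rfl⟩
    exact (Q.isOpen_dom s₀ hs₀).inter ((A.nbhds p).1.preimage (SO.continuous_pt hn))
  cover := fun y => by
    obtain ⟨s₀, hs₀, hy⟩ := Q.cover y
    exact ⟨_, ⟨s₀, hs₀, y.1, rfl⟩, hy, (A.nbhds y.1).2⟩
  transition := by
    rintro _ ⟨s, hs, p, rfl⟩ _ ⟨s', hs', q, rfl⟩ k γ O hO hγ hm g hg
    rw [spinPlots_iff]
    have h1 := spinPlots_iff.1 (Q.transition s hs s' hs' k γ O hO hγ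
      (fun t ht => ⟨(hm ht).1.1, (hm ht).2.1⟩) (fun t => Q.div (s.2 (γ t)) (s'.2 (γ t)))
      fun t _ => Q.mul_div _ _)
    refine (((A.smooth_comp hn hγ (p := p) (q := q) (fun t ht => (hm ht).1.2)
      fun t ht => (hm ht).2.2).unitScalar).spin_mul h1).congr fun t ht => ?_
    congr 1
    refine Q.mul_left_cancel ((hg t ht).trans ?_)
    simp only
    rw [← Q.mul_mul, ← mul_assoc, ← unitScalar_mul, mul_inv_cancel_left, unitScalar_comm, Q.mul_mul,
      Q.mul_div]

section Family

variable {hn : 0 < n} {Q : PrincipalBundle (framePlots m o) (spinK K n) (spinPlots K n)}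
  {A : UAtlas K m M} {k : ℕ} {γ : Eu k → SO o} {O : Set (Eu k)}

lemma PrincipalBundle.SmoothFamily.twist {u : ∀ t, Q.carrier (γ t)} (h : Q.SmoothFamily γ u O)
    (hO : IsOpen O) {p : M} (hp : ∀ t ∈ O, (γ t).1 ∈ A.U p) :
    (Q.twist hn A).SmoothFamily γ (fun t => Q.mul (u t) (unitScalar (A.ζ p (γ t).1))) O :=
  smoothFamily_of_local fun t ht => by
    obtain ⟨O', h1, h2, h3, h4, s, hs, hm, g, hg, hu⟩ := h.exists_local hO ht
    refine ⟨O', h1, h2, h3, h4, _, ⟨s, hs, p, rfl⟩, fun t ht => ⟨hm ht, hp t (h1 ht)⟩, g, hg,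
      fun t ht => ?_⟩
    change Q.mul (Q.mul _ _) _ = _
    rw [← Q.mul_mul, unitScalar_comm, Q.mul_mul, hu t ht]

lemma PrincipalBundle.SmoothFamily.of_twist {u : ∀ t, Q.carrier (γ t)}
    (h : (Q.twist hn A).SmoothFamily γ u O)
    (hO : IsOpen O) {p : M} (hp : ∀ t ∈ O, (γ t).1 ∈ A.U p) :
    Q.SmoothFamily γ (fun t => Q.mul (u t) (unitScalar (A.ζ p (γ t).1))⁻¹) O :=
  smoothFamily_of_local fun t ht => by
    obtain ⟨O', h1, h2, h3, h4, _, ⟨s, hs, q, rfl⟩, hm, g, hg, hu⟩ := h.exists_local hO ht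
    refine ⟨O', h1, h2, h3, h4, s, hs, fun t ht => (hm ht).1,
      fun t => unitScalar ((A.ζ p (γ t).1)⁻¹ * A.ζ q (γ t).1) * g t,
      (A.smooth_comp hn h4 (fun t ht => hp t (h1 ht)) fun t ht => (hm ht).2).unitScalar.spin_mul hg,
      fun t ht => ?_⟩
    have h5 : Q.mul (Q.mul (s.2 (γ t)) (unitScalar (A.ζ q (γ t).1))) (g t) = u t := hu t ht
    simp only
    rw [← h5, ← unitScalar_inv, ← Q.mul_mul, ← Q.mul_mul, mul_comm (A.ζ p (γ t).1)⁻¹, unitScalar_mul,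
      mul_assoc, unitScalar_comm _ (g t)]

lemma PrincipalBundle.exists_twist_nbhd (A : UAtlas K m M) (hn : 0 < n) (hγ : framePlots m o k γ O)
    (hO : IsOpen O) {t : Eu k} (ht : t ∈ O) :
    ∃ O' ⊆ O, IsOpen O' ∧ t ∈ O' ∧ ∀ t' ∈ O', (γ t').1 ∈ A.U (γ t).1 :=
  ⟨O ∩ γ ⁻¹' (SO.pt ⁻¹' A.U (γ t).1), Set.inter_subset_left,
    (framePlots.continuousOn hγ).isOpen_inter_preimage hO
      ((A.nbhds _).1.preimage (SO.continuous_pt hn)), ⟨ht, (A.nbhds _).2⟩, fun _ h => h.2⟩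

end Family

lemma SpinorModule.proj_unitScalar (S : SpinorModule m o ρ) {x : M} {f : OFrame o x}
    (u : S.Q.carrier ⟨x, f⟩) (z : unitary K) : S.Q.proj (S.Q.mul u (unitScalar z)) = S.Q.proj u :=
  S.proj_eq_of_covers (by rw [rot_refl]; exact covers_unitScalar _)

lemma SpinorModule.proj_unitScalar_inv (S : SpinorModule m o ρ) {x : M} {f : OFrame o x}
    (u : S.Q.carrier ⟨x, f⟩) (z : unitary K) : S.Q.proj (S.Q.mul u (unitScalar z)⁻¹) = S.Q.proj u := by
  rw [← unitScalar_inv, S.proj_unitScalar]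

/-- Locally on `M` the family is untwisted, acted upon and twisted again by the same scalars, which
depend only on the point of `M` and commute with the action. -/
lemma SpinorModule.actQ_smooth_twist (hn : 0 < n) (S : SpinorModule m o ρ) (A : UAtlas K m M) {k : ℕ}
    {x : Eu k → M} {f f' : ∀ t, OFrame o (x t)} (l : ∀ t, Gerbe K (f t) (f' t))
    (u : ∀ t, S.Q.carrier ⟨x t, f' t⟩) (O : Set (Eu k)) (hO : IsOpen O)
    (hl : SmoothGerbeFamily m l O)
    (hu : (S.Q.toPrincipalBundle.twist hn A).SmoothFamily (fun t => ⟨x t, f' t⟩) u O) :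
    (S.Q.toPrincipalBundle.twist hn A).SmoothFamily (fun t => ⟨x t, f t⟩)
      (fun t => S.actQ (l t) (u t)) O := PrincipalBundle.SmoothFamily.of_local fun t ht => by
  obtain ⟨O', h1, h2, h3, h4⟩ := PrincipalBundle.exists_twist_nbhd A hn hu.1 hO ht
  have h5 := S.actQ_smooth l _ O' h2 ⟨framePlots.mono hl.1 h1, framePlots.mono hl.2.1 h1,
    spinPlots_iff.2 ((spinPlots_iff.1 hl.2.2).mono h1)⟩
    (PrincipalBundle.SmoothFamily.of_twist (hu.mono h1) h2 h4)
  refine ⟨O', h1, h2, h3, (h5.twist (A := A) (hn := hn) (p := x t) h2 h4).congr h2 fun t' _ => ?_⟩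
  rw [S.actQ_right, ← S.Q.mul_mul, inv_mul_cancel, S.Q.mul_one]

/-- The tensor product of a spinor module and the line bundle associated to `A`. -/
def SpinorModule.twist (hn : 0 < n) (hρ : IsSpinRep ρ) (S : SpinorModule m o ρ) (A : UAtlas K m M) :
    SpinorModule m o ρ where
  S :=
  { vb := S.S.vb.twist hn A
    act := S.S.act
    act_mul := S.S.act_mul
    act_smul := S.S.act_smul
    act_smooth := by
      rintro k x f f' l O hO hl _ ⟨e, he, p, rfl⟩ _ ⟨e', he', q, rfl⟩ hm hm' v φ
      have h1 := S.S.act_smooth l O hO hl e he e' he' (fun t ht => (hm t ht).1)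
        (fun t ht => (hm' t ht).1) v φ
      rw [← contMDiffOn_iff_contDiffOn] at h1 ⊢
      refine ContMDiffOn.congr (ContMDiffOn.rmul (A.smooth_comp hn hl.1 (p := p) (q := q)
        (fun t ht => (hm t ht).2) fun t ht => (hm' t ht).2) h1) fun t _ => ?_
      change φ (((e.2 _).trans (unitSmul _ _)).symm (S.S.act (l t) (((A.ζ q _ : unitary K) : K) • _))) = _
      rw [map_smul]
      exact twisted_coord _ _ _ _ _ }
  Q :=
  { S.Q.toPrincipalBundle.twist hn A with
    proj := S.Q.proj
    proj_mul := S.Q.proj_mul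
    proj_smooth := fun γ u O hO hu => framePlots.of_local fun t ht => by
      obtain ⟨O', h1, h2, h3, h4⟩ := PrincipalBundle.exists_twist_nbhd A hn hu.1 hO ht
      have h5 := S.Q.proj_smooth γ _ O' h2
        (PrincipalBundle.SmoothFamily.of_twist (hu.mono h1) h2 h4)
      refine ⟨O', h1, h2, h3, ?_⟩
      exact FSm.congr h5 fun t _ => (S.proj_unitScalar_inv (u t) _).symm }
  frame := S.frame
  frame_mul := S.frame_mul
  frame_smooth := by
    rintro _ ⟨s, hs, p, rfl⟩ v _ ⟨e, he, q, rfl⟩ φ k γ O hO hγ hm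
    have h1 := S.frame_smooth s hs v e he φ k γ O hO hγ fun t ht => ⟨(hm ht).1.1, (hm ht).2.1⟩
    rw [← contMDiffOn_iff_contDiffOn] at h1 ⊢
    refine ContMDiffOn.congr (ContMDiffOn.rmul (A.smooth_comp hn hγ (p := q) (q := p)
      (fun t ht => (hm ht).2.2) fun t ht => (hm ht).1.2) h1) fun t _ => ?_
    exact (congrArg (fun w => φ (((e.2 (γ t)).trans (unitSmul _ _)).symm w))
      (S.frame_unitScalar hρ _ _ _)).trans (twisted_coord _ _ _ _ _)
  actQ := S.actQ
  actQ_mul := S.actQ_mul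
  actQ_right := S.actQ_right
  actQ_proj := S.actQ_proj
  actQ_frame := S.actQ_frame
  actQ_smooth := S.actQ_smooth_twist hn A

/-- The identity of the fibres serves as the isomorphism that ignores smoothness. -/
lemma isDiff_twist (hn : 0 < n) (hρ : IsSpinRep ρ) (S : SpinorModule m o ρ) (A : UAtlas K m M) :
    IsDiff S (S.twist hn hρ A) A :=
  ⟨⟨fun u => u, fun _ _ => rfl, fun _ => rfl, fun _ _ => rfl⟩,
    fun _ _ _ _ _ hO hu hm => hu.twist (hn := hn) hO hm⟩

end Twist

/-! ### The canonical spinor module on the trivial bundle. -/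

section Canonical

variable {m n : ℕ} {M : Type*} [TopologicalSpace M] [ChartedSpace (Eu m) M]
  {E : M → Type*} [TopologicalSpace (TotalSpace (Eu n) E)]
  [∀ x, NormedAddCommGroup (E x)] [∀ x, InnerProductSpace ℝ (E x)]
  [FiberBundle (Eu n) E] {o : ∀ x, Orientation ℝ (E x) (Fin n)}
  {K : Type} [RCLike K] {V : Type} [AddCommGroup V] [Module K V]
  {ρ : Representation K (spinK K n) V}

/-- The action of a group element as a linear equivalence. -/
def repEquiv {G : Type*} [Group G] (ρ : Representation K G V) (a : G) : V ≃ₗ[K] V :=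
  LinearEquiv.ofLinearMap (ρ a) (ρ a⁻¹) (by ext v; simp) (by ext v; simp)

/-- The frame to which `f` is taken by an element of the spin group. -/
def OFrame.spin {x : M} (f : OFrame o x) (a : spinK K n) : OFrame o x :=
  f.rotate (exists_covers a).choose (exists_covers a).choose_spec.det

lemma OFrame.covers_spin {x : M} (f : OFrame o x) (a : spinK K n) : Covers a (rot f (f.spin a)) := by
  rw [OFrame.spin, rot_rotate]
  exact (exists_covers a).choose_spec

variable (K m o) in
/-- The trivial principal bundle. -/
def trivialBundle :
    PrincipalBundle (framePlots m o) (spinK K n) (spinPlots K n) where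
  carrier := fun _ => spinK K n
  mul := fun u a => u * a
  mul_one := fun u => _root_.mul_one u
  mul_mul := fun u a b => (mul_assoc u a b).symm
  simply_transitive := fun u u' => ⟨u⁻¹ * u', mul_inv_cancel_left u u', fun a ha => by
    rw [← ha, inv_mul_cancel_left]⟩
  sections := {(Set.univ, fun _ => 1)}
  isOpen_dom := by
    rintro _ rfl
    exact isOpen_univ
  cover := fun _ => ⟨_, rfl, trivial⟩
  transition := by
    rintro _ rfl _ rfl k γ O hO hγ hm g hg
    rw [spinPlots_iff]
    refine (wsm_const (1 : ClK K n)).congr fun t ht => ?_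
    have h : 1 * g t = 1 := hg t ht
    rw [one_mul] at h
    rw [h, spinVal_one]

lemma trivialBundle_smoothFamily {k : ℕ} {γ : Eu k → SO o} {u : Eu k → spinK K n} {O : Set (Eu k)}
    (hO : IsOpen O) : (trivialBundle m o K).SmoothFamily γ u O ↔
      framePlots m o k γ O ∧ WSm k K (fun t => spinVal (u t)) O := by
  constructor
  · rintro ⟨h, h'⟩
    exact ⟨h, spinPlots_iff.1 (h' _ rfl O subset_rfl hO (fun _ _ => trivial) u
      fun t _ => one_mul (u t))⟩
  · rintro ⟨h, h'⟩
    refine ⟨h, ?_⟩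
    rintro _ rfl O' hO' hO'' - g hg
    rw [spinPlots_iff]
    refine (h'.mono hO').congr fun t ht => ?_
    have h : 1 * g t = u t := hg t ht
    rw [one_mul] at h
    rw [h]

lemma IsSpinRep.smooth_comp (hρ : IsSpinRep ρ) {k : ℕ} {a : Eu k → spinK K n} {O : Set (Eu k)}
    (hO : IsOpen O) (ha : spinPlots K n k a O) (v : V) (φ : V →ₗ[K] K) :
    ContDiffOn ℝ ∞ (fun t => φ (ρ (a t) v)) O := hρ.smooth v φ k a O hO ha fun _ _ => trivial

variable [VectorBundle ℝ (Eu n) E] [IsManifold (𝓡 m) ∞ M] [ContMDiffVectorBundle ∞ (Eu n) E (𝓡 m)]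
  [IsContMDiffRiemannianBundle (𝓡 m) ∞ (Eu n) E]

lemma FSm.spin (hn : 0 < n) {k : ℕ} {x : Eu k → M} {f : ∀ t, OFrame o (x t)} {O : Set (Eu k)}
    (h : FSm m k x f O) {a : Eu k → spinK K n} (ha : WSm k K (fun t => spinVal (a t)) O) :
    FSm m k x (fun t => (f t).spin (a t)) O :=
  FSm.rotate (h.base hn) h _ fun _ j =>
    ha.rotation_smooth (fun t _ => (exists_covers (a t)).choose_spec) _ j

lemma OFrame.covers_spin_mul {x : M} (f : OFrame o x) (u a : spinK K n) :
    Covers a (rot (f.spin u) (f.spin (u * a))) := by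
  have h := (f.covers_spin u).inv.mul (f.covers_spin (u * a))
  rwa [inv_mul_cancel_left, rot_symm, rot_trans] at h

/-- Left multiplication by `l` is compensated by the passage from `f'` to `f`. In the canonical
module the gerbe therefore covers the identity of the frames in the pullback. -/
lemma Gerbe.spin_mul {x : M} {f f' : OFrame o x} (l : Gerbe K f f') (u : spinK K n) :
    f.spin (l.1 * u) = f'.spin u := by
  refine rot_injective (f := f) ((f.covers_spin (l.1 * u)).unique ?_)
  have h := l.2.mul (f'.covers_spin u)
  rwa [rot_trans] at h

variable (K m o) in
/-- The trivial lift, whose elements over a frame `f` are the spin group elements, projected to the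
images of `f`. -/
def trivialLift (hn : 0 < n) : Lift K m o where
  toPrincipalBundle := trivialBundle m o K
  proj := fun {x f} u => f.spin (K := K) u
  proj_mul := fun {x f} u a => f.covers_spin_mul u a
  proj_smooth := fun γ u O hO hu => by
    have h := (trivialBundle_smoothFamily hO).1 hu
    exact FSm.spin hn (framePlots_iff.1 h.1) h.2

variable (K V m o) in
/-- The trivial vector bundle. -/
def trivialVB : SmoothVB K (framePlots m o) V where
  fiber := fun _ => V
  frames := {(Set.univ, fun _ => LinearEquiv.refl K V)}
  isOpen_dom := by
    rintro _ rfl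
    exact isOpen_univ
  cover := fun _ => ⟨_, rfl, trivial⟩
  transition := by
    rintro _ rfl _ rfl v φ k γ O hO hγ hm
    exact contDiffOn_const (c := φ v)

variable (m o) in
/-- The gerbe acts on the trivial bundle through the representation. -/
def trivialGerbeModule (hρ : IsSpinRep ρ) : GerbeModule K m o V where
  vb := trivialVB m o K V
  act := fun l => repEquiv ρ l.1
  act_mul := fun l l' s => by
    change ρ (l.1 * l'.1) s = ρ l.1 (ρ l'.1 s)
    rw [map_mul]
    rfl
  act_smul := fun z l s => by
    change ρ (unitScalar z * l.1) s = (z : K) • ρ l.1 s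
    rw [map_mul]
    exact hρ.scalar z _
  act_smooth := by
    rintro k x f f' l O hO hl _ rfl _ rfl hm hm' v φ
    exact hρ.smooth_comp hO hl.2.2 v φ

variable (m o) in
/-- The spinor module given by the trivial bundle, on which the gerbe acts through the
representation. -/
def canonicalModule (hn : 0 < n) (hρ : IsSpinRep ρ) : SpinorModule m o ρ where
  S := trivialGerbeModule m o hρ
  Q := trivialLift m o K hn
  frame := fun u => repEquiv ρ u
  frame_mul := fun (u : spinK K n) a v => by
    change ρ (u * a) v = ρ u (ρ a v)
    rw [map_mul]
    rfl
  frame_smooth := by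
    rintro _ rfl v _ rfl φ k γ O hO hγ hm
    exact contDiffOn_const (c := φ (ρ 1 v))
  -- An element of `L` is an element of the spin group and acts on the left, whereas the structure
  -- group acts on the right. So the two actions commute.
  actQ := fun l (u : spinK K n) => (l.1 * u : spinK K n)
  actQ_mul := fun l l' u => mul_assoc l.1 l'.1 (show spinK K n from u)
  actQ_right := fun l u a => (mul_assoc l.1 (show spinK K n from u) a).symm
  actQ_proj := fun l u => l.spin_mul u
  actQ_frame := fun l (u : spinK K n) v => by
    change ρ (l.1 * u) v = ρ l.1 (ρ u v)
    rw [map_mul]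
    rfl
  actQ_smooth := fun l u O hO hl hu => by
    have h := (trivialBundle_smoothFamily hO).1 hu
    exact (trivialBundle_smoothFamily hO).2 ⟨hl.1, (spinPlots_iff.1 hl.2.2).spin_mul h.2⟩

end Canonical

/-! ### Line bundles and their unit sections -/

section LineBundle

variable {m : ℕ} {M : Type*} [TopologicalSpace M] [ChartedSpace (Eu m) M] [IsManifold (𝓡 m) ∞ M]
  {K : Type} [RCLike K] {N N' : LineBundle K m M}

lemma norm_eq_one_iff_mem_unitary {c : K} : ‖c‖ = 1 ↔ c ∈ unitary K := by
  rw [Unitary.mem_iff, mul_comm, and_self, ← starRingEnd_apply, RCLike.mul_conj]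
  constructor
  · intro h
    rw [h]; simp
  · intro h
    have : ‖c‖ ^ 2 = 1 := by exact_mod_cast h
    exact (pow_eq_one_iff_of_nonneg (norm_nonneg c) two_ne_zero).1 this

lemma contMDiffOn_norm {k : ℕ} {X : Type*} [TopologicalSpace X] [ChartedSpace (Eu k) X] {c : X → K}
    {O : Set X} (hc : ContMDiffOn (𝓡 k) 𝓘(ℝ, K) ∞ c O) (h0 : ∀ x ∈ O, c x ≠ 0) :
    ContMDiffOn (𝓡 k) 𝓘(ℝ, ℝ) ∞ (fun x => ‖c x‖) O := fun x hx =>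
  ContMDiffAt.comp_contMDiffWithinAt (g := fun z : K => ‖z‖) x
    ((contDiffAt_norm ℝ (h0 x hx)).contMDiffAt) (hc x hx)

lemma ofReal_contMDiffOn {k : ℕ} {X : Type*} [TopologicalSpace X] [ChartedSpace (Eu k) X] {c : X → ℝ}
    {O : Set X} (hc : ContMDiffOn (𝓡 k) 𝓘(ℝ, ℝ) ∞ c O) :
    ContMDiffOn (𝓡 k) 𝓘(ℝ, K) ∞ (fun x => (c x : K)) O :=
  (RCLike.ofRealCLM (K := K)).contDiff.contMDiff.comp_contMDiffOn hc

namespace LineBundle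

lemma smoothSection_iff {W : Set M} (hW : IsOpen W) {s : ∀ x, N.fiber x} :
    N.SmoothSection W s ↔ ∀ e ∈ N.frames,
      ContMDiffOn (𝓡 m) 𝓘(ℝ, K) ∞ (fun x => (e.2 x).symm (s x)) (W ∩ e.1) := by
  refine forall_congr' fun e => forall_congr' fun he => ?_
  have ho : IsOpen (W ∩ e.1) := hW.inter (N.isOpen_dom e he)
  rw [← wsm_self]
  exact forall_congr' fun φ => smoothFun_iff ho

lemma SmoothSection.mono {W W' : Set M} {s : ∀ x, N.fiber x} (h : N.SmoothSection W s)
    (hW : W' ⊆ W) : N.SmoothSection W' s := fun e he φ k γ O hO hγ hm =>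
  h e he φ k γ O hO hγ fun _ ht => ⟨hW (hm ht).1, (hm ht).2⟩

lemma SmoothSection.congr {W : Set M} {s s' : ∀ x, N.fiber x} (h : N.SmoothSection W s)
    (e : ∀ x ∈ W, s' x = s x) : N.SmoothSection W s' := fun e' he φ k γ O hO hγ hm =>
  (h e' he φ k γ O hO hγ hm).congr fun t ht => by simp only [e _ (hm ht).1]

lemma SmoothSection.of_local {W : Set M} (hW : IsOpen W) {s : ∀ x, N.fiber x}
    (h : ∀ x ∈ W, ∃ U, IsOpen U ∧ x ∈ U ∧ N.SmoothSection (W ∩ U) s) : N.SmoothSection W s := by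
  rw [smoothSection_iff hW]
  refine fun e he => contMDiffOn_of_locally_contMDiffOn fun x hx => ?_
  obtain ⟨U, h1, h2, h3⟩ := h x hx.1
  exact ⟨U, h1, h2, ((smoothSection_iff (hW.inter h1)).1 h3 e he).mono
    fun y hy => ⟨⟨hy.1.1, hy.2⟩, hy.1.2⟩⟩

lemma frame_smooth {e : Set M × ∀ x, K ≃ₗ[K] N.fiber x} (he : e ∈ N.frames) (v : K) :
    N.SmoothSection e.1 (fun x => e.2 x v) := fun e' he' φ => N.transition e he e' he' v φ

lemma SmoothSection.smul {W : Set M} (hW : IsOpen W) {s : ∀ x, N.fiber x} {c : M → K}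
    (hc : ContMDiffOn (𝓡 m) 𝓘(ℝ, K) ∞ c W) (hs : N.SmoothSection W s) :
    N.SmoothSection W (fun x => c x • s x) := by
  rw [smoothSection_iff hW] at hs ⊢
  intro e he
  simp only [map_smul, smul_eq_mul]
  exact (hc.mono Set.inter_subset_left).rmul (hs e he)

/-- The ratio of two smooth sections is smooth. -/
lemma SmoothSection.ratio {W : Set M} (hW : IsOpen W) {s s' : ∀ x, N.fiber x} {c : M → K}
    (hs : N.SmoothSection W s) (hs' : N.SmoothSection W s') (h0 : ∀ x ∈ W, s x ≠ 0)
    (hc : ∀ x ∈ W, s' x = c x • s x) : ContMDiffOn (𝓡 m) 𝓘(ℝ, K) ∞ c W := by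
  rw [smoothSection_iff hW] at hs hs'
  refine contMDiffOn_of_locally_contMDiffOn fun x hx => ?_
  obtain ⟨e, he, hxe⟩ := N.cover x
  have h1 : ∀ x ∈ W ∩ e.1, (e.2 x).symm (s x) ≠ 0 := fun x hx =>
    (LinearEquiv.map_ne_zero_iff _).2 (h0 x hx.1)
  refine ⟨e.1, N.isOpen_dom e he, hxe, ((hs' e he).rmul ((hs e he).rinv h1)).congr fun x hx => ?_⟩
  rw [hc x hx.1, map_smul, smul_eq_mul, mul_inv_cancel_right₀ (h1 x hx)]

lemma exists_ratio {x : M} {w : N.fiber x} (hw : w ≠ 0) (w' : N.fiber x) : ∃ c : K, w' = c • w := by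
  obtain ⟨e, -, -⟩ := N.cover x
  refine ⟨(e.2 x).symm w' * ((e.2 x).symm w)⁻¹, (e.2 x).symm.injective ?_⟩
  rw [map_smul, smul_eq_mul, inv_mul_cancel_right₀ ((LinearEquiv.map_ne_zero_iff _).2 hw)]

lemma exists_ne_zero (N : LineBundle K m M) (x : M) : ∃ w : N.fiber x, w ≠ 0 := by
  obtain ⟨e, -, -⟩ := N.cover x
  exact ⟨e.2 x 1, (LinearEquiv.map_ne_zero_iff _).2 one_ne_zero⟩

/-- Smooth homomorphisms take smooth sections to smooth sections. -/
lemma SmoothSection.map {A : ∀ x, N.fiber x →ₗ[K] N'.fiber x} (hA : SmoothVB.SmoothHom N N' A)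
    {W : Set M} (hW : IsOpen W) {s : ∀ x, N.fiber x} (hs : N.SmoothSection W s) :
    N'.SmoothSection W (fun x => A x (s x)) := SmoothSection.of_local hW fun x _ => by
  obtain ⟨e, he, hxe⟩ := N.cover x
  have ho := hW.inter (N.isOpen_dom e he)
  refine ⟨e.1, N.isOpen_dom e he, hxe, SmoothSection.congr (SmoothSection.smul ho ((smoothSection_iff hW).1 hs e he)
    (SmoothSection.mono (hA e he 1) Set.inter_subset_right)) fun y _ => ?_⟩
  rw [← map_smul, ← map_smul, smul_eq_mul, mul_one, LinearEquiv.apply_symm_apply]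

end LineBundle

open LineBundle

namespace LineMetric

variable (μ : LineMetric N)

lemma ne_zero {x : M} {w : N.fiber x} (h : μ.norm w = 1) : w ≠ 0 := fun h0 => by
  have := μ.norm_smul 0 w
  rw [h, zero_smul, ← h0, h] at this
  simp at this

lemma exists_unitary {x : M} {w w' : N.fiber x} (h : μ.norm w = 1) (h' : μ.norm w' = 1) :
    ∃ z : unitary K, w' = (z : K) • w := by
  obtain ⟨c, rfl⟩ := exists_ratio (μ.ne_zero h) w'
  rw [μ.norm_smul, h, mul_one] at h'
  exact ⟨⟨c, norm_eq_one_iff_mem_unitary.1 h'⟩, rfl⟩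

lemma norm_unitary_smul {x : M} (z : unitary K) (w : N.fiber x) : μ.norm ((z : K) • w) = μ.norm w := by
  rw [μ.norm_smul, norm_eq_one_iff_mem_unitary.2 z.2, one_mul]

lemma contMDiffOn_norm {W : Set M} (hW : IsOpen W) {s : ∀ x, N.fiber x} (hs : N.SmoothSection W s)
    (h0 : ∀ x ∈ W, s x ≠ 0) : ContMDiffOn (𝓡 m) 𝓘(ℝ, ℝ) ∞ (fun x => μ.norm (s x)) W := by
  refine contMDiffOn_of_locally_contMDiffOn fun x hx => ?_
  obtain ⟨e, he, hxe⟩ := N.cover x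
  have h1 := SpinorGerbe.contMDiffOn_norm ((smoothSection_iff hW).1 hs e he)
    fun x hx => (LinearEquiv.map_ne_zero_iff _).2 (h0 x hx.1)
  have h2 := ((smoothFun_iff (N.isOpen_dom e he)).1 (μ.smooth e he)).mono
    (Set.inter_subset_right (s := W))
  refine ⟨e.1, N.isOpen_dom e he, hxe, (h1.rmul h2).congr fun x hx => ?_⟩
  rw [← μ.norm_smul, ← map_smul, smul_eq_mul, mul_one, LinearEquiv.apply_symm_apply]

/-- The unit vector on the ray through `w`. -/
def normalize {x : M} (w : N.fiber x) : N.fiber x := (μ.norm w : K)⁻¹ • w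

lemma norm_normalize {x : M} {w : N.fiber x} (h : w ≠ 0) : μ.norm (μ.normalize w) = 1 := by
  have := μ.norm_pos w h
  rw [normalize, μ.norm_smul, norm_inv, RCLike.norm_ofReal, abs_of_pos this, inv_mul_cancel₀ this.ne']

lemma normalize_unitary_smul {x : M} (z : unitary K) (w : N.fiber x) :
    μ.normalize ((z : K) • w) = (z : K) • μ.normalize w := by
  rw [normalize, normalize, norm_unitary_smul, smul_comm]

lemma normalize_smooth {W : Set M} (hW : IsOpen W) {s : ∀ x, N.fiber x} (hs : N.SmoothSection W s)
    (h0 : ∀ x ∈ W, s x ≠ 0) : N.SmoothSection W (fun x => μ.normalize (s x)) :=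
  SmoothSection.smul hW ((ofReal_contMDiffOn (μ.contMDiffOn_norm hW hs h0)).rinv fun x hx =>
    RCLike.ofReal_ne_zero.2 (μ.norm_pos _ (h0 x hx)).ne') hs

/-- Local norms are averaged with a partition of unity. On a line the norm is smooth away from zero,
so the norms themselves, rather than their squares, can be added. -/
lemma nonempty [T2Space M] [SecondCountableTopology M] (N : LineBundle K m M) :
    Nonempty (LineMetric N) := by
  have := ChartedSpace.locallyCompactSpace (Eu m) M
  choose e he hxe using N.cover
  obtain ⟨f, hf⟩ := SmoothPartitionOfUnity.exists_isSubordinate (𝓡 m) isClosed_univ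
    (fun p => (e p).1) (fun p => N.isOpen_dom _ (he p))
    (fun p _ => Set.mem_iUnion.2 ⟨p, hxe p⟩)
  have hfin : ∀ (x : M) (w : N.fiber x),
      (Function.support fun p => f p x * ‖((e p).2 x).symm w‖).Finite := fun x w =>
    (f.locallyFinite.point_finite x).subset fun p hp => by
      intro h
      exact hp (by simp only [h, zero_mul])
  refine ⟨⟨fun {x} w => ∑ᶠ p, f p x * ‖((e p).2 x).symm w‖, fun {x} c w => ?_, fun {x} w hw => ?_,
    fun η hη => ?_⟩⟩
  · rw [mul_finsum' _ _ (hfin x w)]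
    refine finsum_congr fun p => ?_
    rw [map_smul, _root_.norm_smul]
    ring
  · obtain ⟨p, hp⟩ := f.exists_pos_of_mem (Set.mem_univ x)
    exact finsum_pos (fun p => mul_nonneg (f.nonneg p x) (norm_nonneg _))
      ⟨p, mul_pos hp (norm_pos_iff.2 ((LinearEquiv.map_ne_zero_iff _).2 hw))⟩ (hfin x w)
  · have hη' := N.isOpen_dom η hη
    rw [smoothFun_iff hη']
    intro x hx
    refine (f.contMDiffAt_finsum (g := fun p x => ‖((e p).2 x).symm (η.2 x 1)‖)
      fun p hp => ?_).contMDiffWithinAt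
    have ho := hη'.inter (N.isOpen_dom _ (he p))
    exact (SpinorGerbe.contMDiffOn_norm ((smoothSection_iff hη').1 (frame_smooth hη 1) _ (he p))
      fun y _ => (LinearEquiv.map_ne_zero_iff _).2 ((LinearEquiv.map_ne_zero_iff _).2 one_ne_zero)).contMDiffAt
        (ho.mem_nhds ⟨hx, hf p hp⟩)

end LineMetric

/-- The bundle of unit vectors of `N` is `A`. -/
def IsAt (N : LineBundle K m M) (A : UAtlas K m M) : Prop :=
  ∃ (μ : LineMetric N) (w : ∀ x, N.fiber x), (∀ x, μ.norm (w x) = 1) ∧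
    ∀ p, N.SmoothSection (A.U p) (fun x => (A.ζ p x : K) • w x)

/-- Smooth unit sections differ by smooth functions. -/
lemma usm_of_sections (μ : LineMetric N) {w : ∀ x, N.fiber x} (hw : ∀ x, μ.norm (w x) = 1)
    {W : Set M} (hW : IsOpen W) {z z' : M → unitary K}
    (h : N.SmoothSection W fun x => (z x : K) • w x)
    (h' : N.SmoothSection W fun x => (z' x : K) • w x) : USm m (fun x => (z x)⁻¹ * z' x) W := by
  refine SmoothSection.ratio hW h h' (fun x _ => ?_) fun x _ => ?_
  · exact μ.ne_zero (by rw [μ.norm_unitary_smul, hw])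
  · simp only
    rw [smul_smul, ← MulMemClass.coe_mul, mul_comm ((z x)⁻¹), inv_mul_cancel_right]

/-- A unit vector is chosen in each fibre, without any continuity, and the normalised local frames
are expressed as multiples of it. The discontinuity drops out of all ratios. -/
lemma exists_isAt [T2Space M] [SecondCountableTopology M] (N : LineBundle K m M) : ∃ A, IsAt N A := by
  obtain ⟨μ⟩ := LineMetric.nonempty N
  choose w₀ hw₀ using N.exists_ne_zero
  choose e he hxe using N.cover
  have h0 : ∀ p x, (e p).2 x 1 ≠ 0 := fun p x => (LinearEquiv.map_ne_zero_iff _).2 one_ne_zero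
  have hz : ∀ p x, ∃ z : unitary K, μ.normalize ((e p).2 x 1) = (z : K) • μ.normalize (w₀ x) :=
    fun p x => μ.exists_unitary (μ.norm_normalize (hw₀ x)) (μ.norm_normalize (h0 p x))
  choose ζ hζ using hz
  have hs : ∀ p, N.SmoothSection (e p).1 fun x => (ζ p x : K) • μ.normalize (w₀ x) := fun p => by
    simp only [← hζ]
    exact μ.normalize_smooth (N.isOpen_dom _ (he p)) (frame_smooth (he p) 1) fun x _ => h0 p x
  exact ⟨⟨fun p => (e p).1, fun p => ⟨N.isOpen_dom _ (he p), hxe p⟩, ζ, fun p q =>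
    usm_of_sections μ (fun x => μ.norm_normalize (hw₀ x))
      ((N.isOpen_dom _ (he p)).inter (N.isOpen_dom _ (he q)))
      (SmoothSection.mono (hs p) Set.inter_subset_left)
      (SmoothSection.mono (hs q) Set.inter_subset_right)⟩, μ, _,
    fun x => μ.norm_normalize (hw₀ x), hs⟩

/-- The line bundle associated to an atlas. -/
def UAtlas.lineBundle (A : UAtlas K m M) : LineBundle K m M where
  fiber := fun _ => K
  frames := {e | ∃ p, e = (A.U p, fun x => unitSmul (A.ζ p x) K)}
  isOpen_dom := by
    rintro _ ⟨p, rfl⟩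
    exact (A.nbhds p).1
  cover := fun x => ⟨_, ⟨x, rfl⟩, (A.nbhds x).2⟩
  transition := by
    rintro _ ⟨p, rfl⟩ _ ⟨q, rfl⟩ v φ
    rw [smoothFun_iff ((A.nbhds p).1.inter (A.nbhds q).1)]
    refine (wsm_self.2 ?_ : WSm m K (fun x => (unitSmul (A.ζ q x) K).symm (unitSmul (A.ζ p x) K v)) _) φ
    refine (ContMDiffOn.rmul ((A.smooth q p).mono fun x hx => ⟨hx.2, hx.1⟩)
      (contMDiffOn_const (c := v))).congr fun x _ => ?_
    rw [unitSmul_symm_apply, unitSmul_apply, smul_smul, MulMemClass.coe_mul, smul_eq_mul]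

lemma isAt_lineBundle (A : UAtlas K m M) : IsAt A.lineBundle A := by
  refine ⟨⟨fun {x} (w : K) => ‖w‖, fun {x} c (w : K) => norm_mul c w,
    fun {x} (w : K) hw => norm_pos_iff.2 hw, ?_⟩, fun x => (1 : K), fun x => norm_one, fun p => ?_⟩
  · rintro _ ⟨p, rfl⟩ k γ O hO hγ hm
    refine (contDiffOn_const (c := (1 : ℝ))).congr fun t _ => ?_
    change ‖(A.ζ p (γ t) : K) * 1‖ = 1
    rw [mul_one, norm_eq_one_iff_mem_unitary]
    exact (A.ζ p (γ t)).2
  · exact frame_smooth (N := A.lineBundle) ⟨p, rfl⟩ 1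

/-- Line bundles are isomorphic if and only if their unit vector bundles are. -/
lemma IsAt.isIso_iff {A A' : UAtlas K m M} (h : IsAt N A) (h' : IsAt N' A') :
    N.IsIso N' ↔ A.Equiv A' := by
  obtain ⟨μ, w, hw, hs⟩ := h
  obtain ⟨μ', w', hw', hs'⟩ := h'
  constructor
  · rintro ⟨T, hT⟩
    have h0 : ∀ x, T x (w x) ≠ 0 := fun x => (LinearEquiv.map_ne_zero_iff _).2 (μ.ne_zero (hw x))
    -- The equivalence compares the reference vector `w'` with the normalised image of `w`. The
    -- isomorphism need not preserve the metrics.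
    choose h hh using fun x => μ'.exists_unitary (μ'.norm_normalize (h0 x)) (hw' x)
    refine ⟨h, fun p q => ?_⟩
    have ho := (A.nbhds p).1.inter (A'.nbhds q).1
    have h1 := μ'.normalize_smooth (A.nbhds p).1 (SmoothSection.map hT (A.nbhds p).1 (hs p)) fun x _ => by
      rw [LinearEquiv.coe_coe, map_smul]
      exact smul_ne_zero (coe_unitary_ne_zero _) (h0 x)
    refine (usm_of_sections μ' (w := fun x => μ'.normalize (T x (w x)))
      (fun x => μ'.norm_normalize (h0 x)) ho (z := A.ζ p) (z' := fun x => A'.ζ q x * h x) ?_ ?_).congr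
      fun x _ => mul_assoc _ _ _
    · refine SmoothSection.congr (SmoothSection.mono h1 Set.inter_subset_left) fun x _ => ?_
      rw [LinearEquiv.coe_coe, map_smul, μ'.normalize_unitary_smul]
    · refine SmoothSection.congr (SmoothSection.mono (hs' q) Set.inter_subset_right) fun x _ => ?_
      rw [MulMemClass.coe_mul, mul_smul, ← hh]
  · rintro ⟨h, hh⟩
    have hb : ∀ x, Function.Bijective (LinearMap.toSpanSingleton K (N.fiber x) (w x)) := fun x =>
      ⟨LinearMap.ker_eq_bot.1 (LinearMap.ker_toSpanSingleton K (μ.ne_zero (hw x))),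
        fun v => let ⟨c, hc⟩ := exists_ratio (μ.ne_zero (hw x)) v; ⟨c, hc.symm⟩⟩
    have hb' : ∀ x, Function.Bijective (LinearMap.toSpanSingleton K (N'.fiber x) (w' x)) := fun x =>
      ⟨LinearMap.ker_eq_bot.1 (LinearMap.ker_toSpanSingleton K (μ'.ne_zero (hw' x))),
        fun v => let ⟨c, hc⟩ := exists_ratio (μ'.ne_zero (hw' x)) v; ⟨c, hc.symm⟩⟩
    -- The map takes `w` to `h⁻¹ w'`. It is smooth because it takes the smooth section `A.ζ p • w`
    -- to a smooth multiple of `A'.ζ p • w'`.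
    let T : ∀ x, N.fiber x ≃ₗ[K] N'.fiber x := fun x =>
      ((LinearEquiv.ofBijective _ (hb x)).symm.trans (LinearEquiv.ofBijective _ (hb' x))).trans
        (unitSmul (h x)⁻¹ _)
    have hT : ∀ x (c : K), T x (c • w x) = (c * ((h x)⁻¹ : unitary K)) • w' x := fun x c => by
      have : (LinearEquiv.ofBijective _ (hb x)).symm (c • w x) = c := by
        rw [LinearEquiv.symm_apply_eq]; rfl
      simp only [T, LinearEquiv.trans_apply, this, unitSmul_apply]
      rw [LinearEquiv.ofBijective_apply, LinearMap.toSpanSingleton_apply, smul_smul, mul_comm]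
    refine ⟨T, fun e he v => SmoothSection.of_local (N.isOpen_dom e he) fun p hp => ?_⟩
    have ho := (N.isOpen_dom e he).inter ((A.nbhds p).1.inter (A'.nbhds p).1)
    refine ⟨_, (A.nbhds p).1.inter (A'.nbhds p).1, ⟨(A.nbhds p).2, (A'.nbhds p).2⟩, ?_⟩
    choose c hc using fun x => exists_ratio (w := (A.ζ p x : K) • w x)
      (smul_ne_zero (coe_unitary_ne_zero _) (μ.ne_zero (hw x))) (e.2 x v)
    have h1 : ContMDiffOn (𝓡 m) 𝓘(ℝ, K) ∞ c (e.1 ∩ (A.U p ∩ A'.U p)) :=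
      SmoothSection.ratio ho (SmoothSection.mono (hs p) fun x hx => hx.2.1)
        (SmoothSection.mono (frame_smooth he v) fun x hx => hx.1)
        (fun x _ => smul_ne_zero (coe_unitary_ne_zero _) (μ.ne_zero (hw x))) fun x _ => hc x
    refine SmoothSection.congr (SmoothSection.smul ho (h1.rmul
      ((hh p p).inv.mono fun x hx => hx.2)) (SmoothSection.mono (hs' p) fun x hx => hx.2.2))
      fun x _ => ?_
    rw [LinearEquiv.coe_coe, hc x, smul_smul, hT, smul_smul]
    congr 1
    rw [mul_assoc, mul_assoc, ← MulMemClass.coe_mul, ← MulMemClass.coe_mul]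
    congr 2
    simp [mul_comm, mul_left_comm]

end LineBundle

/-! ### Tensor products with line bundles -/

section Tensor

open LineBundle

variable {m n : ℕ} {M : Type*} [TopologicalSpace M] [ChartedSpace (Eu m) M]
  {E : M → Type*} [TopologicalSpace (TotalSpace (Eu n) E)]
  [∀ x, NormedAddCommGroup (E x)] [∀ x, InnerProductSpace ℝ (E x)]
  [FiberBundle (Eu n) E] {o : ∀ x, Orientation ℝ (E x) (Fin n)}
  {K : Type} [RCLike K] {V : Type} [AddCommGroup V] [Module K V]
  {ρ : Representation K (spinK K n) V} {S₁ S₂ : SpinorModule m o ρ} {N : LineBundle K m M}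

lemma AlgIso.twist_lin (hρ : IsSpinRep ρ) (Φ : AlgIso S₁ S₂) (z : M → unitary K) (y : SO o)
    (s : S₁.S.vb.fiber y) : (Φ.twist z).lin y s = (z y.1 : K) • Φ.lin y s := by
  obtain ⟨u⟩ := S₁.Q.nonempty_carrier y
  obtain ⟨v, rfl⟩ := (S₁.frame u).surjective s
  rw [← map_frame, ← map_frame, twist_map, S₂.frame_unitScalar hρ]

/-- As for `actQ_smul`, equivariance in the unit vector is forced by the compatibility with the
linear map, since `V` is nonzero. -/
lemma SpinorTensor.map_smul (hρ : IsSpinRep ρ) (T : SpinorTensor S₁ N S₂) {x : M} {f : OFrame o x}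
    (u : S₁.Q.carrier ⟨x, f⟩) (w w' : {w : N.fiber x // T.metric.norm w = 1}) (z : unitary K)
    (h : w'.1 = (z : K) • w.1) : T.map u w' = S₂.Q.mul (T.map u w) (unitScalar z) := by
  obtain ⟨z', hz'⟩ := S₂.exists_scalar (u := T.map u w) (u' := T.map u w')
    (by rw [T.map_proj, T.map_proj])
  have := hρ.nontrivial
  obtain ⟨v, hv⟩ := exists_ne (0 : V)
  have h1 : (z : K) • S₂.frame (T.map u w) v = (z' : K) • S₂.frame (T.map u w) v := by
    rw [← S₂.frame_unitScalar hρ _ z', ← hz', T.map_frame, T.map_frame, h, TensorProduct.tmul_smul,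
      _root_.map_smul]
  rw [hz', Subtype.ext (smul_left_injective K ((S₂.frame (T.map u w)).map_ne_zero_iff.2 hv) h1)]

variable [VectorBundle ℝ (Eu n) E] [IsManifold (𝓡 m) ∞ M] [ContMDiffVectorBundle ∞ (Eu n) E (𝓡 m)]
  [IsContMDiffRiemannianBundle (𝓡 m) ∞ (Eu n) E]

/-- Tensoring with the reference unit vectors gives an isomorphism that is not smooth. Twisting it
by `A.ζ p` replaces them by the smooth section `A.ζ p • w`. -/
lemma IsTensor.isDiff (hρ : IsSpinRep ρ) {A : UAtlas K m M} (hA : IsAt N A)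
    (h : IsTensor S₁ N S₂) : IsDiff S₁ S₂ A := by
  obtain ⟨T⟩ := h
  obtain ⟨μ, w, hw, hs⟩ := hA
  have h0 : ∀ x, w x ≠ 0 := fun x => μ.ne_zero (hw x)
  -- The tensor structure carries its own metric, which may differ from `μ`, so the reference
  -- vectors are renormalised.
  let w' : ∀ x, {w : N.fiber x // T.metric.norm w = 1} := fun x =>
    ⟨T.metric.normalize (w x), T.metric.norm_normalize (h0 x)⟩
  refine ⟨⟨fun {y} u => T.map (f := y.2) u (w' y.1), fun u a => T.map_mul _ _ _,
    fun u => T.map_proj _ _, fun l u => T.map_actQ _ _ _⟩, fun p k γ u O hO hu hm => ?_⟩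
  let wp : ∀ x, {w : N.fiber x // T.metric.norm w = 1} := fun x =>
    ⟨(A.ζ p x : K) • (w' x).1, by rw [T.metric.norm_unitary_smul, (w' x).2]⟩
  have h1 : N.SmoothSection (A.U p) fun x => (wp x).1 := by
    simp only [wp, w', ← T.metric.normalize_unitary_smul]
    exact T.metric.normalize_smooth (A.nbhds p).1 (hs p)
      fun x _ => smul_ne_zero (coe_unitary_ne_zero _) (h0 x)
  refine (T.map_smooth γ u O hO hu (A.U p) wp (A.nbhds p).1 h1 hm).congr hO fun t _ => ?_
  exact (T.map_smul hρ (f := (γ t).2) (u t) (w' (γ t).1) (wp (γ t).1) _ rfl).symm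

/-- The coordinate with respect to a basis vector of a line. -/
def lineCoord {x : M} {w : N.fiber x} (hw : w ≠ 0) : N.fiber x ≃ₗ[K] K :=
  (LinearEquiv.ofBijective (LinearMap.toSpanSingleton K (N.fiber x) w)
    ⟨LinearMap.ker_eq_bot.1 (LinearMap.ker_toSpanSingleton K hw),
      fun v => let ⟨c, hc⟩ := exists_ratio hw v; ⟨c, hc.symm⟩⟩).symm

lemma lineCoord_smul {x : M} {w : N.fiber x} (hw : w ≠ 0) (c : K) : lineCoord hw (c • w) = c := by
  rw [lineCoord, LinearEquiv.symm_apply_eq]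
  rfl

lemma lineCoord_smul_self {x : M} {w : N.fiber x} (hw : w ≠ 0) (w' : N.fiber x) :
    lineCoord hw w' • w = w' := by
  obtain ⟨c, rfl⟩ := exists_ratio hw w'
  rw [lineCoord_smul]

/-- The tensor `s ⊗ w'` is sent to the coordinate of `w'` along `w` times the image of `s` under
`Φ`. Neither factor is smooth, but the functions `A.ζ p` that repair them cancel in the product. -/
lemma IsDiff.isTensor (hn : 0 < n) (hρ : IsSpinRep ρ) {A : UAtlas K m M} (hA : IsAt N A)
    (h : IsDiff S₁ S₂ A) : IsTensor S₁ N S₂ := by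
  obtain ⟨Φ, h⟩ := h
  obtain ⟨μ, w, hw, hs⟩ := hA
  have h0 : ∀ x, w x ≠ 0 := fun x => μ.ne_zero (hw x)
  have hz : ∀ x (w' : {w : N.fiber x // μ.norm w = 1}), ∃ z : unitary K, w'.1 = (z : K) • w x :=
    fun x w' => μ.exists_unitary (hw x) w'.2
  choose z hz using hz
  let lin : ∀ {x : M} (f : OFrame o x),
      S₁.S.vb.fiber ⟨x, f⟩ ⊗[K] N.fiber x ≃ₗ[K] S₂.S.vb.fiber ⟨x, f⟩ := fun {x} f =>
    (TensorProduct.congr (Φ.lin ⟨x, f⟩) (lineCoord (h0 x))).trans (TensorProduct.rid K _)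
  have hlin : ∀ {x : M} (f : OFrame o x) (s : S₁.S.vb.fiber ⟨x, f⟩) (w' : N.fiber x),
      lin f (s ⊗ₜ w') = lineCoord (h0 x) w' • Φ.lin ⟨x, f⟩ s := fun {x} f s w' => by
    simp [lin]
  refine ⟨⟨μ, lin, fun e he η hη v e' he' φ k γ O hO hγ hm => ?_, fun {x f f'} l s w' => ?_,
    fun {x f} u w' => S₂.Q.mul (Φ.map u) (unitScalar (z x w')), fun {x f} u w' a => ?_,
    fun {x f} u w' => ?_, fun {x f} u w' v => ?_, fun {x f f'} l u w' => ?_,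
    fun {k} γ u O hO hu W w' hW hw' hm => ?_⟩⟩
  · rw [← contMDiffOn_iff_contDiffOn]
    refine WSm.of_local (f := fun t => (e'.2 (γ t)).symm
      (lin (γ t).2 (e.2 (γ t) v ⊗ₜ η.2 (γ t).1 1))) (fun t ht => ?_) φ
    obtain ⟨O', h1, h2, h3, h4⟩ := PrincipalBundle.exists_twist_nbhd A hn hγ hO ht
    have hop := (A.nbhds (γ t).1).1.inter (N.isOpen_dom η hη)
    -- This is the coordinate of the frame `η` with respect to the smooth section `A.ζ • w`, hence
    -- smooth.
    let c : M → K := fun x => lineCoord (h0 x) (η.2 x 1) * ((A.ζ (γ t).1 x)⁻¹ : unitary K)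
    have hc : ContMDiffOn (𝓡 m) 𝓘(ℝ, K) ∞ c (A.U (γ t).1 ∩ η.1) :=
      SmoothSection.ratio hop (SmoothSection.mono (hs (γ t).1) Set.inter_subset_left)
        (SmoothSection.mono (frame_smooth hη 1) Set.inter_subset_right)
        (fun x _ => smul_ne_zero (coe_unitary_ne_zero _) (h0 x)) fun x _ => by
          simp only [c]
          rw [smul_smul, mul_assoc, ← MulMemClass.coe_mul, inv_mul_cancel, OneMemClass.coe_one,
            mul_one, lineCoord_smul_self]
    have h5 : WSm k K (fun t' => (e'.2 (γ t')).symm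
        ((Φ.twist (A.ζ (γ t).1)).lin (γ t') (e.2 (γ t') v))) O' := fun φ =>
      contMDiffOn_iff_contDiffOn.2 ((h (γ t).1).lin_smooth hρ he v e' he' φ k γ O' h2
        (framePlots.mono hγ h1) fun t' ht' => ⟨⟨(hm (h1 ht')).1.1, h4 t' ht'⟩, (hm (h1 ht')).2⟩)
    have h6 := (WSm.smul (hc.comp ((FSm.base hn (framePlots_iff.1 hγ)).mono h1)
      fun t' ht' => ⟨h4 t' ht', (hm (h1 ht')).1.2⟩) h5)
    refine ⟨O', h2, h3, (h6.mono Set.inter_subset_right).congr fun t' _ => ?_⟩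
    rw [hlin, Φ.twist_lin hρ, _root_.map_smul, _root_.map_smul, smul_smul]
    congr 1
    simp only [c, Function.comp]
    rw [mul_assoc, ← MulMemClass.coe_mul, inv_mul_cancel, OneMemClass.coe_one, mul_one]
  · rw [hlin, hlin, Φ.lin_act, map_smul]
  · rw [Φ.map_mul, ← S₂.Q.mul_mul, ← S₂.Q.mul_mul, unitScalar_comm]
  · rw [S₂.proj_unitScalar, Φ.map_proj]
  · rw [S₂.frame_unitScalar hρ, Φ.map_frame, hlin, hz x w', lineCoord_smul]
  · rw [Φ.map_actQ, S₂.actQ_right]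
  · refine PrincipalBundle.SmoothFamily.of_local fun t ht => ?_
    obtain ⟨O', h1, h2, h3, h4⟩ := PrincipalBundle.exists_twist_nbhd A hn hu.1 hO ht
    have h5 := h (γ t).1 γ u O' h2 (hu.mono h1) h4
    have h6 : USm m (fun x => (A.ζ (γ t).1 x)⁻¹ * z x (w' x)) (A.U (γ t).1 ∩ W) :=
      usm_of_sections μ hw ((A.nbhds _).1.inter hW)
        (SmoothSection.mono (hs (γ t).1) Set.inter_subset_left)
        (SmoothSection.congr (SmoothSection.mono hw' Set.inter_subset_right)
          fun x _ => (hz x (w' x)).symm)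
    have h7 := h6.comp ((FSm.base hn (framePlots_iff.1 hu.1)).mono h1)
      fun t' ht' => ⟨h4 t' ht', hm t' (h1 ht')⟩
    refine ⟨O', h1, h2, h3, (h5.mul h2 h7.unitScalar).congr h2 fun t' _ => ?_⟩
    rw [AlgIso.twist_map, ← S₂.Q.mul_mul, ← unitScalar_mul, mul_inv_cancel_left]

lemma IsAt.isTensor_iff (hn : 0 < n) (hρ : IsSpinRep ρ) {A : UAtlas K m M} (hA : IsAt N A) :
    IsTensor S₁ N S₂ ↔ IsDiff S₁ S₂ A := ⟨fun h => h.isDiff hρ hA, fun h => h.isTensor hn hρ hA⟩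

end Tensor

/-! ### Čech cochains -/

section Cech

variable {X A : Type*} [AddCommGroup A]

lemma mem_overlap {U : X → Set X} {k : ℕ} {σ : Fin (k + 1) → X} {x : X} :
    x ∈ overlap U σ ↔ ∀ i, x ∈ U (σ i) := Set.mem_iInter

lemma isOpen_overlap [TopologicalSpace X] {U : X → Set X} (hU : IsNbhds U) {k : ℕ}
    (σ : Fin (k + 1) → X) : IsOpen (overlap U σ) := isOpen_iInter_of_finite fun i => (hU (σ i)).1

lemma overlap_mono {U V : X → Set X} (h : ∀ p, V p ⊆ U p) {k : ℕ} (σ : Fin (k + 1) → X) :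
    overlap V σ ⊆ overlap U σ := Set.iInter_mono fun i => h (σ i)

lemma mem_overlap_two {U : X → Set X} {p q x : X} : x ∈ overlap U ![p, q] ↔ x ∈ U p ∧ x ∈ U q := by
  simp [mem_overlap, Fin.forall_fin_two]

lemma mem_overlap_three {U : X → Set X} {p q t x : X} :
    x ∈ overlap U ![p, q, t] ↔ x ∈ U p ∧ x ∈ U q ∧ x ∈ U t := by
  simp [mem_overlap, Fin.forall_fin_succ]

lemma mem_overlap_four {U : X → Set X} {p q t u x : X} :
    x ∈ overlap U ![p, q, t, u] ↔ x ∈ U p ∧ x ∈ U q ∧ x ∈ U t ∧ x ∈ U u := by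
  simp [mem_overlap, Fin.forall_fin_succ]

lemma eq_two (σ : Fin 2 → X) : σ = ![σ 0, σ 1] := by
  ext i; fin_cases i <;> rfl

lemma eq_three (σ : Fin 3 → X) : σ = ![σ 0, σ 1, σ 2] := by
  ext i; fin_cases i <;> rfl

lemma eq_four (σ : Fin 4 → X) : σ = ![σ 0, σ 1, σ 2, σ 3] := by
  ext i; fin_cases i <;> rfl

lemma delta_apply {k : ℕ} (c : PreCochain X A k) (σ : Fin (k + 2) → X) (x : X) : cechDelta c σ x =
    ∑ i : Fin (k + 2), (-1 : ℤ) ^ (i : ℕ) • c (fun j => σ (i.succAbove j)) x := rfl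

lemma delta_zero (c : PreCochain X A 0) (p q x : X) :
    cechDelta c ![p, q] x = c ![q] x - c ![p] x := by
  have h0 : (fun j : Fin 1 => ![p, q] ((0 : Fin 2).succAbove j)) = ![q] := by
    ext j; fin_cases j; rfl
  have h1 : (fun j : Fin 1 => ![p, q] ((1 : Fin 2).succAbove j)) = ![p] := by
    ext j; fin_cases j; rfl
  rw [delta_apply, Fin.sum_univ_two, h0, h1]
  simp [sub_eq_add_neg]

lemma delta_one (c : PreCochain X A 1) (p q t x : X) :
    cechDelta c ![p, q, t] x = c ![q, t] x - c ![p, t] x + c ![p, q] x := by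
  have h0 : (fun j : Fin 2 => ![p, q, t] ((0 : Fin 3).succAbove j)) = ![q, t] := by
    ext j; fin_cases j <;> rfl
  have h1 : (fun j : Fin 2 => ![p, q, t] ((1 : Fin 3).succAbove j)) = ![p, t] := by
    ext j; fin_cases j <;> rfl
  have h2 : (fun j : Fin 2 => ![p, q, t] ((2 : Fin 3).succAbove j)) = ![p, q] := by
    ext j; fin_cases j <;> rfl
  rw [delta_apply, Fin.sum_univ_three, h0, h1, h2]
  simp [sub_eq_add_neg]

lemma delta_two (c : PreCochain X A 2) (p q t u x : X) : cechDelta c ![p, q, t, u] x =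
    c ![q, t, u] x - c ![p, t, u] x + c ![p, q, u] x - c ![p, q, t] x := by
  have h0 : (fun j : Fin 3 => ![p, q, t, u] ((0 : Fin 4).succAbove j)) = ![q, t, u] := by
    ext j; fin_cases j <;> rfl
  have h1 : (fun j : Fin 3 => ![p, q, t, u] ((1 : Fin 4).succAbove j)) = ![p, t, u] := by
    ext j; fin_cases j <;> rfl
  have h2 : (fun j : Fin 3 => ![p, q, t, u] ((2 : Fin 4).succAbove j)) = ![p, q, u] := by
    ext j; fin_cases j <;> rfl
  have h3 : (fun j : Fin 3 => ![p, q, t, u] ((3 : Fin 4).succAbove j)) = ![p, q, t] := by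
    ext j; fin_cases j <;> rfl
  rw [delta_apply, Fin.sum_univ_four, h0, h1, h2, h3]
  simp [sub_eq_add_neg]

lemma eq_five (σ : Fin 5 → X) : σ = ![σ 0, σ 1, σ 2, σ 3, σ 4] := by
  ext i; fin_cases i <;> rfl

lemma delta_three (c : PreCochain X A 3) (p q t u v x : X) : cechDelta c ![p, q, t, u, v] x =
    c ![q, t, u, v] x - c ![p, t, u, v] x + c ![p, q, u, v] x - c ![p, q, t, v] x
      + c ![p, q, t, u] x := by
  have h0 : (fun j : Fin 4 => ![p, q, t, u, v] ((0 : Fin 5).succAbove j)) = ![q, t, u, v] := by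
    ext j; fin_cases j <;> rfl
  have h1 : (fun j : Fin 4 => ![p, q, t, u, v] ((1 : Fin 5).succAbove j)) = ![p, t, u, v] := by
    ext j; fin_cases j <;> rfl
  have h2 : (fun j : Fin 4 => ![p, q, t, u, v] ((2 : Fin 5).succAbove j)) = ![p, q, u, v] := by
    ext j; fin_cases j <;> rfl
  have h3 : (fun j : Fin 4 => ![p, q, t, u, v] ((3 : Fin 5).succAbove j)) = ![p, q, t, v] := by
    ext j; fin_cases j <;> rfl
  have h4 : (fun j : Fin 4 => ![p, q, t, u, v] ((4 : Fin 5).succAbove j)) = ![p, q, t, u] := by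
    ext j; fin_cases j <;> rfl
  rw [delta_apply, Fin.sum_univ_five, h0, h1, h2, h3, h4]
  simp [sub_eq_add_neg]

lemma delta_delta_one (c : PreCochain X A 1) (σ : Fin 4 → X) (x : X) :
    cechDelta (cechDelta c) σ x = 0 := by
  rw [eq_four σ, delta_two, delta_one, delta_one, delta_one, delta_one]
  abel

lemma delta_delta_two (c : PreCochain X A 2) (σ : Fin 5 → X) (x : X) :
    cechDelta (cechDelta c) σ x = 0 := by
  rw [eq_five σ, delta_three, delta_two, delta_two, delta_two, delta_two, delta_two]
  abel

variable [TopologicalSpace X]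

lemma cechClass_eq_iff {k : ℕ} {c c' : cechZ X A (k + 1)} : cechClass c = cechClass c' ↔
    ∃ b ∈ cechC X A k, ∃ U, IsNbhds U ∧ ∀ σ, ∀ x ∈ overlap U σ, c'.1 σ x - c.1 σ x = cechDelta b σ x := by
  rw [cechClass, cechClass, QuotientAddGroup.eq, AddSubgroup.mem_addSubgroupOf, cechB,
    AddSubgroup.mem_sup]
  constructor
  · rintro ⟨_, ⟨b, hb, rfl⟩, d, ⟨U, hU, hd⟩, h⟩
    refine ⟨b, hb, U, hU, fun σ x hx => ?_⟩
    have h1 := congrFun (congrFun h σ) x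
    simp only [Pi.add_apply, hd σ x hx, add_zero] at h1
    rw [h1]
    simp [sub_eq_neg_add]
  · rintro ⟨b, hb, U, hU, h⟩
    refine ⟨cechDelta b, ⟨b, hb, rfl⟩, (-c + c' : cechZ X A (k + 1)).1 - cechDelta b, ⟨U, hU, ?_⟩, ?_⟩
    · intro σ x hx
      have := h σ x hx
      simp only [Pi.sub_apply, ← this]
      simp [sub_eq_neg_add]
    · simp

/-- A cocycle from its properties over a cover. -/
def mkCocycle {k : ℕ} (c : PreCochain X A k) {U : X → Set X} (hU : IsNbhds U)
    (h : ∀ σ, ∀ x ∈ overlap U σ, ∀ᶠ y in 𝓝 x, c σ y = c σ x)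
    (h' : ∀ σ, ∀ x ∈ overlap U σ, cechDelta c σ x = 0) : cechZ X A k :=
  ⟨c, ⟨U, hU, h⟩, ⟨U, hU, h'⟩⟩

lemma exists_nbhds {k : ℕ} (c : cechZ X A k) : ∃ U : X → Set X, IsNbhds U ∧
    (∀ σ, ∀ x ∈ overlap U σ, ∀ᶠ y in 𝓝 x, c.1 σ y = c.1 σ x) ∧
    ∀ σ, ∀ x ∈ overlap U σ, cechDelta c.1 σ x = 0 := by
  obtain ⟨U, hU, h⟩ := c.2.1
  obtain ⟨U', hU', h'⟩ := c.2.2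
  exact ⟨_, hU.inter hU', fun σ x hx => h σ x (overlap_inter hx).1,
    fun σ x hx => h' σ x (overlap_inter hx).2⟩

lemma delta_congr {k : ℕ} {c c' : PreCochain X A k} {U : X → Set X}
    (h : ∀ σ, ∀ x ∈ overlap U σ, c σ x = c' σ x) {σ : Fin (k + 2) → X} {x : X}
    (hx : x ∈ overlap U σ) : cechDelta c σ x = cechDelta c' σ x := by
  rw [delta_apply, delta_apply]
  exact Finset.sum_congr rfl fun i _ => by
    rw [h _ x (mem_overlap.2 fun j => mem_overlap.1 hx _)]

lemma delta_map {B : Type*} [AddCommGroup B] (φ : A →+ B) {k : ℕ} (c : PreCochain X A k)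
    (σ : Fin (k + 2) → X) (x : X) : cechDelta (fun σ x => φ (c σ x)) σ x = φ (cechDelta c σ x) := by
  rw [delta_apply, delta_apply, map_sum]
  exact Finset.sum_congr rfl fun i _ => (map_zsmul φ _ _).symm

/-- A refinement of a cover on which a local property of pairs holds on all overlaps. -/
lemma exists_refinement [ParacompactSpace X] [T2Space X] {U : X → Set X} (hU : IsNbhds U)
    {P : X → X → Set X → Prop} (mono : ∀ p q W W', W' ⊆ W → P p q W → P p q W')
    (loc : ∀ p q, ∀ x ∈ U p ∩ U q, ∃ W, IsOpen W ∧ x ∈ W ∧ P p q W) :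
    ∃ (τ : X → X) (V : X → Set X), IsNbhds V ∧ (∀ p, V p ⊆ U (τ p)) ∧
      ∀ p q, (V p ∩ V q).Nonempty → P (τ p) (τ q) (V p) := by
  obtain ⟨B, hB, hBc, hBf, hBU⟩ := precise_refinement U (fun p => (hU p).1)
    (Set.eq_univ_of_forall fun p => Set.mem_iUnion.2 ⟨p, (hU p).2⟩)
  -- Shrinking a locally finite refinement: near a point only finitely many closures of the `D j`
  -- matter.
  obtain ⟨D, hDc, hD, hDB⟩ := exists_iUnion_eq_closure_subset hB (fun x => hBf.point_finite x) hBc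
  have hDf : LocallyFinite fun i => closure (D i) := hBf.subset hDB
  have hτ : ∀ p, ∃ i, p ∈ D i := fun p => Set.mem_iUnion.1 (hDc ▸ Set.mem_univ p)
  choose τ hτ using hτ
  have key : ∀ p, ∃ V, IsOpen V ∧ p ∈ V ∧ V ⊆ D (τ p) ∧
      ∀ j, (V ∩ D j).Nonempty → P (τ p) j V := fun p => by
    obtain ⟨W, hW, hWf⟩ := hDf p
    have h1 : ∀ j, ∃ Wj, IsOpen Wj ∧ p ∈ Wj ∧ ((Wj ∩ closure (D j)).Nonempty → P (τ p) j Wj) := by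
      intro j
      by_cases hj : p ∈ closure (D j)
      · obtain ⟨Wj, h1, h2, h3⟩ := loc (τ p) j p ⟨hBU _ (hDB _ (subset_closure (hτ p))), hBU _ (hDB j hj)⟩
        exact ⟨Wj, h1, h2, fun _ => h3⟩
      -- If `p` is outside the closure of `D j`, the neighbourhood is taken disjoint from it and no
      -- condition arises.
      · exact ⟨(closure (D j))ᶜ, isClosed_closure.isOpen_compl, hj, fun ⟨x, hx⟩ => absurd hx.2 hx.1⟩
    choose Wj hWo hWp hWP using h1
    refine ⟨interior W ∩ D (τ p) ∩ ⋂ j ∈ {j | (closure (D j) ∩ W).Nonempty}, Wj j,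
      (isOpen_interior.inter (hD _)).inter (hWf.isOpen_biInter fun j _ => hWo j),
      ⟨⟨mem_interior_iff_mem_nhds.2 hW, hτ p⟩, Set.mem_iInter₂.2 fun j _ => hWp j⟩,
      fun x hx => hx.1.2, fun j ⟨x, hx, hxj⟩ => ?_⟩
    have hj : j ∈ {j | (closure (D j) ∩ W).Nonempty} :=
      ⟨x, subset_closure hxj, interior_subset hx.1.1⟩
    have hsub : (interior W ∩ D (τ p) ∩ ⋂ j ∈ {j | (closure (D j) ∩ W).Nonempty}, Wj j) ⊆ Wj j :=
      fun y hy => Set.mem_iInter₂.1 hy.2 j hj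
    exact mono _ _ _ _ hsub (hWP j ⟨x, hsub hx, subset_closure hxj⟩)
  choose V hVo hVp hVD hVP using key
  -- If `V p` meets `V q`, it meets `D (τ q)`. So the local property holds on the whole of `V p`, in
  -- particular on the overlap.
  exact ⟨τ, V, fun p => ⟨hVo p, hVp p⟩, fun p => (hVD p).trans (subset_closure.trans
    ((hDB _).trans (hBU _))), fun p q ⟨x, hx⟩ => hVP p (τ q) ⟨x, hx.1, hVD q hx.2⟩⟩

lemma continuousOn_delta {U : X → Set X} {k : ℕ} {r : PreCochain X ℝ k}
    (h : ∀ σ, ContinuousOn (r σ) (overlap U σ)) (σ : Fin (k + 2) → X) :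
    ContinuousOn (cechDelta r σ) (overlap U σ) := by
  have h1 : cechDelta r σ = fun x => ∑ i : Fin (k + 2), (-1 : ℤ) ^ (i : ℕ) •
      r (fun j => σ (i.succAbove j)) x := rfl
  rw [h1]
  refine continuousOn_finsetSum _ fun i _ => ?_
  have h2 : ContinuousOn (r fun j => σ (i.succAbove j)) (overlap U σ) :=
    (h _).mono fun x hx => mem_overlap.2 fun j => mem_overlap.1 hx _
  exact h2.const_smul ((-1 : ℤ) ^ (i : ℕ))

end Cech

/-! ### Integer valued functions, exponentials and logarithms -/

section Exponential

lemma eventually_eq_of_int {X : Type*} [TopologicalSpace X] {f : X → ℝ} {z : X → ℤ} {O : Set X}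
    (hO : IsOpen O) (hf : ContinuousOn f O) (hz : ∀ x ∈ O, f x = z x) {x : X} (hx : x ∈ O) :
    ∀ᶠ y in 𝓝 x, z y = z x := by
  have h1 := (hf.continuousAt (hO.mem_nhds hx)).eventually (Metric.ball_mem_nhds (f x) one_pos)
  filter_upwards [h1, hO.mem_nhds hx] with y hy hyO
  change dist (f y) (f x) < 1 at hy
  rw [Real.dist_eq, hz y hyO, hz x hx, ← Int.cast_sub, ← Int.cast_abs] at hy
  have h2 : |z y - z x| < 1 := by exact_mod_cast hy
  have := Int.abs_lt_one_iff.1 h2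
  lia

/-- Integer valued continuous cochains are locally constant. -/
lemma exists_int_cochain {X : Type*} [TopologicalSpace X] {k : ℕ} {r : PreCochain X ℝ k}
    {U : X → Set X} (hU : IsNbhds U) (hr : ∀ σ, ContinuousOn (r σ) (overlap U σ))
    (hri : ∀ σ, ∀ x ∈ overlap U σ, ∃ j : ℤ, r σ x = j) :
    ∃ b ∈ cechC X ℤ k, (∀ σ, ∀ x ∈ overlap U σ, ∀ᶠ y in 𝓝 x, b σ y = b σ x) ∧
      ∀ σ, ∀ x ∈ overlap U σ, r σ x = b σ x := by
  have h2 : ∀ σ y, ∃ j : ℤ, y ∈ overlap U σ → r σ y = j := fun σ y => by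
    by_cases hy : y ∈ overlap U σ
    · exact (hri σ y hy).imp fun j hj _ => hj
    · exact ⟨0, fun h => absurd h hy⟩
  choose b hb using h2
  have h3 := fun σ x hx => eventually_eq_of_int (isOpen_overlap hU σ) (hr σ) (hb σ) (x := x) hx
  exact ⟨b, ⟨U, hU, h3⟩, h3, hb⟩

lemma exists_int_cocycle {X : Type*} [TopologicalSpace X] {k : ℕ} {r : PreCochain X ℝ k}
    {U : X → Set X} (hU : IsNbhds U) (hr : ∀ σ, ContinuousOn (r σ) (overlap U σ))
    (hri : ∀ σ, ∀ x ∈ overlap U σ, ∃ j : ℤ, cechDelta r σ x = j)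
    (hd : ∀ σ x, cechDelta (cechDelta r) σ x = 0) :
    ∃ z : cechZ X ℤ (k + 1), ∀ σ, ∀ x ∈ overlap U σ, cechDelta r σ x = z.1 σ x := by
  obtain ⟨b, -, h1, h2⟩ := exists_int_cochain hU (continuousOn_delta hr) hri
  refine ⟨mkCocycle b hU h1 fun σ x hx => ?_, h2⟩
  have h3 : ((cechDelta b σ x : ℤ) : ℝ) = 0 := by
    rw [← hd σ x, delta_congr h2 hx]
    exact (delta_map (Int.castAddHom ℝ) b σ x).symm
  exact_mod_cast h3

/-- The point `exp(2πit)` of the unit circle. -/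
def expU (t : ℝ) : unitary ℂ :=
  ⟨Complex.exp (2 * Real.pi * Complex.I * t), norm_eq_one_iff_mem_unitary.1 (by
    rw [Complex.norm_exp]; simp)⟩

lemma coe_expU (t : ℝ) : (expU t : ℂ) = Complex.exp (2 * Real.pi * Complex.I * t) := rfl

lemma expU_add (s t : ℝ) : expU (s + t) = expU s * expU t :=
  Subtype.ext (by simp [coe_expU, mul_add, Complex.exp_add])

lemma expU_zero : expU 0 = 1 := Subtype.ext (by simp [coe_expU])

lemma expU_neg (t : ℝ) : expU (-t) = (expU t)⁻¹ :=
  eq_inv_of_mul_eq_one_left (by rw [← expU_add, neg_add_cancel, expU_zero])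

lemma expU_sub (s t : ℝ) : expU (s - t) = expU s * (expU t)⁻¹ := by
  rw [sub_eq_add_neg, expU_add, expU_neg]

lemma expU_eq_one_iff {t : ℝ} : expU t = 1 ↔ ∃ k : ℤ, t = k := by
  rw [Subtype.ext_iff, coe_expU, OneMemClass.coe_one, Complex.exp_eq_one_iff]
  refine exists_congr fun k => ?_
  have h : (2 * Real.pi * Complex.I : ℂ) ≠ 0 := Complex.two_pi_I_ne_zero
  rw [mul_comm, mul_left_inj' h]
  norm_cast

variable {k : ℕ} {X : Type*} [TopologicalSpace X] [ChartedSpace (Eu k) X] {O : Set X}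

lemma usm_expU {f : X → ℝ} (hf : ContMDiffOn (𝓡 k) 𝓘(ℝ, ℝ) ∞ f O) : USm k (fun x => expU (f x)) O := by
  have h : ContDiff ℝ ∞ fun t : ℝ => Complex.exp (2 * Real.pi * Complex.I * t) :=
    (contDiff_const.mul Complex.ofRealCLM.contDiff).cexp
  exact h.contMDiff.comp_contMDiffOn hf

/-- Local logarithms. -/
lemma exists_local_log {η : X → unitary ℂ} (hO : IsOpen O) (h : USm k η O) {x₀ : X} (hx₀ : x₀ ∈ O) :
    ∃ W ⊆ O, IsOpen W ∧ x₀ ∈ W ∧ ∃ l : X → ℝ, ContMDiffOn (𝓡 k) 𝓘(ℝ, ℝ) ∞ l W ∧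
      ∀ x ∈ W, expU (l x) = η x := by
  have hu : ∀ z : unitary ℂ, expU (Complex.arg z / (2 * Real.pi)) = z := fun z => Subtype.ext (by
    have hz := norm_eq_one_iff_mem_unitary.2 z.2
    rw [coe_expU]
    have h2 : (2 * Real.pi * Complex.I * ((Complex.arg z / (2 * Real.pi) : ℝ) : ℂ)) =
        Complex.arg z * Complex.I := by
      have : (Real.pi : ℂ) ≠ 0 := by exact_mod_cast Real.pi_ne_zero
      push_cast
      field_simp
    rw [h2]
    have h3 := Complex.norm_mul_exp_arg_mul_I (z : ℂ)
    rwa [hz, Complex.ofReal_one, one_mul] at h3)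
  -- Rotating the value at `x₀` to `1` keeps nearby values in the slit plane, where the principal
  -- logarithm is smooth.
  have h1 : USm k (fun x => η x * (η x₀)⁻¹) O := h.mul (usm_const _)
  refine ⟨O ∩ (fun x => ((η x * (η x₀)⁻¹ : unitary ℂ) : ℂ)) ⁻¹' Complex.slitPlane,
    Set.inter_subset_left, (ContMDiffOn.continuousOn h1).isOpen_inter_preimage hO
      Complex.isOpen_slitPlane, ⟨hx₀, by
        rw [Set.mem_preimage, mul_inv_cancel]; simp⟩,
    fun x => Complex.arg (η x * (η x₀)⁻¹ : unitary ℂ) / (2 * Real.pi) +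
      Complex.arg (η x₀) / (2 * Real.pi), fun x hx => ?_, fun x _ => ?_⟩
  · have h2 : ContDiffAt ℝ ∞ (fun z : ℂ => (Complex.log z).im / (2 * Real.pi) +
        Complex.arg (η x₀) / (2 * Real.pi)) ((η x * (η x₀)⁻¹ : unitary ℂ) : ℂ) := by
      have h3 : ContDiffAt ℝ ∞ Complex.log ((η x * (η x₀)⁻¹ : unitary ℂ) : ℂ) :=
        (Complex.contDiffAt_log hx.2).restrict_scalars ℝ
      exact ((Complex.imCLM.contDiff.contDiffAt.comp _ h3).div_const _).add contDiffAt_const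
    simp only [Complex.log_im] at h2
    exact (ContMDiffAt.comp_contMDiffWithinAt (g := fun z : ℂ => Complex.arg z / (2 * Real.pi) +
      Complex.arg (η x₀) / (2 * Real.pi)) x h2.contMDiffAt (h1 x hx.1)).mono Set.inter_subset_left
  · rw [expU_add, hu, hu, inv_mul_cancel_right]

/-- A continuous logarithm of a smooth function is smooth. -/
lemma contMDiffOn_of_expU {f : X → ℝ} (hO : IsOpen O) (hf : ContinuousOn f O)
    (h : USm k (fun x => expU (f x)) O) : ContMDiffOn (𝓡 k) 𝓘(ℝ, ℝ) ∞ f O := by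
  intro x hx
  obtain ⟨W, hWO, hW, hxW, l, hl, he⟩ := exists_local_log hO h hx
  have h1 : ∀ y ∈ W, ∃ j : ℤ, f y - l y = j := fun y hy => expU_eq_one_iff.1 (by
    rw [expU_sub, he y hy, mul_inv_cancel])
  have h2 : ∀ y, ∃ j : ℤ, y ∈ W → f y - l y = j := fun y => by
    by_cases hy : y ∈ W
    · exact (h1 y hy).imp fun j hj _ => hj
    · exact ⟨0, fun h => absurd h hy⟩
  choose z hz using h2
  -- The given logarithm differs from a smooth local one by a continuous integer valued function,
  -- which is locally constant.
  have h3 := eventually_eq_of_int hW ((hf.mono hWO).sub hl.continuousOn) hz hxW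
  have h4 : ContMDiffAt (𝓡 k) 𝓘(ℝ, ℝ) ∞ (fun y => l y + (z x : ℝ)) x :=
    (hl.contMDiffAt (hW.mem_nhds hxW)).add contMDiffAt_const
  refine (h4.congr_of_eventuallyEq ?_).contMDiffWithinAt
  filter_upwards [h3, hW.mem_nhds hxW] with y hy hyW
  rw [← hy, ← hz y hyW, add_sub_cancel]

end Exponential

/-! ### Averages with respect to a partition of unity -/

section Average

variable {m : ℕ} {M : Type*} [TopologicalSpace M] [ChartedSpace (Eu m) M]
  {V : M → Set M} {f : SmoothPartitionOfUnity M (𝓡 m) M Set.univ}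

/-- The average of a family of numbers with respect to a partition of unity. -/
def average (f : SmoothPartitionOfUnity M (𝓡 m) M Set.univ) (c : M → ℝ) (x : M) : ℝ :=
  ∑ᶠ i, f i x * c i

lemma average_finite (c : M → ℝ) (x : M) : (Function.support fun i => f i x * c i).Finite :=
  (f.locallyFinite.point_finite x).subset fun p hp h => hp (by simp only [h, zero_mul])

lemma average_add (c d : M → ℝ) (x : M) :
    average f (fun i => c i + d i) x = average f c x + average f d x := by
  rw [average, average, average, ← finsum_add_distrib (average_finite c x) (average_finite d x)]
  exact finsum_congr fun i => mul_add _ _ _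

lemma average_neg (c : M → ℝ) (x : M) : average f (fun i => -c i) x = -average f c x := by
  rw [average, average, ← finsum_neg_distrib]
  exact finsum_congr fun i => mul_neg _ _

lemma average_sub (c d : M → ℝ) (x : M) :
    average f (fun i => c i - d i) x = average f c x - average f d x := by
  simp only [sub_eq_add_neg]
  rw [average_add, average_neg]

/-- The weights sum to one and only indices with `x ∈ V i` contribute. Averaging over one index of a
cocycle thus gives a contracting homotopy for smooth real cochains. -/
lemma average_eq (hf : f.IsSubordinate V) {c : M → ℝ} {x : M} {d : ℝ} (h : ∀ i, x ∈ V i → c i = d) :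
    average f c x = d := by
  have h1 : average f c x = ∑ᶠ i, f i x * d := finsum_congr fun i => by
    by_cases hi : f i x = 0
    · rw [hi, zero_mul, zero_mul]
    · rw [h i (hf i (subset_tsupport _ hi))]
  rw [h1, ← finsum_mul' _ _ (f.locallyFinite.point_finite x), f.sum_eq_one (Set.mem_univ x), one_mul]

lemma average_smooth (hV : IsNbhds V) (hf : f.IsSubordinate V) {O : Set M} (hO : IsOpen O)
    {c : M → M → ℝ} (hc : ∀ i, ContMDiffOn (𝓡 m) 𝓘(ℝ, ℝ) ∞ (c i) (O ∩ V i)) :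
    ContMDiffOn (𝓡 m) 𝓘(ℝ, ℝ) ∞ (fun x => average f (fun i => c i x) x) O := fun _ hx =>
  (f.contMDiffAt_finsum (g := c) fun i hi => (hc i).contMDiffAt
    ((hO.inter (hV i).1).mem_nhds ⟨hx, hf i hi⟩)).contMDiffWithinAt

lemma exists_partition [IsManifold (𝓡 m) ∞ M] [T2Space M] [SecondCountableTopology M]
    (hV : IsNbhds V) :
    ∃ f : SmoothPartitionOfUnity M (𝓡 m) M Set.univ, f.IsSubordinate V := by
  have := ChartedSpace.locallyCompactSpace (Eu m) M
  exact SmoothPartitionOfUnity.exists_isSubordinate (𝓡 m) isClosed_univ V (fun p => (hV p).1)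
    fun p _ => Set.mem_iUnion.2 ⟨p, (hV p).2⟩

lemma contMDiffOn_of_eventually_eq {F : Type*} [NormedAddCommGroup F] [NormedSpace ℝ F] {g : M → F}
    {O : Set M} (h : ∀ x ∈ O, ∀ᶠ y in 𝓝 x, g y = g x) : ContMDiffOn (𝓡 m) 𝓘(ℝ, F) ∞ g O :=
  fun x hx => ((contMDiffAt_const (c := g x)).congr_of_eventuallyEq (h x hx)).contMDiffWithinAt

end Average

/-! ### The Chern class of an atlas -/

section Chern

open LineBundle

variable {m : ℕ} {M : Type*} [TopologicalSpace M] [ChartedSpace (Eu m) M] {K : Type} [RCLike K]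

/-- The `ξ p` are smooth local sections of the bundle `A` over the sets `U p`. -/
structure UAtlas.IsSections (A : UAtlas K m M) (U : M → Set M) (ξ : M → M → unitary K) : Prop where
  nbhds : IsNbhds U
  subset : ∀ p, U p ⊆ A.U p
  smooth : ∀ p, USm m (fun x => (A.ζ p x)⁻¹ * ξ p x) (U p)

namespace UAtlas.IsSections

variable {A B : UAtlas K m M} {U V : M → Set M} {ξ η : M → M → unitary K}

lemma mono (h : A.IsSections U ξ) (hV : IsNbhds V) (hVU : ∀ p, V p ⊆ U p) : A.IsSections V ξ :=
  ⟨hV, fun p => (hVU p).trans (h.subset p), fun p => (h.smooth p).mono (hVU p)⟩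

lemma ratio (h : A.IsSections U ξ) (p q : M) : USm m (fun x => (ξ p x)⁻¹ * ξ q x) (U p ∩ U q) := by
  have h1 := (A.smooth p q).mono (Set.inter_subset_inter (h.subset p) (h.subset q))
  have h2 := (h.smooth p).mono (Set.inter_subset_left (t := U q))
  have h3 := (h.smooth q).mono (Set.inter_subset_right (s := U p))
  refine ((h2.inv.mul h1).mul h3).congr fun x _ => ?_
  simp only [mul_inv, inv_inv]
  simp [mul_comm, mul_left_comm]

lemma mul (h : A.IsSections U ξ) (h' : B.IsSections U η) :
    (A.mul B).IsSections U (fun p x => ξ p x * η p x) := by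
  refine ⟨h.nbhds, fun p x hx => ⟨h.subset p hx, h'.subset p hx⟩, fun p =>
    ((h.smooth p).mul (h'.smooth p)).congr fun x _ => ?_⟩
  simp only [UAtlas.mul, mul_inv]
  exact mul_mul_mul_comm _ _ _ _

/-- Equivalences in terms of sections. -/
lemma equiv_iff (h : A.IsSections U ξ) (h' : B.IsSections U η) :
    A.Equiv B ↔ ∃ w : M → unitary K, ∀ p, USm m (fun x => (ξ p x)⁻¹ * η p x * w x) (U p) := by
  constructor
  · rintro ⟨w, hw⟩
    refine ⟨w, fun p => (((h.smooth p).inv.mul ((hw p p).mono fun x hx =>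
      ⟨h.subset p hx, h'.subset p hx⟩)).mul (h'.smooth p)).congr fun x _ => ?_⟩
    refine Additive.ofMul.injective ?_
    simp only [ofMul_mul, ofMul_inv]
    abel
  · rintro ⟨w, hw⟩
    refine equiv_of_diag h.nbhds (h := w) fun p =>
      (((h.smooth p).mul (hw p)).mul (h'.smooth p).inv).congr fun x _ => ?_
    refine Additive.ofMul.injective ?_
    simp only [ofMul_mul, ofMul_inv]
    abel

lemma isAt_smooth [IsManifold (𝓡 m) ∞ M] {N : LineBundle K m M} (h : A.IsSections U ξ)
    {w : ∀ x, N.fiber x} (hs : ∀ p, N.SmoothSection (A.U p) (fun x => (A.ζ p x : K) • w x)) (p : M) :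
    N.SmoothSection (U p) (fun x => (ξ p x : K) • w x) := by
  refine SmoothSection.congr (SmoothSection.smul (h.nbhds p).1 (h.smooth p)
    (SmoothSection.mono (hs p) (h.subset p))) fun x _ => ?_
  simp only
  rw [smul_smul, ← MulMemClass.coe_mul, mul_comm ((A.ζ p x)⁻¹), inv_mul_cancel_right]

end UAtlas.IsSections

/-- Sections of the unit vector bundle from sections of a line bundle. -/
lemma exists_isSections [IsManifold (𝓡 m) ∞ M] {N : LineBundle K m M} {A : UAtlas K m M}
    (μ : LineMetric N) {w : ∀ x, N.fiber x} (hw : ∀ x, μ.norm (w x) = 1)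
    (hA : ∀ p, N.SmoothSection (A.U p) (fun x => (A.ζ p x : K) • w x)) {U : M → Set M}
    (hU : IsNbhds U) {s : M → ∀ x, N.fiber x}
    (hs : ∀ p, N.SmoothSection (U p) (s p) ∧ ∀ x ∈ U p, s p x ≠ 0) :
    ∃ ξ : M → M → unitary K, A.IsSections (fun p => U p ∩ A.U p) ξ ∧
      ∀ p, ∀ x ∈ U p, μ.normalize (s p x) = (ξ p x : K) • w x := by
  have h : ∀ p x, ∃ z : unitary K, x ∈ U p → μ.normalize (s p x) = (z : K) • w x := fun p x => by
    by_cases hx : x ∈ U p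
    · exact (μ.exists_unitary (hw x) (μ.norm_normalize ((hs p).2 x hx))).imp fun z hz _ => hz
    · exact ⟨1, fun h => absurd h hx⟩
  choose ξ hξ using h
  refine ⟨ξ, ⟨hU.inter A.nbhds, fun p => Set.inter_subset_right, fun p => ?_⟩, hξ⟩
  refine usm_of_sections μ hw ((hU p).1.inter (A.nbhds p).1)
    (SmoothSection.mono (hA p) Set.inter_subset_right) ?_
  exact SmoothSection.congr (SmoothSection.mono (μ.normalize_smooth (hU p).1 (hs p).1 (hs p).2)
    Set.inter_subset_left) fun x hx => (hξ p x hx.1).symm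

/-- The Chern class of a bundle with group `U(1)`. -/
def UAtlas.IsChern (A : UAtlas ℂ m M) (c : H2 M ℤ) : Prop :=
  ∃ (U : M → Set M) (ξ : M → M → unitary ℂ) (r : PreCochain M ℝ 1) (z : cechZ M ℤ 2),
    A.IsSections U ξ ∧ (∀ σ, ContinuousOn (r σ) (overlap U σ)) ∧
    (∀ σ, ∀ x ∈ overlap U σ, ξ (σ 1) x = expU (r σ x) * ξ (σ 0) x) ∧
    (∀ σ, ∀ x ∈ overlap U σ, cechDelta r σ x = (z.1 σ x : ℝ)) ∧ cechClass z = c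

lemma LineMetric.normalize_smul [IsManifold (𝓡 m) ∞ M] {N : LineBundle K m M} (μ : LineMetric N)
    {x : M} (c : K) (w : N.fiber x) : μ.normalize (c • w) = (c * (‖c‖ : K)⁻¹) • μ.normalize w := by
  rw [normalize, normalize, μ.norm_smul, smul_smul, smul_smul]
  congr 1
  push_cast
  rw [mul_inv]
  ring

/-- Normalising the sections replaces the complex logarithm `r` by its real part, since its
imaginary part only affects absolute values. The coboundary is integral and so does not change. -/
lemma IsAt.isChernClass_iff [IsManifold (𝓡 m) ∞ M] {N : LineBundle ℂ m M} {A : UAtlas ℂ m M}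
    (hA : IsAt N A) (c : H2 M ℤ) : IsChernClass N c ↔ A.IsChern c := by
  obtain ⟨μ, w, hw, hA⟩ := hA
  constructor
  · rintro ⟨U, s, r, z, hU, hs, hr, hsr, hz, rfl⟩
    obtain ⟨ξ, hξ, hξs⟩ := exists_isSections μ hw hA hU hs
    have hsub : ∀ {k : ℕ} (σ : Fin (k + 1) → M), overlap (fun p => U p ∩ A.U p) σ ⊆ overlap U σ :=
      fun σ => overlap_mono (fun p => Set.inter_subset_left) σ
    refine ⟨_, ξ, fun σ x => (r σ x).re, z, hξ, fun σ => Complex.continuous_re.comp_continuousOn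
      ((hr σ).mono (hsub σ)), fun σ x hx => ?_, fun σ x hx => ?_, rfl⟩
    · have hx' := mem_overlap.1 (hsub σ hx)
      have h1 := congrArg μ.normalize (hsr σ x (hsub σ hx))
      rw [μ.normalize_smul, hξs _ x (hx' 1), hξs _ x (hx' 0), smul_smul] at h1
      refine Subtype.ext (smul_left_injective ℂ (μ.ne_zero (hw x)) (h1.trans ?_))
      simp only [MulMemClass.coe_mul]
      congr 2
      rw [coe_expU, Complex.norm_exp, RCLike.ofReal_eq_complex_ofReal, Complex.ofReal_exp,
        ← Complex.exp_neg, ← Complex.exp_add]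
      congr 1
      apply Complex.ext <;> simp
    · have h1 := congrArg Complex.re (hz σ x (hsub σ hx))
      rw [Complex.intCast_re] at h1
      rw [← h1]
      exact delta_map Complex.reAddGroupHom r σ x
  · rintro ⟨U, ξ, r, z, hξ, hr, hsr, hz, rfl⟩
    refine ⟨U, fun p x => (ξ p x : ℂ) • w x, fun σ x => (r σ x : ℂ), z, hξ.nbhds, fun p =>
      ⟨hξ.isAt_smooth hA p, fun x _ => smul_ne_zero (coe_unitary_ne_zero _) (μ.ne_zero (hw x))⟩,
      fun σ => Complex.continuous_ofReal.comp_continuousOn (hr σ), fun σ x hx => ?_,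
      fun σ x hx => ?_, rfl⟩
    · simp only
      rw [hsr σ x hx, MulMemClass.coe_mul, mul_smul, coe_expU]
    · rw [← Complex.ofReal_intCast, ← hz σ x hx]
      exact delta_map Complex.ofRealHom.toAddMonoidHom r σ x

namespace UAtlas

/-- The transition functions have only local logarithms. After `exists_refinement` they have
logarithms on whole overlaps, and the coboundary of these is integral by the cocycle identity. -/
lemma exists_isChern [IsManifold (𝓡 m) ∞ M] [T2Space M] [SecondCountableTopology M]
    (A : UAtlas ℂ m M) : ∃ c, A.IsChern c := by
  have := ChartedSpace.locallyCompactSpace (Eu m) M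
  obtain ⟨τ, V, hV, hVU, hVP⟩ := exists_refinement A.nbhds
    (P := fun p q W => ∃ l : M → ℝ, ContinuousOn l W ∧ ∀ x ∈ W, expU (l x) = (A.ζ p x)⁻¹ * A.ζ q x)
    (fun p q W W' hW ⟨l, h1, h2⟩ => ⟨l, h1.mono hW, fun x hx => h2 x (hW hx)⟩)
    (fun p q x hx => by
      obtain ⟨W, -, h1, h2, l, h3, h4⟩ := exists_local_log
        ((A.nbhds p).1.inter (A.nbhds q).1) (A.smooth p q) hx
      exact ⟨W, h1, h2, l, h3.continuousOn, h4⟩)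
  have hl : ∀ p q, ∃ l : M → ℝ, ContinuousOn l (V p ∩ V q) ∧
      ∀ x ∈ V p ∩ V q, expU (l x) = (A.ζ (τ p) x)⁻¹ * A.ζ (τ q) x := fun p q => by
    by_cases h : (V p ∩ V q).Nonempty
    · obtain ⟨l, h1, h2⟩ := hVP p q h
      exact ⟨l, h1.mono Set.inter_subset_left, fun x hx => h2 x hx.1⟩
    · rw [Set.not_nonempty_iff_eq_empty] at h
      exact ⟨0, by simp [h], by simp [h]⟩
  choose l hl he using hl
  -- The reindexed section `A.ζ (τ p)` has to be compared with `A.ζ p`, so the cover is cut down to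
  -- `A.U p`.
  have hsub : ∀ p, V p ∩ A.U p ⊆ V p := fun p => Set.inter_subset_left
  have hov : ∀ {k : ℕ} (σ : Fin (k + 1) → M), overlap (fun p => V p ∩ A.U p) σ ⊆ overlap V σ :=
    fun σ => overlap_mono hsub σ
  have hU := hV.inter A.nbhds
  have hs : A.IsSections (fun p => V p ∩ A.U p) (fun p => A.ζ (τ p)) :=
    ⟨hU, fun p => Set.inter_subset_right,
      fun p => (A.smooth p (τ p)).mono fun x hx => ⟨hx.2, hVU p hx.1⟩⟩
  let r : PreCochain M ℝ 1 := fun σ => l (σ 0) (σ 1)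
  have hr : ∀ σ, ContinuousOn (r σ) (overlap (fun p => V p ∩ A.U p) σ) := fun σ =>
    (hl _ _).mono fun x hx => ⟨mem_overlap.1 (hov σ hx) 0, mem_overlap.1 (hov σ hx) 1⟩
  have hri : ∀ σ, ∀ x ∈ overlap (fun p => V p ∩ A.U p) σ, ∃ j : ℤ, cechDelta r σ x = j := by
    intro σ x hx
    have hx' := mem_overlap.1 (hov σ hx)
    rw [← expU_eq_one_iff, eq_three σ, delta_one]
    change expU (l (σ 1) (σ 2) x - l (σ 0) (σ 2) x + l (σ 0) (σ 1) x) = 1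
    rw [expU_add, expU_sub, he _ _ x ⟨hx' 1, hx' 2⟩, he _ _ x ⟨hx' 0, hx' 2⟩,
      he _ _ x ⟨hx' 0, hx' 1⟩]
    refine Additive.ofMul.injective ?_
    simp only [ofMul_mul, ofMul_inv, ofMul_one]
    abel
  obtain ⟨z, hz⟩ := exists_int_cocycle hU hr hri (delta_delta_one r)
  refine ⟨cechClass z, _, _, r, z, hs, hr, fun σ x hx => ?_, hz, rfl⟩
  have hx' := mem_overlap.1 (hov σ hx)
  rw [he _ _ x ⟨hx' 0, hx' 1⟩, mul_right_comm, inv_mul_cancel, one_mul]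

lemma IsChern.mul {A B : UAtlas ℂ m M} {c d : H2 M ℤ} (h : A.IsChern c) (h' : B.IsChern d) :
    (A.mul B).IsChern (c + d) := by
  obtain ⟨U, ξ, r, z, hξ, hr, hsr, hz, rfl⟩ := h
  obtain ⟨U', ξ', r', z', hξ', hr', hsr', hz', rfl⟩ := h'
  have hV := hξ.nbhds.inter hξ'.nbhds
  have h1 := hξ.mono hV fun p => Set.inter_subset_left
  have h2 := hξ'.mono hV fun p => Set.inter_subset_right
  refine ⟨_, _, r + r', z + z', h1.mul h2, fun σ => ?_, fun σ x hx => ?_, fun σ x hx => ?_, rfl⟩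
  · exact ((hr σ).mono fun x hx => (overlap_inter hx).1).add
      ((hr' σ).mono fun x hx => (overlap_inter hx).2)
  · rw [hsr σ x (overlap_inter hx).1, hsr' σ x (overlap_inter hx).2, Pi.add_apply, Pi.add_apply,
      expU_add, mul_mul_mul_comm]
  · rw [map_add, Pi.add_apply, Pi.add_apply, hz σ x (overlap_inter hx).1,
      hz' σ x (overlap_inter hx).2]
    simp

variable [IsManifold (𝓡 m) ∞ M]

/-- With `l` a logarithm of the comparison of sections, `r' - r - δl` is integer valued and has the
same coboundary as `r' - r`. -/
lemma IsChern.eq_of_equiv {A B : UAtlas ℂ m M} {c d : H2 M ℤ} (h : A.IsChern c) (h' : B.IsChern d)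
    (hAB : A.Equiv B) : c = d := by
  obtain ⟨U, ξ, r, z, hξ, hr, hsr, hz, rfl⟩ := h
  obtain ⟨U', ξ', r', z', hξ', hr', hsr', hz', rfl⟩ := h'
  have hV := hξ.nbhds.inter hξ'.nbhds
  obtain ⟨w, hw⟩ := ((hξ.mono hV fun p => Set.inter_subset_left).equiv_iff
    (hξ'.mono hV fun p => Set.inter_subset_right)).1 hAB
  choose W hWV hWo hpW l hl he using fun p => exists_local_log (hV p).1 (hw p) (hV p).2
  have hW : IsNbhds W := fun p => ⟨hWo p, hpW p⟩
  have hov : ∀ {k : ℕ} {σ : Fin (k + 1) → M} {x}, x ∈ overlap W σ →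
      x ∈ overlap U σ ∧ x ∈ overlap U' σ := fun {k σ x} hx => overlap_inter (overlap_mono hWV σ hx)
  let g : PreCochain M ℝ 1 := fun σ x => r' σ x - r σ x - (l (σ 1) x - l (σ 0) x)
  have hg : ∀ σ, ContinuousOn (g σ) (overlap W σ) := fun σ =>
    (((hr' σ).mono fun x hx => (hov hx).2).sub ((hr σ).mono fun x hx => (hov hx).1)).sub
      (((hl (σ 1)).continuousOn.mono fun x hx => mem_overlap.1 hx 1).sub
        ((hl (σ 0)).continuousOn.mono fun x hx => mem_overlap.1 hx 0))
  have hgi : ∀ σ, ∀ x ∈ overlap W σ, ∃ j : ℤ, g σ x = j := fun σ x hx => by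
    have h1 := hsr σ x (hov hx).1
    have h2 := hsr' σ x (hov hx).2
    rw [← expU_eq_one_iff]
    simp only [g, expU_sub]
    rw [he _ x (mem_overlap.1 hx 1), he _ x (mem_overlap.1 hx 0), h1, h2]
    refine Additive.ofMul.injective ?_
    simp only [ofMul_mul, ofMul_inv, ofMul_one]
    abel
  obtain ⟨b, hb, -, hbg⟩ := exists_int_cochain (r := g) hW hg hgi
  refine cechClass_eq_iff.2 ⟨b, hb, W, hW, fun σ x hx => ?_⟩
  have h1 : ((cechDelta b σ x : ℤ) : ℝ) = cechDelta g σ x := by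
    rw [delta_congr hbg hx]
    exact (delta_map (Int.castAddHom ℝ) b σ x).symm
  have h2 : cechDelta g σ x = cechDelta r' σ x - cechDelta r σ x := by
    rw [eq_three σ, delta_one, delta_one, delta_one]
    simp only [g, Matrix.cons_val_zero, Matrix.cons_val_one]
    ring
  rw [h2, hz σ x (hov hx).1, hz' σ x (hov hx).2] at h1
  exact_mod_cast h1.symm

lemma IsChern.smooth_log {A : UAtlas ℂ m M} {U : M → Set M} {ξ : M → M → unitary ℂ}
    (hξ : A.IsSections U ξ) {r : PreCochain M ℝ 1} (hr : ∀ σ, ContinuousOn (r σ) (overlap U σ))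
    (hsr : ∀ σ, ∀ x ∈ overlap U σ, ξ (σ 1) x = expU (r σ x) * ξ (σ 0) x) (σ : Fin 2 → M) :
    ContMDiffOn (𝓡 m) 𝓘(ℝ, ℝ) ∞ (r σ) (overlap U σ) := by
  refine contMDiffOn_of_expU (isOpen_overlap hξ.nbhds σ) (hr σ) (((hξ.ratio (σ 0) (σ 1)).mono
    fun x hx => ⟨mem_overlap.1 hx 0, mem_overlap.1 hx 1⟩).congr fun x hx => ?_)
  rw [hsr σ x hx, mul_comm (expU _), inv_mul_cancel_left]

variable [T2Space M] [SecondCountableTopology M]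

/-- If the classes agree, an integral cochain `b` makes `g = r' - r - b` a smooth real cocycle.
Averaging writes it as the coboundary of `G`, and `expU (G p)` gives the equivalence. -/
lemma IsChern.equiv {A B : UAtlas ℂ m M} {c : H2 M ℤ} (h : A.IsChern c) (h' : B.IsChern c) :
    A.Equiv B := by
  obtain ⟨U, ξ, r, z, hξ, hr, hsr, hz, rfl⟩ := h
  obtain ⟨U', ξ', r', z', hξ', hr', hsr', hz', hc⟩ := h'
  obtain ⟨b, ⟨U₁, hU₁, hb⟩, U₂, hU₂, hzb⟩ := cechClass_eq_iff.1 hc.symm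
  have hV := (hξ.nbhds.inter hξ'.nbhds).inter (hU₁.inter hU₂)
  set V : M → Set M := fun p => (U p ∩ U' p) ∩ (U₁ p ∩ U₂ p) with hVdef
  have ov1 : ∀ {k : ℕ} {σ : Fin (k + 1) → M}, overlap V σ ⊆ overlap U σ := fun {k σ} =>
    overlap_mono (fun p x hx => hx.1.1) σ
  have ov2 : ∀ {k : ℕ} {σ : Fin (k + 1) → M}, overlap V σ ⊆ overlap U' σ := fun {k σ} =>
    overlap_mono (fun p x hx => hx.1.2) σ
  have ov3 : ∀ {k : ℕ} {σ : Fin (k + 1) → M}, overlap V σ ⊆ overlap U₁ σ := fun {k σ} =>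
    overlap_mono (fun p x hx => hx.2.1) σ
  have ov4 : ∀ {k : ℕ} {σ : Fin (k + 1) → M}, overlap V σ ⊆ overlap U₂ σ := fun {k σ} =>
    overlap_mono (fun p x hx => hx.2.2) σ
  refine ((hξ.mono hV fun p x hx => hx.1.1).equiv_iff (hξ'.mono hV fun p x hx => hx.1.2)).2 ?_
  let g : PreCochain M ℝ 1 := fun σ x => r' σ x - r σ x - b σ x
  have hg : ∀ σ, ContMDiffOn (𝓡 m) 𝓘(ℝ, ℝ) ∞ (g σ) (overlap V σ) := fun σ =>
    (((IsChern.smooth_log hξ' hr' hsr' σ).mono ov2).sub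
      ((IsChern.smooth_log hξ hr hsr σ).mono ov1)).sub
      (contMDiffOn_of_eventually_eq fun x hx => (hb σ x (ov3 hx)).mono fun y hy => by rw [hy])
  have hgd : ∀ p q t x, x ∈ V p → x ∈ V q → x ∈ V t → g ![p, t] x - g ![p, q] x = g ![q, t] x := by
    intro p q t x hp hq ht
    have hx : x ∈ overlap V ![p, q, t] := mem_overlap_three.2 ⟨hp, hq, ht⟩
    have h1 := hz _ x (ov1 hx)
    have h2 := hz' _ x (ov2 hx)
    have h3 : ((z'.1 ![p, q, t] x - z.1 ![p, q, t] x : ℤ) : ℝ) = (cechDelta b ![p, q, t] x : ℤ) := by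
      rw [hzb _ x (ov4 hx)]
    rw [delta_one] at h1 h2 h3
    push_cast at h3
    simp only [g]
    linarith
  obtain ⟨f, hf⟩ := exists_partition (m := m) hV
  let G : M → M → ℝ := fun p x => average f (fun i => g ![i, p] x) x
  have hG : ∀ p, ContMDiffOn (𝓡 m) 𝓘(ℝ, ℝ) ∞ (G p) (V p) := fun p =>
    average_smooth hV hf (hV p).1 fun i => (hg ![i, p]).mono fun x hx =>
      mem_overlap_two.2 ⟨hx.2, hx.1⟩
  have hGd : ∀ p q x, x ∈ V p → x ∈ V q → G q x - G p x = g ![p, q] x := fun p q x hp hq => by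
    simp only [G]
    rw [← average_sub]
    exact average_eq hf fun i hi => hgd i p q x hi hp hq
  -- The function that should equal `expU (G p) * ξ p * (ξ' p)⁻¹` on every `V p` is defined at `x`
  -- by means of the index `x` itself. The cocycle relations then give agreement for all `p`.
  refine ⟨fun x => expU (G x x) * ξ x x * (ξ' x x)⁻¹, fun p => (usm_expU (hG p)).congr fun x hx => ?_⟩
  have hxx : x ∈ V x := (hV x).2
  have hx2 : x ∈ overlap V ![p, x] := mem_overlap_two.2 ⟨hx, hxx⟩
  have h1 := hsr ![p, x] x (ov1 hx2)
  have h2 := hsr' ![p, x] x (ov2 hx2)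
  simp only [Matrix.cons_val_one, Matrix.cons_val_zero] at h1 h2
  have h3 : expU (g ![p, x] x) = expU (r' ![p, x] x) * (expU (r ![p, x] x))⁻¹ := by
    simp only [g]
    rw [expU_sub, expU_sub, expU_eq_one_iff.2 ⟨b ![p, x] x, rfl⟩, inv_one, mul_one]
  have h4 : G x x = G p x + g ![p, x] x := by rw [← hGd p x x hx hxx]; ring
  change (ξ p x)⁻¹ * ξ' p x * (expU (G x x) * ξ x x * (ξ' x x)⁻¹) = expU (G p x)
  rw [h4, expU_add, h3, h1, h2]
  refine Additive.ofMul.injective ?_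
  simp only [ofMul_mul, ofMul_inv]
  abel

lemma IsChern.eq_iff {A B : UAtlas ℂ m M} {c d : H2 M ℤ} (h : A.IsChern c) (h' : B.IsChern d) :
    c = d ↔ A.Equiv B :=
  ⟨fun e => h.equiv (e ▸ h'), fun e => h.eq_of_equiv h' e⟩

/-- Averaging the last index of an integral cocycle `z` gives smooth real `r p q` with `δr = z`. The
functions `expU (r p q)` are then the transition functions of the required bundle. -/
lemma isChern_surjective (c : H2 M ℤ) : ∃ A : UAtlas ℂ m M, A.IsChern c := by
  obtain ⟨z, rfl⟩ := QuotientAddGroup.mk_surjective c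
  obtain ⟨U, hU, hzc, hzd⟩ := exists_nbhds z
  obtain ⟨f, hf⟩ := exists_partition (m := m) hU
  let r : M → M → M → ℝ := fun p q x => average f (fun i => (z.1 ![p, q, i] x : ℝ)) x
  have hr : ∀ p q, ContMDiffOn (𝓡 m) 𝓘(ℝ, ℝ) ∞ (r p q) (U p ∩ U q) := fun p q =>
    average_smooth hU hf ((hU p).1.inter (hU q).1) fun i =>
      contMDiffOn_of_eventually_eq fun x hx =>
        (hzc ![p, q, i] x (mem_overlap_three.2 ⟨hx.1.1, hx.1.2, hx.2⟩)).mono fun y hy => by rw [hy]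
  have hd : ∀ p q t x, x ∈ U p → x ∈ U q → x ∈ U t →
      r q t x - r p t x + r p q x = z.1 ![p, q, t] x := fun p q t x hp hq ht => by
    simp only [r]
    rw [← average_sub, ← average_add]
    refine average_eq hf fun i hi => ?_
    have h1 := hzd ![p, q, t, i] x (mem_overlap_four.2 ⟨hp, hq, ht, hi⟩)
    rw [delta_two] at h1
    have h2 : ((z.1 ![q, t, i] x - z.1 ![p, t, i] x + z.1 ![p, q, i] x - z.1 ![p, q, t] x : ℤ) : ℝ) = 0 := by
      rw [h1, Int.cast_zero]
    push_cast at h2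
    linarith
  have hζ : ∀ p q x, x ∈ U p → x ∈ U q → expU (r x q x) = expU (r p q x) * expU (r x p x) := by
    intro p q x hp hq
    have h1 := hd x p q x (hU x).2 hp hq
    have h2 : r x q x = r p q x + r x p x - z.1 ![x, p, q] x := by linarith
    rw [h2, expU_sub, expU_add, expU_eq_one_iff.2 ⟨_, rfl⟩, inv_one, mul_one]
  -- The bundle is trivialised at `x` by the section with index `x`, so `ζ p x` is the transition
  -- function from the index `x` to `p`.
  let A : UAtlas ℂ m M := ⟨U, hU, fun p x => expU (r x p x), fun p q =>
    (usm_expU (hr p q)).congr fun x hx => by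
      rw [hζ p q x hx.1 hx.2, mul_comm, mul_inv_cancel_right]⟩
  refine ⟨A, U, A.ζ, fun σ => r (σ 0) (σ 1), z, ⟨hU, fun p => subset_rfl, fun p =>
    (usm_const 1).congr fun x _ => inv_mul_cancel _⟩, fun σ => (hr _ _).continuousOn.mono
      fun x hx => ⟨mem_overlap.1 hx 0, mem_overlap.1 hx 1⟩, fun σ x hx =>
      hζ _ _ x (mem_overlap.1 hx 0) (mem_overlap.1 hx 1), fun σ x hx => ?_, rfl⟩
  have hx' := mem_overlap.1 hx
  rw [eq_three σ, delta_one]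
  exact hd _ _ _ x (hx' 0) (hx' 1) (hx' 2)

end UAtlas

end Chern

/-! ### Signs and the first Stiefel–Whitney class of an atlas -/

section Sign

/-- The sign `(-1)ᵃ` as a real number of absolute value one. -/
def signU (a : ZMod 2) : unitary ℝ :=
  ⟨(-1) ^ a.val, norm_eq_one_iff_mem_unitary.1 (by simp)⟩

lemma coe_signU (a : ZMod 2) : (signU a : ℝ) = (-1) ^ a.val := rfl

lemma zmod_two_cases (a : ZMod 2) : a = 0 ∨ a = 1 := by
  revert a; decide

lemma coe_signU_zero : (signU 0 : ℝ) = 1 := by simp [coe_signU]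

lemma coe_signU_one : (signU 1 : ℝ) = -1 := by simp [coe_signU, ZMod.val_one]

lemma signU_zero : signU 0 = 1 := Subtype.ext coe_signU_zero

lemma signU_add (a b : ZMod 2) : signU (a + b) = signU a * signU b := by
  refine Subtype.ext ?_
  have h : (1 : ZMod 2) + 1 = 0 := by decide
  rcases zmod_two_cases a with rfl | rfl <;> rcases zmod_two_cases b with rfl | rfl <;>
    simp [coe_signU_zero, coe_signU_one, h]

lemma signU_neg (a : ZMod 2) : signU (-a) = (signU a)⁻¹ :=
  eq_inv_of_mul_eq_one_left (by rw [← signU_add, neg_add_cancel, signU_zero])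

lemma signU_sub (a b : ZMod 2) : signU (a - b) = signU a * (signU b)⁻¹ := by
  rw [sub_eq_add_neg, signU_add, signU_neg]

lemma signU_eq_one_iff {a : ZMod 2} : signU a = 1 ↔ a = 0 := by
  constructor
  · intro h
    rcases zmod_two_cases a with rfl | rfl
    · rfl
    · have := congrArg Subtype.val h
      rw [coe_signU_one] at this
      norm_num at this
  · rintro rfl
    exact signU_zero

lemma signU_injective : Function.Injective signU := fun a b h =>
  sub_eq_zero.1 (signU_eq_one_iff.1 (by rw [signU_sub, h, mul_inv_cancel]))

lemma exists_signU (z : unitary ℝ) : ∃ a, signU a = z := by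
  have h : |(z : ℝ)| = 1 := norm_eq_one_iff_mem_unitary.2 z.2
  rcases eq_or_eq_neg_of_abs_eq h with h | h
  · exact ⟨0, Subtype.ext (by rw [coe_signU_zero, h])⟩
  · exact ⟨1, Subtype.ext (by rw [coe_signU_one, h])⟩

lemma eventually_eq_of_signU {X : Type*} [TopologicalSpace X] {a : X → ZMod 2} {O : Set X}
    (hO : IsOpen O) (h : ContinuousOn (fun x => (signU (a x) : ℝ)) O) {x : X} (hx : x ∈ O) :
    ∀ᶠ y in 𝓝 x, a y = a x := by
  have h1 := (h.continuousAt (hO.mem_nhds hx)).eventually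
    (Metric.ball_mem_nhds (signU (a x) : ℝ) one_pos)
  filter_upwards [h1] with y hy
  rw [Real.dist_eq] at hy
  rcases zmod_two_cases (a x) with hx0 | hx0 <;> rcases zmod_two_cases (a y) with hy0 | hy0 <;>
    rw [hx0, hy0] at hy ⊢ <;> rw [coe_signU_zero, coe_signU_one] at hy <;> norm_num at hy

end Sign

/-! ### Classification of bundles with group `{±1}` by the first Stiefel–Whitney class. -/

section SW

open LineBundle

variable {m : ℕ} {M : Type*} [TopologicalSpace M] [ChartedSpace (Eu m) M]

lemma usm_signU {a : M → ZMod 2} {O : Set M} (h : ∀ x ∈ O, ∀ᶠ y in 𝓝 x, a y = a x) :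
    USm m (fun x => signU (a x)) O :=
  contMDiffOn_of_eventually_eq fun x hx => (h x hx).mono fun y hy => by simp only [hy]

/-- The first Stiefel–Whitney class of a bundle with group `{±1}`. -/
def UAtlas.IsSW1 (A : UAtlas ℝ m M) (c : H1 M (ZMod 2)) : Prop :=
  ∃ (U : M → Set M) (ξ : M → M → unitary ℝ) (z : cechZ M (ZMod 2) 1), A.IsSections U ξ ∧
    (∀ σ, ∀ x ∈ overlap U σ, ξ (σ 1) x = signU (z.1 σ x) * ξ (σ 0) x) ∧ cechClass z = c

lemma IsAt.isSW1_iff [IsManifold (𝓡 m) ∞ M] {N : LineBundle ℝ m M} {A : UAtlas ℝ m M}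
    (hA : IsAt N A) (c : H1 M (ZMod 2)) : IsSW1 N c ↔ A.IsSW1 c := by
  obtain ⟨μ, w, hw, hA⟩ := hA
  constructor
  · rintro ⟨U, s, z, hU, hs, hsz, rfl⟩
    obtain ⟨ξ, hξ, hξs⟩ := exists_isSections μ hw hA hU hs
    refine ⟨_, ξ, z, hξ, fun σ x hx => ?_, rfl⟩
    have hx1 : x ∈ overlap U σ := overlap_mono (fun p => Set.inter_subset_left) σ hx
    have hx' := mem_overlap.1 hx1
    obtain ⟨g, hg, h⟩ := hsz σ x hx1
    have h1 := congrArg μ.normalize h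
    rw [μ.normalize_smul, hξs _ x (hx' 1), hξs _ x (hx' 0), smul_smul] at h1
    refine Subtype.ext (smul_left_injective ℝ (μ.ne_zero (hw x)) (h1.trans ?_))
    simp only [MulMemClass.coe_mul, coe_signU]
    congr 2
    rw [norm_mul, norm_pow, norm_neg, norm_one, one_pow, one_mul, Real.norm_eq_abs, abs_of_pos hg]
    simp only [RCLike.ofReal_real_eq_id, id]
    rw [mul_inv_cancel_right₀ hg.ne']
  · rintro ⟨U, ξ, z, hξ, hsz, rfl⟩
    refine ⟨U, fun p x => (ξ p x : ℝ) • w x, z, hξ.nbhds, fun p => ⟨hξ.isAt_smooth hA p,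
      fun x _ => smul_ne_zero (coe_unitary_ne_zero _) (μ.ne_zero (hw x))⟩,
      fun σ x hx => ⟨1, one_pos, ?_⟩, rfl⟩
    simp only
    rw [hsz σ x hx, MulMemClass.coe_mul, mul_smul, coe_signU, mul_one]

namespace UAtlas

/-- The group `{±1}` is discrete, so the ratios of sections are locally constant and form a cocycle
on the given cover. Neither logarithms nor refinements are needed. -/
lemma exists_isSW1 (A : UAtlas ℝ m M) : ∃ c, A.IsSW1 c := by
  choose a ha using fun (σ : Fin 2 → M) x => exists_signU ((A.ζ (σ 0) x)⁻¹ * A.ζ (σ 1) x)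
  have hs : A.IsSections A.U A.ζ := ⟨A.nbhds, fun p => subset_rfl, fun p =>
    (usm_const 1).congr fun x _ => inv_mul_cancel _⟩
  have h1 : ∀ σ, ∀ x ∈ overlap A.U σ, ∀ᶠ y in 𝓝 x, a σ y = a σ x := fun σ x hx => by
    refine eventually_eq_of_signU (isOpen_overlap A.nbhds σ) ?_ hx
    have h2 := (A.smooth (σ 0) (σ 1)).mono fun x (hx : x ∈ overlap A.U σ) =>
      ⟨mem_overlap.1 hx 0, mem_overlap.1 hx 1⟩
    exact (h2.congr fun x _ => ha σ x).continuousOn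
  refine ⟨_, A.U, A.ζ, mkCocycle a A.nbhds h1 fun σ x hx => signU_injective ?_, hs,
    fun σ x hx => ?_, rfl⟩
  · rw [eq_three σ, delta_one, signU_add, signU_sub, ha, ha, ha, signU_zero]
    simp only [Matrix.cons_val_zero, Matrix.cons_val_one]
    refine Additive.ofMul.injective ?_
    simp only [ofMul_mul, ofMul_inv, ofMul_one]
    abel
  · change _ = signU (a σ x) * _
    rw [ha, mul_right_comm, inv_mul_cancel, one_mul]

lemma IsSW1.mul {A B : UAtlas ℝ m M} {c d : H1 M (ZMod 2)} (h : A.IsSW1 c) (h' : B.IsSW1 d) :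
    (A.mul B).IsSW1 (c + d) := by
  obtain ⟨U, ξ, z, hξ, hsz, rfl⟩ := h
  obtain ⟨U', ξ', z', hξ', hsz', rfl⟩ := h'
  have hV := hξ.nbhds.inter hξ'.nbhds
  refine ⟨_, _, z + z', (hξ.mono hV fun p => Set.inter_subset_left).mul
    (hξ'.mono hV fun p => Set.inter_subset_right), fun σ x hx => ?_, rfl⟩
  rw [hsz σ x (overlap_inter hx).1, hsz' σ x (overlap_inter hx).2, AddSubgroup.coe_add,
    Pi.add_apply, Pi.add_apply, signU_add, mul_mul_mul_comm]

/-- A cochain with coboundary `z' - z` and a comparison of sections are the same data under `signU`.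
As for `IsChern.equiv`, the global function is defined at `x` through the index `x`. -/
lemma IsSW1.eq_iff {A B : UAtlas ℝ m M} {c d : H1 M (ZMod 2)} (h : A.IsSW1 c) (h' : B.IsSW1 d) :
    c = d ↔ A.Equiv B := by
  obtain ⟨U, ξ, z, hξ, hsz, rfl⟩ := h
  obtain ⟨U', ξ', z', hξ', hsz', rfl⟩ := h'
  constructor
  · intro hc
    obtain ⟨b, ⟨U₁, hU₁, hb⟩, U₂, hU₂, hzb⟩ := cechClass_eq_iff.1 hc
    have hV := (hξ.nbhds.inter hξ'.nbhds).inter (hU₁.inter hU₂)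
    refine ((hξ.mono hV fun p x hx => hx.1.1).equiv_iff (hξ'.mono hV fun p x hx => hx.1.2)).2
      ⟨fun x => signU (b ![x] x) * ξ x x * (ξ' x x)⁻¹, fun p => ?_⟩
    refine (usm_signU (a := fun x => b ![p] x) fun x hx => hb ![p] x (mem_overlap.2 fun i => ?_)).congr
      fun x hx => ?_
    · fin_cases i; exact hx.2.1
    have hxx := (hV x).2
    have h1 := hsz ![p, x] x (mem_overlap_two.2 ⟨hx.1.1, hxx.1.1⟩)
    have h2 := hsz' ![p, x] x (mem_overlap_two.2 ⟨hx.1.2, hxx.1.2⟩)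
    have h3 := hzb ![p, x] x (mem_overlap_two.2 ⟨hx.2.2, hxx.2.2⟩)
    rw [delta_zero] at h3
    simp only [Matrix.cons_val_zero, Matrix.cons_val_one] at h1 h2
    have h4 : b ![x] x = b ![p] x + z'.1 ![p, x] x - z.1 ![p, x] x := by
      rw [add_sub_assoc, h3]; abel
    simp only
    rw [h4, signU_sub, signU_add, h1, h2]
    refine Additive.ofMul.injective ?_
    simp only [ofMul_mul, ofMul_inv]
    abel
  · intro hAB
    have hV := hξ.nbhds.inter hξ'.nbhds
    obtain ⟨w, hw⟩ := ((hξ.mono hV fun p => Set.inter_subset_left).equiv_iff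
      (hξ'.mono hV fun p => Set.inter_subset_right)).1 hAB
    choose l hl using fun p x => exists_signU ((ξ p x)⁻¹ * ξ' p x * w x)
    refine cechClass_eq_iff.2 ⟨fun σ => l (σ 0), ⟨_, hV, fun σ x hx => ?_⟩, _, hV,
      fun σ x hx => signU_injective ?_⟩
    · exact eventually_eq_of_signU (hV (σ 0)).1
        ((hw (σ 0)).congr fun x _ => hl (σ 0) x).continuousOn (mem_overlap.1 hx 0)
    · have h1 := hsz σ x (overlap_inter hx).1
      have h2 := hsz' σ x (overlap_inter hx).2
      have h3 : cechDelta (fun σ : Fin 1 → M => l (σ 0)) σ x = l (σ 1) x - l (σ 0) x := by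
        conv_lhs => rw [eq_two σ]
        exact delta_zero _ _ _ _
      rw [h3, signU_sub, signU_sub, hl, hl, h1, h2]
      refine Additive.ofMul.injective ?_
      simp only [ofMul_mul, ofMul_inv]
      abel

lemma isSW1_surjective (c : H1 M (ZMod 2)) : ∃ A : UAtlas ℝ m M, A.IsSW1 c := by
  obtain ⟨z, rfl⟩ := QuotientAddGroup.mk_surjective c
  obtain ⟨U, hU, hzc, hzd⟩ := exists_nbhds z
  have hd : ∀ p q x, x ∈ U p → x ∈ U q →
      signU (z.1 ![x, q] x) = signU (z.1 ![p, q] x) * signU (z.1 ![x, p] x) := by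
    intro p q x hp hq
    have h1 := hzd ![x, p, q] x (mem_overlap_three.2 ⟨(hU x).2, hp, hq⟩)
    rw [delta_one] at h1
    rw [← signU_add]
    congr 1
    rw [← sub_eq_zero, ← neg_eq_zero, ← h1]
    abel
  let A : UAtlas ℝ m M := ⟨U, hU, fun p x => signU (z.1 ![x, p] x), fun p q =>
    (usm_signU fun x hx => hzc ![p, q] x (mem_overlap_two.2 hx)).congr fun x hx => by
      rw [hd p q x hx.1 hx.2, mul_comm, mul_inv_cancel_right]⟩
  refine ⟨A, U, A.ζ, z, ⟨hU, fun p => subset_rfl, fun p =>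
    (usm_const 1).congr fun x _ => inv_mul_cancel _⟩, fun σ x hx => ?_, rfl⟩
  have h := hd (σ 0) (σ 1) x (mem_overlap.1 hx 0) (mem_overlap.1 hx 1)
  rw [← eq_two σ] at h
  exact h

end UAtlas

end SW

/-! ### The simply transitive action -/

section Parametrisation

namespace UAtlas

variable {m : ℕ} {M : Type*} [TopologicalSpace M] [ChartedSpace (Eu m) M] {K : Type} [RCLike K]

lemma Equiv.refl (A : UAtlas K m M) : A.Equiv A :=
  equiv_of_diag A.nbhds (h := fun _ => 1) fun p => (usm_const 1).congr fun x _ => by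
    rw [inv_mul_cancel, mul_one]

lemma mul_one_equiv (A : UAtlas K m M) : (A.mul one).Equiv A :=
  equiv_of_diag A.nbhds (h := fun _ => 1) fun p => (usm_const 1).congr fun x _ => by
    simp [mul, one]

lemma one_mul_equiv (A : UAtlas K m M) : (one.mul A).Equiv A :=
  equiv_of_diag A.nbhds (h := fun _ => 1) fun p => (usm_const 1).congr fun x _ => by
    simp [mul, one]

lemma equiv_one_of_mul_equiv {A B : UAtlas K m M} (h : (A.mul B).Equiv A) : B.Equiv one := by
  obtain ⟨h, hh⟩ := h
  refine equiv_of_diag (A.mul B).nbhds (h := h) fun p =>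
    ((hh p p).mono fun x hx => ⟨hx, hx.1⟩).congr fun x _ => ?_
  simp [mul, one]

end UAtlas

variable {m n : ℕ} {M : Type*} [TopologicalSpace M] [ChartedSpace (Eu m) M]
  {E : M → Type*} [TopologicalSpace (TotalSpace (Eu n) E)]
  [∀ x, NormedAddCommGroup (E x)] [∀ x, InnerProductSpace ℝ (E x)]
  [FiberBundle (Eu n) E] {o : ∀ x, Orientation ℝ (E x) (Fin n)}
  {K : Type} [RCLike K] {V : Type} [AddCommGroup V] [Module K V]
  {ρ : Representation K (spinK K n) V} [VectorBundle ℝ (Eu n) E] [IsManifold (𝓡 m) ∞ M]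
  [ContMDiffVectorBundle ∞ (Eu n) E (𝓡 m)] [IsContMDiffRiemannianBundle (𝓡 m) ∞ (Eu n) E]

/-- If `S'` and `S''` both differ from `S` by `A`, their own difference `D` satisfies `A D ≅ A`, so
`D` is trivial. -/
lemma IsDiff.isIso_iff (hn : 0 < n) (ho : IsOrientation o) (hρ : IsSpinRep ρ)
    {S S' S'' : SpinorModule m o ρ} {A : UAtlas K m M} (h : IsDiff S S' A) :
    IsDiff S S'' A ↔ S'.IsIso S'' := by
  constructor
  · intro h'
    obtain ⟨D, hD⟩ := exists_isDiff hn ho hρ S' S''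
    refine (isIso_iff_isDiff hρ).2 ((hD.iff_equiv hn ho).2 ?_)
    exact UAtlas.equiv_one_of_mul_equiv (((h.mul hD).iff_equiv hn ho).1 h')
  · intro h'
    exact ((h.mul ((isIso_iff_isDiff hρ).1 h')).iff_equiv hn ho).2 A.mul_one_equiv

lemma IsDiff.of_isIso (hn : 0 < n) (ho : IsOrientation o) (hρ : IsSpinRep ρ)
    {S S' S'' : SpinorModule m o ρ} {A : UAtlas K m M} (h : S.IsIso S') (h' : IsDiff S' S'' A) :
    IsDiff S S'' A :=
  ((((isIso_iff_isDiff hρ).1 h).mul h').iff_equiv hn ho).2 A.one_mul_equiv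

/-- A characteristic class that classifies bundles with group the scalars of absolute value one and
takes products to sums. -/
structure IsClassifying {H : Type*} [AddCommGroup H] (C : UAtlas K m M → H → Prop) : Prop where
  exists_class : ∀ A, ∃ c, C A c
  eq_iff : ∀ {A B : UAtlas K m M} {c d : H}, C A c → C B d → (c = d ↔ A.Equiv B)
  surjective : ∀ c, ∃ A, C A c
  mul : ∀ {A B : UAtlas K m M} {c d : H}, C A c → C B d → C (A.mul B) (c + d)

lemma IsClassifying.one {H : Type*} [AddCommGroup H] {C : UAtlas K m M → H → Prop}
    (hC : IsClassifying C) : C UAtlas.one 0 := by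
  obtain ⟨c, hc⟩ := hC.exists_class UAtlas.one
  have h := (hC.eq_iff (hC.mul hc hc) hc).2 (UAtlas.mul_one_equiv _)
  rw [add_eq_left] at h
  rwa [h] at hc

variable [T2Space M] [SecondCountableTopology M]

/-- Line bundles, tensor products and classes all translate into statements about atlases, where
they reduce to the properties of differences and of `C`. -/
lemma IsClassifying.parametrisedBy (hn : 0 < n) (ho : IsOrientation o) (hρ : IsSpinRep ρ)
    {H : Type*} [AddCommGroup H] {C : UAtlas K m M → H → Prop} (hC : IsClassifying C)
    {cls : LineBundle K m M → H → Prop}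
    (hcls : ∀ {N : LineBundle K m M} {A : UAtlas K m M}, IsAt N A → ∀ c, cls N c ↔ C A c) :
    ParametrisedBy m o ρ cls := by
  choose B hB using hC.surjective
  have hBA : ∀ {A : UAtlas K m M} {c : H} {S S' : SpinorModule m o ρ}, C A c →
      (IsDiff S S' (B c) ↔ IsDiff S S' A) := fun {A c S S'} hA => by
    have h := (hC.eq_iff (hB c) hA).1 rfl
    exact ⟨fun h' => (h'.iff_equiv hn ho).2 h, fun h' => (h'.iff_equiv hn ho).2 h.symm⟩
  -- The class `c` acts by twisting with a chosen representative `B c`. By `hBA` the choice does not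
  -- matter up to isomorphism.
  let v : H → SpinorClasses m o ρ → SpinorClasses m o ρ := fun c =>
    Quot.map (fun S => S.twist hn hρ (B c)) fun S S' h =>
      ((isDiff_twist hn hρ S (B c)).isIso_iff hn ho hρ).1
        (.of_isIso hn ho hρ h (isDiff_twist hn hρ S' (B c)))
  have hv : ∀ {A : UAtlas K m M} {c : H} {S S' : SpinorModule m o ρ}, C A c →
      (v c S.toClass = S'.toClass ↔ IsDiff S S' A) := fun {A c S S'} hA => by
    rw [← hBA hA, (isDiff_twist hn hρ S (B c)).isIso_iff hn ho hρ, ← toClass_eq_iff hn ho hρ]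
    rfl
  refine ⟨⟨canonicalModule m o hn hρ⟩, fun S N => ?_, fun S N S' S'' h => ?_, fun S₁ S₂ => ?_,
    fun S₁ S₂ N N' h => ?_, fun N => ?_, fun c => ?_, fun N N' c c' h h' => ?_, ?_⟩
  · obtain ⟨A, hA⟩ := exists_isAt N
    exact ⟨_, (hA.isTensor_iff hn hρ).2 (isDiff_twist hn hρ S A)⟩
  · obtain ⟨A, hA⟩ := exists_isAt N
    rw [hA.isTensor_iff hn hρ] at h ⊢
    exact h.isIso_iff hn ho hρ
  · obtain ⟨A, hA⟩ := exists_isDiff hn ho hρ S₁ S₂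
    exact ⟨A.lineBundle, ((isAt_lineBundle A).isTensor_iff hn hρ).2 hA⟩
  · obtain ⟨A, hA⟩ := exists_isAt N
    obtain ⟨A', hA'⟩ := exists_isAt N'
    rw [hA.isTensor_iff hn hρ] at h
    rw [hA'.isTensor_iff hn hρ, hA.isIso_iff hA']
    exact h.iff_equiv hn ho
  · obtain ⟨A, hA⟩ := exists_isAt N
    obtain ⟨c, hc⟩ := hC.exists_class A
    exact ⟨c, (hcls hA c).2 hc, fun d hd => (hC.eq_iff ((hcls hA d).1 hd) hc).2 (.refl A)⟩
  · obtain ⟨A, hA⟩ := hC.surjective c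
    exact ⟨A.lineBundle, (hcls (isAt_lineBundle A) c).2 hA⟩
  · obtain ⟨A, hA⟩ := exists_isAt N
    obtain ⟨A', hA'⟩ := exists_isAt N'
    rw [hA.isIso_iff hA']
    exact hC.eq_iff ((hcls hA c).1 h) ((hcls hA' c').1 h')
  · refine ⟨{ vadd := v, zero_vadd := fun a => ?_, add_vadd := fun c d a => ?_ },
      fun c S S' => ?_, fun a b => ?_⟩
    · obtain ⟨S, rfl⟩ := Quot.exists_rep a
      -- Twisting by `d` and then by `c` gives a difference of class `d + c`, and commutativity
      -- adapts it to the order in the law of an action.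
      refine (hv (S' := (S.twist hn hρ (B d)).twist hn hρ (B c))
        (add_comm d c ▸ hC.mul (hB d) (hB c))).2 ?_
      exact (isDiff_twist hn hρ S (B d)).mul (isDiff_twist hn hρ _ (B c))
    · obtain ⟨S, rfl⟩ := Quot.exists_rep a
      exact (hv hC.one).2 ((isIso_iff_isDiff hρ).1 (isIso_refl hρ S))
    · refine (hv (hB c)).trans ⟨fun h => ⟨(B c).lineBundle, (hcls (isAt_lineBundle _) c).2 (hB c),
        ((isAt_lineBundle _).isTensor_iff hn hρ).2 h⟩, ?_⟩
      rintro ⟨N, hN, h⟩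
      obtain ⟨A, hA⟩ := exists_isAt N
      exact (hBA ((hcls hA c).1 hN)).2 ((hA.isTensor_iff hn hρ).1 h)
    · obtain ⟨S, rfl⟩ := Quot.exists_rep a
      obtain ⟨S', rfl⟩ := Quot.exists_rep b
      obtain ⟨A, hA⟩ := exists_isDiff hn ho hρ S S'
      obtain ⟨c, hc⟩ := hC.exists_class A
      refine ⟨c, (hv hc).2 hA, fun d hd => ?_⟩
      exact (hC.eq_iff (hB d) hc).2 ((((hv (hB d)).1 hd).iff_equiv hn ho).1 hA)

lemma isClassifying_isChern : IsClassifying (UAtlas.IsChern (m := m) (M := M)) where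
  exists_class := UAtlas.exists_isChern
  eq_iff := UAtlas.IsChern.eq_iff
  surjective := UAtlas.isChern_surjective
  mul := UAtlas.IsChern.mul

lemma isClassifying_isSW1 : IsClassifying (UAtlas.IsSW1 (m := m) (M := M)) where
  exists_class := UAtlas.exists_isSW1
  eq_iff := UAtlas.IsSW1.eq_iff
  surjective := UAtlas.isSW1_surjective
  mul := UAtlas.IsSW1.mul

end Parametrisation

/-! ### The Bockstein homomorphism -/

section Bockstein

variable {X : Type*} [TopologicalSpace X]

lemma delta_eventually_eq {A : Type*} [AddCommGroup A] {k : ℕ} {c : PreCochain X A k} {U : X → Set X}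
    (hc : ∀ σ, ∀ x ∈ overlap U σ, ∀ᶠ y in 𝓝 x, c σ y = c σ x) (σ : Fin (k + 2) → X) {x : X}
    (hx : x ∈ overlap U σ) : ∀ᶠ y in 𝓝 x, cechDelta c σ y = cechDelta c σ x := by
  have h : ∀ i : Fin (k + 2), ∀ᶠ y in 𝓝 x,
      c (fun j => σ (i.succAbove j)) y = c (fun j => σ (i.succAbove j)) x := fun i =>
    hc _ x (mem_overlap.2 fun j => mem_overlap.1 hx _)
  filter_upwards [Filter.eventually_all.2 h] with y hy
  rw [delta_apply, delta_apply]
  exact Finset.sum_congr rfl fun i _ => by rw [hy i]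

/-- The representative `0` or `1` of a residue class modulo two. -/
def zlift (a : ZMod 2) : ℤ := a.val

lemma zlift_cast (a : ZMod 2) : ((zlift a : ℤ) : ZMod 2) = a := by
  rw [zlift, Int.cast_natCast, ZMod.natCast_zmod_val]

lemma delta_two_mul {k : ℕ} (c : PreCochain X ℤ k) (σ : Fin (k + 2) → X) (x : X) :
    cechDelta (fun σ x => 2 * c σ x) σ x = 2 * cechDelta c σ x :=
  delta_map (AddMonoidHom.mulLeft 2) c σ x

/-- The coboundary of the lift with values `0` and `1` is even because `c` is a cocycle modulo two.
Half of it is closed, since twice its coboundary vanishes in `ℤ`. -/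
lemma exists_integral_lift (c : cechZ X (ZMod 2) 2) : ∃ (U : X → Set X) (z : cechZ X ℤ 3), IsNbhds U ∧
    (∀ σ, ∀ x ∈ overlap U σ, ∀ᶠ y in 𝓝 x, c.1 σ y = c.1 σ x) ∧
    ∀ σ, ∀ x ∈ overlap U σ, cechDelta (fun σ x => zlift (c.1 σ x)) σ x = 2 * z.1 σ x := by
  obtain ⟨U, hU, hc, hd⟩ := exists_nbhds c
  let b : PreCochain X ℤ 2 := fun σ x => zlift (c.1 σ x)
  have hb : ∀ σ, ∀ x ∈ overlap U σ, ∀ᶠ y in 𝓝 x, b σ y = b σ x := fun σ x hx =>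
    (hc σ x hx).mono fun y hy => by simp only [b, hy]
  have heven : ∀ σ, ∀ x ∈ overlap U σ, cechDelta b σ x = 2 * (cechDelta b σ x / 2) := by
    intro σ x hx
    refine (Int.mul_ediv_cancel' ((ZMod.intCast_zmod_eq_zero_iff_dvd _ 2).1 ?_)).symm
    rw [← hd σ x hx]
    have h := delta_map (Int.castAddHom (ZMod 2)) b σ x
    have h' : (fun σ x => Int.castAddHom (ZMod 2) (b σ x)) = c.1 := by
      ext σ x
      exact zlift_cast _
    rw [h'] at h
    exact h.symm
  refine ⟨U, mkCocycle (fun σ x => cechDelta b σ x / 2) hU (fun σ x hx =>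
    (delta_eventually_eq hb σ hx).mono fun y hy => by simp only [hy]) fun σ x hx => ?_, hU, hc, heven⟩
  have h1 := delta_two_mul (fun σ x => cechDelta b σ x / 2) σ x
  rw [← delta_congr heven hx, delta_delta_two] at h1
  exact (mul_eq_zero.1 h1.symm).resolve_left two_ne_zero

/-- For lifts `b`, `b'` of cohomologous cocycles and an integral lift `ε` of the cochain joining
them, `b' - b - δε` is even. Half of it has coboundary `z' - z`. -/
lemma IsBockstein.unique {w : H2 X (ZMod 2)} {d d' : H3 X ℤ} (h : IsBockstein w d)
    (h' : IsBockstein w d') : d = d' := by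
  obtain ⟨U, b, c, z, hU, ⟨U₁, hU₁, hb⟩, hc, rfl, hbc, hbz⟩ := h
  obtain ⟨U', b', c', z', hU', ⟨U₁', hU₁', hb'⟩, hc', rfl, hbc', hbz'⟩ := h'
  obtain ⟨e, ⟨U₂, hU₂, he⟩, U₃, hU₃, hce⟩ := cechClass_eq_iff.1 (hc.trans hc'.symm)
  have hV := ((hU.inter hU').inter (hU₁.inter hU₁')).inter (hU₂.inter hU₃)
  set V : X → Set X := fun p => ((U p ∩ U' p) ∩ (U₁ p ∩ U₁' p)) ∩ (U₂ p ∩ U₃ p)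
  let ε : PreCochain X ℤ 1 := fun σ x => zlift (e σ x)
  let f : PreCochain X ℤ 2 := fun σ x => b' σ x - b σ x - cechDelta ε σ x
  have hf : ∀ σ, ∀ x ∈ overlap V σ, ∀ᶠ y in 𝓝 x, f σ y = f σ x := fun σ x hx => by
    obtain ⟨hx1, hx2⟩ := overlap_inter hx
    have hx3 := overlap_inter (overlap_inter hx1).2
    have h1 : ∀ᶠ y in 𝓝 x, cechDelta ε σ y = cechDelta ε σ x :=
      delta_eventually_eq (fun σ x hx => (he σ x hx).mono fun y hy => by simp only [ε, hy]) σ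
        (overlap_inter hx2).1
    filter_upwards [hb σ x hx3.1, hb' σ x hx3.2, h1] with y h1 h2 h3
    simp only [f, h1, h2, h3]
  have heven : ∀ σ, ∀ x ∈ overlap V σ, f σ x = 2 * (f σ x / 2) := fun σ x hx => by
    obtain ⟨hx1, hx2⟩ := overlap_inter hx
    have hx3 := overlap_inter (overlap_inter hx1).1
    refine (Int.mul_ediv_cancel' ((ZMod.intCast_zmod_eq_zero_iff_dvd _ 2).1 ?_)).symm
    have h := delta_map (Int.castAddHom (ZMod 2)) ε σ x
    have h' : (fun σ x => Int.castAddHom (ZMod 2) (ε σ x)) = e := by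
      ext σ x
      exact zlift_cast _
    rw [h'] at h
    simp only [f, Int.cast_sub]
    rw [hbc' σ x hx3.2, hbc σ x hx3.1, hce σ x (overlap_inter hx2).2, h]
    exact sub_self _
  refine cechClass_eq_iff.2 ⟨fun σ x => f σ x / 2, ⟨V, hV, fun σ x hx =>
    (hf σ x hx).mono fun y hy => by simp only [hy]⟩, V, hV, fun σ x hx => ?_⟩
  have hx3 := overlap_inter (overlap_inter (overlap_inter hx).1).1
  have h1 := delta_two_mul (fun σ x => f σ x / 2) σ x
  rw [← delta_congr heven hx] at h1
  have h2 : cechDelta f σ x = cechDelta b' σ x - cechDelta b σ x - cechDelta (cechDelta ε) σ x := by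
    have : f = b' - b - cechDelta ε := rfl
    rw [this, map_sub, map_sub]
    rfl
  rw [h2, delta_delta_one, hbz σ x hx3.1, hbz' σ x hx3.2] at h1
  omega

end Bockstein

/-! ### Uniqueness of classes defined by logarithms of `U(1)`-valued cocycles -/

section Logarithm

variable {m : ℕ} {M : Type*} [TopologicalSpace M] [ChartedSpace (Eu m) M] [T2Space M]
  [SecondCountableTopology M]

/-- With logarithms `l` of `lam`, the cochain `ρ - δl` would be integral with coboundary `δρ`, as
wanted. Since logarithms exist only after reindexing by `τ`, they have to be corrected. -/
lemma cechClass_eq_of_log {U : M → Set M} (hU : IsNbhds U) {lam : M → M → M → unitary ℂ}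
    (hl : ∀ p q, USm m (lam p q) (U p ∩ U q)) {ρ : PreCochain M ℝ 2}
    (hρ : ∀ σ, ContinuousOn (ρ σ) (overlap U σ))
    (hlam : ∀ p q t x, x ∈ U p → x ∈ U q → x ∈ U t →
      lam p q x * lam q t x = lam p t x * expU (ρ ![p, q, t] x))
    {z z' : cechZ M ℤ 3}
    (hz : ∀ σ, ∀ x ∈ overlap U σ, cechDelta ρ σ x = ((z'.1 σ x - z.1 σ x : ℤ) : ℝ)) :
    cechClass z = cechClass z' := by
  have := ChartedSpace.locallyCompactSpace (Eu m) M
  obtain ⟨τ, V, hV, hVU, hVP⟩ := exists_refinement hU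
    (P := fun p q W => ∃ l : M → ℝ, ContinuousOn l W ∧ ∀ x ∈ W, expU (l x) = lam p q x)
    (fun p q W W' hW ⟨l, h1, h2⟩ => ⟨l, h1.mono hW, fun x hx => h2 x (hW hx)⟩)
    (fun p q x hx => by
      obtain ⟨W, -, h1, h2, l, h3, h4⟩ := exists_local_log ((hU p).1.inter (hU q).1) (hl p q) hx
      exact ⟨W, h1, h2, l, h3.continuousOn, h4⟩)
  have hlog : ∀ p q, ∃ l : M → ℝ, ContinuousOn l (V p ∩ V q) ∧
      ∀ x ∈ V p ∩ V q, expU (l x) = lam (τ p) (τ q) x := fun p q => by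
    by_cases h : (V p ∩ V q).Nonempty
    · obtain ⟨l, h1, h2⟩ := hVP p q h
      exact ⟨l, h1.mono Set.inter_subset_left, fun x hx => h2 x hx.1⟩
    · rw [Set.not_nonempty_iff_eq_empty] at h
      rw [h]
      exact ⟨0, continuousOn_empty _, fun x hx => absurd hx (Set.notMem_empty x)⟩
  choose l hlc hle using hlog
  have hW := hV.inter hU
  set W : M → Set M := fun p => V p ∩ U p
  -- The terms in `ρ` convert the logarithm of `lam (τ p) (τ q)` into one of `lam p q` times the
  -- factors `(lam p (τ p))⁻¹` and `lam q (τ q)`. These factors cancel in the coboundary.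
  let k : PreCochain M ℝ 1 := fun σ x => l (σ 0) (σ 1) x - ρ ![σ 0, τ (σ 0), τ (σ 1)] x +
    ρ ![σ 0, σ 1, τ (σ 1)] x
  have hk : ∀ σ, ContinuousOn (k σ) (overlap W σ) := fun σ => by
    refine (((hlc _ _).mono fun x hx => ?_).sub ((hρ _).mono fun x hx => ?_)).add
      ((hρ _).mono fun x hx => ?_) <;> have h0 := mem_overlap.1 hx 0 <;> have h1 := mem_overlap.1 hx 1
    · exact ⟨h0.1, h1.1⟩
    · exact mem_overlap_three.2 ⟨h0.2, hVU _ h0.1, hVU _ h1.1⟩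
    · exact mem_overlap_three.2 ⟨h0.2, h1.2, hVU _ h1.1⟩
  have hkl : ∀ p q x, x ∈ W p → x ∈ W q →
      expU (k ![p, q] x) = lam p q x * (lam p (τ p) x)⁻¹ * lam q (τ q) x := by
    intro p q x hp hq
    have h1 := hlam p (τ p) (τ q) x hp.2 (hVU _ hp.1) (hVU _ hq.1)
    have h2 := hlam p q (τ q) x hp.2 hq.2 (hVU _ hq.1)
    change expU (l p q x - ρ ![p, τ p, τ q] x + ρ ![p, q, τ q] x) = _
    rw [expU_add, expU_sub, hle p q x ⟨hp.1, hq.1⟩, eq_inv_mul_of_mul_eq h1.symm,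
      eq_inv_mul_of_mul_eq h2.symm]
    refine Additive.ofMul.injective ?_
    simp only [ofMul_mul, ofMul_inv]
    abel
  let g : PreCochain M ℝ 2 := ρ - cechDelta k
  have hg : ∀ σ, ContinuousOn (g σ) (overlap W σ) := fun σ =>
    ((hρ σ).mono fun x hx => (overlap_inter hx).2).sub (continuousOn_delta hk σ)
  have hgi : ∀ σ, ∀ x ∈ overlap W σ, ∃ j : ℤ, g σ x = j := fun σ x hx => by
    have hx' := mem_overlap.1 hx
    have h1 := hlam (σ 0) (σ 1) (σ 2) x (hx' 0).2 (hx' 1).2 (hx' 2).2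
    have h2 : g σ x = ρ ![σ 0, σ 1, σ 2] x -
        (k ![σ 1, σ 2] x - k ![σ 0, σ 2] x + k ![σ 0, σ 1] x) := by
      rw [← delta_one, ← eq_three σ]
      rfl
    rw [← expU_eq_one_iff, h2, expU_sub, expU_add, expU_sub, hkl _ _ x (hx' 1) (hx' 2),
      hkl _ _ x (hx' 0) (hx' 2), hkl _ _ x (hx' 0) (hx' 1), eq_inv_mul_of_mul_eq h1.symm]
    refine Additive.ofMul.injective ?_
    simp only [ofMul_mul, ofMul_inv, ofMul_one]
    abel
  obtain ⟨b, hb, -, hbg⟩ := exists_int_cochain hW hg hgi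
  refine cechClass_eq_iff.2 ⟨b, hb, W, hW, fun σ x hx => ?_⟩
  have h1 : ((cechDelta b σ x : ℤ) : ℝ) = cechDelta g σ x := by
    rw [delta_congr hbg hx]
    exact (delta_map (Int.castAddHom ℝ) b σ x).symm
  have h2 : cechDelta g σ x = cechDelta ρ σ x - cechDelta (cechDelta k) σ x := by
    simp only [g, map_sub]
    rfl
  rw [h2, delta_delta_one, sub_zero, hz σ x (overlap_inter hx).2] at h1
  exact_mod_cast h1.symm

end Logarithm

/-! ### The characteristic classes of the lifting bundle gerbes -/

section GerbeClasses

variable {m n : ℕ} {M : Type*} [TopologicalSpace M] [ChartedSpace (Eu m) M]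
  {E : M → Type*} [TopologicalSpace (TotalSpace (Eu n) E)]
  [∀ x, NormedAddCommGroup (E x)] [∀ x, InnerProductSpace ℝ (E x)]
  [FiberBundle (Eu n) E] {o : ∀ x, Orientation ℝ (E x) (Fin n)} {K : Type} [RCLike K]

/-- The bookkeeping for `exists_comparison`: conjugating a product relation by changes of frame,
with all scalar factors moved to the front. -/
lemma mul_conj_mul_of_central {G : Type*} [Group G] {c₁ c₂ e a b c h k l : G}
    (hc : ∀ g, c₂ * g = g * c₂) (he : ∀ g, e * g = g * e) (h' : a * b = e * c) :
    c₁ * c₂ * e * (h⁻¹ * c * k) = c₁ * (h⁻¹ * a * l) * (c₂ * (l⁻¹ * b * k)) := by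
  calc c₁ * c₂ * e * (h⁻¹ * c * k) = c₁ * c₂ * (e * h⁻¹) * c * k := by simp only [mul_assoc]
    _ = c₁ * c₂ * h⁻¹ * (a * b) * k := by rw [he, h']; simp only [mul_assoc]
    _ = c₁ * (c₂ * (h⁻¹ * a * l)) * (l⁻¹ * b * k) := by
        simp only [mul_assoc, mul_inv_cancel_left]
    _ = c₁ * (h⁻¹ * a * l) * (c₂ * (l⁻¹ * b * k)) := by rw [hc]; simp only [mul_assoc]

lemma isLocalSections_iff {U : M → Set M} {s : M → ∀ x, OFrame o x} :
    IsLocalSections m U s ↔ ∀ p, FSm m m id (s p) (U p) := Iff.rfl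

namespace IsGerbeSections

variable {U : M → Set M} {s : M → ∀ x, OFrame o x} {a : PreCochain M (spinK K n) 1}

lemma covers (ha : IsGerbeSections m U s a) {p q x : M} (hp : x ∈ U p) (hq : x ∈ U q) :
    Covers (a ![p, q] x) (rot (s p x) (s q x)) := (ha ![p, q]).1 x (mem_overlap_two.2 ⟨hp, hq⟩)

lemma smooth (ha : IsGerbeSections m U s a) (p q : M) :
    WSm m K (fun x => spinVal (a ![p, q] x)) (U p ∩ U q) := fun φ =>
  ((ha ![p, q]).2 φ).mono fun _ hx => mem_overlap_two.2 hx

lemma exists_scalar (ha : IsGerbeSections m U s a) {p q t x : M} (hp : x ∈ U p) (hq : x ∈ U q)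
    (ht : x ∈ U t) :
    ∃ η : unitary K, a ![p, q] x * a ![q, t] x = unitScalar η * a ![p, t] x := by
  have h := (ha.covers hp hq).mul (ha.covers hq ht)
  rw [rot_trans] at h
  exact (ha.covers hp ht).exists_unitScalar h

lemma scalar_smooth (ha : IsGerbeSections m U s a) {p q t : M} {O : Set M} (hp : O ⊆ U p)
    (hq : O ⊆ U q) (ht : O ⊆ U t) {η : M → unitary K}
    (h : ∀ x ∈ O, a ![p, q] x * a ![q, t] x = unitScalar (η x) * a ![p, t] x) : USm m η O := by
  refine wsm_unitScalar.1 (((((ha.smooth p q).mono fun x hx => ⟨hp hx, hq hx⟩).spin_mul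
    ((ha.smooth q t).mono fun x hx => ⟨hq hx, ht hx⟩)).spin_mul
    ((ha.smooth p t).mono fun x hx => ⟨hp hx, ht hx⟩).spin_inv).congr fun x hx => ?_)
  rw [h x hx, mul_inv_cancel_right]

end IsGerbeSections

/-- The two bracketings of `a_pq a_qt a_tu` give the two sides. -/
lemma scalar_cocycle {a : PreCochain M (spinK K n) 1} {p q t u x : M} {e₀ e₁ e₂ e₃ : unitary K}
    (h₀ : a ![q, t] x * a ![t, u] x = unitScalar e₀ * a ![q, u] x)
    (h₁ : a ![p, t] x * a ![t, u] x = unitScalar e₁ * a ![p, u] x)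
    (h₂ : a ![p, q] x * a ![q, u] x = unitScalar e₂ * a ![p, u] x)
    (h₃ : a ![p, q] x * a ![q, t] x = unitScalar e₃ * a ![p, t] x) : e₀ * e₂ = e₃ * e₁ := by
  refine unitScalar_injective (mul_right_cancel (b := a ![p, u] x) ?_)
  calc unitScalar (e₀ * e₂) * a ![p, u] x = a ![p, q] x * (a ![q, t] x * a ![t, u] x) := by
        rw [h₀, unitScalar_mul, mul_assoc, ← h₂, ← mul_assoc, ← mul_assoc, unitScalar_comm]
    _ = unitScalar (e₃ * e₁) * a ![p, u] x := by
        rw [← mul_assoc, h₃, mul_assoc, h₁, unitScalar_mul, mul_assoc]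

variable [VectorBundle ℝ (Eu n) E] [IsManifold (𝓡 m) ∞ M] [ContMDiffVectorBundle ∞ (Eu n) E (𝓡 m)]
  [IsContMDiffRiemannianBundle (𝓡 m) ∞ (Eu n) E]

/-- Two systems of local sections of the gerbe differ by scalar functions. -/
lemma IsGerbeSections.exists_comparison (hn : 0 < n) {U U' : M → Set M} {s s' : M → ∀ x, OFrame o x}
    {a a' : PreCochain M (spinK K n) 1} (hU : IsNbhds U) (hU' : IsNbhds U')
    (hs : IsLocalSections m U s) (hs' : IsLocalSections m U' s') (ha : IsGerbeSections m U s a)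
    (ha' : IsGerbeSections m U' s' a') :
    ∃ (V : M → Set M) (lam : M → M → M → unitary K), IsNbhds V ∧ (∀ p, V p ⊆ U p ∩ U' p) ∧
      (∀ p q, USm m (lam p q) (V p ∩ V q)) ∧
      ∀ p q t x, x ∈ V p → x ∈ V q → x ∈ V t → ∀ e e' : unitary K,
        a ![p, q] x * a ![q, t] x = unitScalar e * a ![p, t] x →
        a' ![p, q] x * a' ![q, t] x = unitScalar e' * a' ![p, t] x →
        lam p q x * lam q t x * e = lam p t x * e' := by
  -- Elements `h p` of the gerbe over `(s p, s' p)` carry one system of sections to the other: `(h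
  -- p)⁻¹ a_pq (h q)` covers the same rotation as `a'_pq`, and `lam` is their scalar ratio.
  have hloc := fun p => AlgIso.exists_local_gerbe K hn ((hU p).1.inter (hU' p).1)
    ((isLocalSections_iff.1 hs p).mono Set.inter_subset_left)
    ((isLocalSections_iff.1 hs' p).mono Set.inter_subset_right) ⟨(hU p).2, (hU' p).2⟩
  choose V hVU hVo hpV h hh using hloc
  have hlam : ∀ p q x, ∃ lam : unitary K, x ∈ V p → x ∈ V q →
      a' ![p, q] x = unitScalar lam * ((h p x).1⁻¹ * a ![p, q] x * (h q x).1) := fun p q x => by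
    by_cases hx : x ∈ V p ∧ x ∈ V q
    · have h1 := ((h p x).2.inv.mul (ha.covers (hVU p hx.1).1 (hVU q hx.2).1)).mul (h q x).2
      rw [rot_symm] at h1
      simp only [id] at h1
      rw [rot_trans, rot_trans] at h1
      obtain ⟨lam, hl⟩ := h1.exists_unitScalar (ha'.covers (hVU p hx.1).2 (hVU q hx.2).2)
      exact ⟨lam, fun _ _ => hl⟩
    · exact ⟨1, fun h1 h2 => absurd ⟨h1, h2⟩ hx⟩
  choose lam hlam using hlam
  refine ⟨V, lam, fun p => ⟨hVo p, hpV p⟩, hVU, fun p q => ?_, fun p q t x hp hq ht e e' he he' => ?_⟩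
  · have h1 := ((hh p).mono (Set.inter_subset_left (t := V q))).spin_inv
    have h2 := (ha.smooth p q).mono (Set.inter_subset_inter (fun x hx => (hVU p hx).1)
      fun x hx => (hVU q hx).1)
    have h3 := (hh q).mono (Set.inter_subset_right (s := V p))
    have h4 := (ha'.smooth p q).mono (Set.inter_subset_inter (fun x hx => (hVU p hx).2)
      fun x hx => (hVU q hx).2)
    refine wsm_unitScalar.1 ((h4.spin_mul ((h1.spin_mul h2).spin_mul h3).spin_inv).congr
      fun x hx => ?_)
    rw [hlam p q x hx.1 hx.2, mul_inv_cancel_right]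
  · rw [hlam p q x hp hq, hlam q t x hq ht, hlam p t x hp ht] at he'
    set b := (h p x).1⁻¹ * a ![p, t] x * (h t x).1 with hb
    refine unitScalar_injective (mul_right_cancel (b := b) ?_)
    rw [mul_comm (lam p t x), unitScalar_mul e', mul_assoc (unitScalar e'), ← he', unitScalar_mul, unitScalar_mul]
    exact mul_conj_mul_of_central (unitScalar_comm _) (unitScalar_comm _) he

/-- Local frames with lifts of the transition functions to `Spin(n)`. -/
lemma exists_spin_sections [T2Space M] [SecondCountableTopology M] (hn : 0 < n)
    (ho : IsOrientation o) :
    ∃ (U : M → Set M) (s : M → ∀ x, OFrame o x) (a : PreCochain M (spinGroup (quad n)) 1),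
      IsNbhds U ∧ IsLocalSections m U s ∧
      (∀ σ, ∀ x ∈ overlap U σ, ∀ v : Eu n, (a σ x : Cl n) * CliffordAlgebra.ι (quad n) v =
        CliffordAlgebra.ι (quad n) (rot (s (σ 0) x) (s (σ 1) x) v) * (a σ x : Cl n)) ∧
      ∀ σ, WSm m ℝ (fun x => (a σ x : Cl n)) (overlap U σ) := by
  have := ChartedSpace.locallyCompactSpace (Eu m) M
  choose U hUo hpU s hs using exists_local_section (m := m) (o := o) hn ho
  have hU : IsNbhds U := fun p => ⟨hUo p, hpU p⟩
  -- The transition rotations lift to `Spin(n)` only locally on overlaps. The refinement provides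
  -- lifts on whole overlaps.
  obtain ⟨τ, V, hV, hVU, hVP⟩ := exists_refinement hU
    (P := fun p q W => ∃ a : M → spinGroup (quad n), (∀ x ∈ W, ∀ v : Eu n,
      (a x : Cl n) * CliffordAlgebra.ι (quad n) v =
        CliffordAlgebra.ι (quad n) (rot (s p x) (s q x) v) * (a x : Cl n)) ∧
      WSm m ℝ (fun x => (a x : Cl n)) W)
    (fun p q W W' hW ⟨l, h1, h2⟩ => ⟨l, fun x hx => h1 x (hW hx), h2.mono hW⟩)
    (fun p q x hx => by
      obtain ⟨W, -, h1, h2, b, h3, h4⟩ := exists_local_spin_lift hn ((hUo p).inter (hUo q))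
        (fun x _ => det_rot (s p x) (s q x)) (((hs p).mono Set.inter_subset_left).rot_smooth
          ((hs q).mono Set.inter_subset_right)) hx
      exact ⟨W, h1, h2, b, h3, h4⟩)
  have ha : ∀ σ : Fin 2 → M, ∃ a : M → spinGroup (quad n), (∀ x ∈ overlap V σ, ∀ v : Eu n,
      (a x : Cl n) * CliffordAlgebra.ι (quad n) v =
        CliffordAlgebra.ι (quad n) (rot (s (τ (σ 0)) x) (s (τ (σ 1)) x) v) * (a x : Cl n)) ∧
      WSm m ℝ (fun x => (a x : Cl n)) (overlap V σ) := fun σ => by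
    by_cases h : (V (σ 0) ∩ V (σ 1)).Nonempty
    · obtain ⟨a, h1, h2⟩ := hVP _ _ h
      exact ⟨a, fun x hx => h1 x (mem_overlap.1 hx 0), h2.mono fun x hx => mem_overlap.1 hx 0⟩
    · have h0 : ∀ x, x ∉ overlap V σ := fun x hx => h ⟨x, mem_overlap.1 hx 0, mem_overlap.1 hx 1⟩
      exact ⟨1, fun x hx => absurd hx (h0 x), fun φ x hx => absurd hx (h0 x)⟩
  choose a ha has using ha
  exact ⟨V, fun p => s (τ p), a, hV, fun p i => (hs (τ p) i).mono (hVU p), ha, has⟩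

end GerbeClasses

/-! ### Identification of the Dixmier–Douady classes with `w₂` and `W₃`. -/

section GerbeClasses

variable {m n : ℕ} {M : Type*} [TopologicalSpace M] [ChartedSpace (Eu m) M]
  {E : M → Type*} [TopologicalSpace (TotalSpace (Eu n) E)]
  [∀ x, NormedAddCommGroup (E x)] [∀ x, InnerProductSpace ℝ (E x)]
  [FiberBundle (Eu n) E] {o : ∀ x, Orientation ℝ (E x) (Fin n)} {K : Type} [RCLike K]

lemma eq_unitScalar_mul_iff {a b : spinK K n} {z : unitary K} :
    a = unitScalar z * b ↔ spinVal a = (z : K) • spinVal b := by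
  rw [← spinVal_unitScalar_mul, spinVal_injective.eq_iff]

lemma isGerbeSections_ofSpin (K : Type) [RCLike K] {U : M → Set M} {s : M → ∀ x, OFrame o x}
    {a : PreCochain M (spinGroup (quad n)) 1}
    (ha : ∀ σ, ∀ x ∈ overlap U σ, ∀ v : Eu n, (a σ x : Cl n) * CliffordAlgebra.ι (quad n) v =
      CliffordAlgebra.ι (quad n) (rot (s (σ 0) x) (s (σ 1) x) v) * (a σ x : Cl n))
    (has : ∀ σ, WSm m ℝ (fun x => (a σ x : Cl n)) (overlap U σ)) :
    IsGerbeSections m U s fun σ x => ofSpin K (a σ x) := fun σ =>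
  ⟨fun x hx => covers_ofSpin.2 (ha σ x hx), (has σ).ofSpin⟩

lemma mul_inv_eq_iff {a : spinGroup (quad n)} {v w : Cl n} :
    (a : Cl n) * v * ((a⁻¹ : spinGroup (quad n)) : Cl n) = w ↔ (a : Cl n) * v = w * a := by
  have h : (a : Cl n) * ((a⁻¹ : spinGroup (quad n)) : Cl n) = 1 := by
    rw [← MulMemClass.coe_mul, mul_inv_cancel, OneMemClass.coe_one]
  have h' : ((a⁻¹ : spinGroup (quad n)) : Cl n) * (a : Cl n) = 1 := by
    rw [← MulMemClass.coe_mul, inv_mul_cancel, OneMemClass.coe_one]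
  constructor
  · rintro rfl
    rw [mul_assoc _ _ (a : Cl n), h', mul_one]
  · intro e
    rw [e, mul_assoc, h, mul_one]

lemma ofSpin_mul_eq_iff {a b c : spinGroup (quad n)} {z : ℝ} :
    (a : Cl n) * b = z • (c : Cl n) ↔
      spinVal (ofSpin K a * ofSpin K b) = (z : K) • spinVal (ofSpin K c) := by
  rw [← ofSpin_mul, spinVal_ofSpin, spinVal_ofSpin, TensorProduct.smul_tmul', smul_eq_mul, mul_one,
    MulMemClass.coe_mul, ← one_tmul_injective (K := K).eq_iff]
  simp only [TensorProduct.tmul_smul]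
  rw [TensorProduct.smul_tmul', RCLike.real_smul_eq_coe_mul, mul_one]

lemma IsSW2.isRealDDClass {w : H2 M (ZMod 2)} (h : IsSW2 m o w) : IsRealDDClass m o w := by
  obtain ⟨U, s, a, z, hU, hs, ha, has, haz, hw⟩ := h
  exact ⟨U, s, fun σ x => ofSpin ℝ (a σ x), z, hU, hs, isGerbeSections_ofSpin ℝ
    (fun σ x hx v => mul_inv_eq_iff.1 (ha σ x hx v)) has,
    fun σ x hx => ofSpin_mul_eq_iff.1 (haz σ x hx), hw⟩

variable [VectorBundle ℝ (Eu n) E] [IsManifold (𝓡 m) ∞ M] [ContMDiffVectorBundle ∞ (Eu n) E (𝓡 m)]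
  [IsContMDiffRiemannianBundle (𝓡 m) ∞ (Eu n) E]

/-- The comparison scalars are signs here, and their exponents form a cochain with coboundary `z' -
z`. -/
lemma IsRealDDClass.unique (hn : 0 < n) {w w' : H2 M (ZMod 2)} (h : IsRealDDClass m o w)
    (h' : IsRealDDClass m o w') : w = w' := by
  obtain ⟨U, s, a, z, hU, hs, ha, haz, rfl⟩ := h
  obtain ⟨U', s', a', z', hU', hs', ha', haz', rfl⟩ := h'
  obtain ⟨V, lam, hV, hVU, hlam, hl⟩ := ha.exists_comparison hn hU hU' hs hs' ha'
  choose l hle using fun p q x => exists_signU (lam p q x)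
  refine cechClass_eq_iff.2 ⟨fun σ => l (σ 0) (σ 1), ⟨V, hV, fun σ x hx => ?_⟩, V, hV, fun σ x hx =>
    signU_injective ?_⟩
  · refine eventually_eq_of_signU ((hV _).1.inter (hV _).1) ?_
      ⟨mem_overlap.1 hx 0, mem_overlap.1 hx 1⟩
    exact ((hlam _ _).congr fun x _ => hle _ _ x).continuousOn
  · have hx' := mem_overlap.1 hx
    have h1 := haz σ x (overlap_mono (fun p x hx => (hVU p hx).1) σ hx)
    have h2 := haz' σ x (overlap_mono (fun p x hx => (hVU p hx).2) σ hx)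
    have h3 := hl (σ 0) (σ 1) (σ 2) x (hx' 0) (hx' 1) (hx' 2) (signU (z.1 σ x)) (signU (z'.1 σ x))
      (eq_unitScalar_mul_iff.2 h1) (eq_unitScalar_mul_iff.2 h2)
    have h4 : cechDelta (fun σ : Fin 2 → M => l (σ 0) (σ 1)) σ x =
        l (σ 1) (σ 2) x - l (σ 0) (σ 2) x + l (σ 0) (σ 1) x := by
      conv_lhs => rw [eq_three σ]
      exact delta_one _ _ _ _ _
    rw [h4, signU_add, signU_sub, signU_sub, hle, hle, hle, eq_inv_mul_of_mul_eq h3.symm]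
    refine Additive.ofMul.injective ?_
    simp only [ofMul_mul, ofMul_inv]
    abel

variable [T2Space M] [SecondCountableTopology M]

/-- The scalars measuring the failure of the lifts to be multiplicative are smooth signs, hence
locally constant, and associativity makes them a cocycle. -/
lemma exists_isSW2 (hn : 0 < n) (ho : IsOrientation o) : ∃ w, IsSW2 m o w := by
  obtain ⟨U, s, a, hU, hs, ha, has⟩ := exists_spin_sections (m := m) hn ho
  have hG := isGerbeSections_ofSpin ℝ ha has
  have hz : ∀ p q t x, ∃ z : ZMod 2, x ∈ U p → x ∈ U q → x ∈ U t →
      ofSpin ℝ (a ![p, q] x) * ofSpin ℝ (a ![q, t] x) =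
        unitScalar (signU z) * ofSpin ℝ (a ![p, t] x) := fun p q t x => by
    by_cases h : x ∈ U p ∧ x ∈ U q ∧ x ∈ U t
    · obtain ⟨η, hη⟩ := hG.exists_scalar h.1 h.2.1 h.2.2
      obtain ⟨z, rfl⟩ := exists_signU η
      exact ⟨z, fun _ _ _ => hη⟩
    · exact ⟨0, fun h1 h2 h3 => absurd ⟨h1, h2, h3⟩ h⟩
  choose z hz using hz
  have hz' : ∀ (σ : Fin 3 → M), ∀ x ∈ overlap U σ, ofSpin ℝ (a ![σ 0, σ 1] x) *
      ofSpin ℝ (a ![σ 1, σ 2] x) =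
        unitScalar (signU (z (σ 0) (σ 1) (σ 2) x)) * ofSpin ℝ (a ![σ 0, σ 2] x) := fun σ x hx =>
    hz _ _ _ x (mem_overlap.1 hx 0) (mem_overlap.1 hx 1) (mem_overlap.1 hx 2)
  refine ⟨_, U, s, a, mkCocycle (fun σ => z (σ 0) (σ 1) (σ 2)) hU (fun σ x hx => ?_)
    (fun σ x hx => signU_injective ?_), hU, hs, fun σ x hx v => mul_inv_eq_iff.2 (ha σ x hx v), has,
    fun σ x hx => ?_, rfl⟩
  · exact eventually_eq_of_signU (isOpen_overlap hU σ) (hG.scalar_smooth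
      (fun x hx => mem_overlap.1 hx 0) (fun x hx => mem_overlap.1 hx 1)
      (fun x hx => mem_overlap.1 hx 2) (hz' σ)).continuousOn hx
  · have hx' := mem_overlap.1 hx
    have h1 := scalar_cocycle (a := fun σ x => ofSpin ℝ (a σ x))
      (hz _ _ _ x (hx' 1) (hx' 2) (hx' 3)) (hz _ _ _ x (hx' 0) (hx' 2) (hx' 3))
      (hz _ _ _ x (hx' 0) (hx' 1) (hx' 3)) (hz _ _ _ x (hx' 0) (hx' 1) (hx' 2))
    have h4 : cechDelta (fun σ : Fin 3 → M => z (σ 0) (σ 1) (σ 2)) σ x =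
        z (σ 1) (σ 2) (σ 3) x - z (σ 0) (σ 2) (σ 3) x + z (σ 0) (σ 1) (σ 3) x -
          z (σ 0) (σ 1) (σ 2) x := by
      conv_lhs => rw [eq_four σ]
      exact delta_two _ _ _ _ _ _
    rw [h4, signU_sub, signU_add, signU_sub, eq_mul_inv_of_mul_eq h1, signU_zero]
    refine Additive.ofMul.injective ?_
    simp only [ofMul_mul, ofMul_inv, ofMul_one]
    abel
  · have h : (a ![σ 0, σ 1] x : Cl n) * a ![σ 1, σ 2] x =
        (signU (z (σ 0) (σ 1) (σ 2) x) : ℝ) • (a ![σ 0, σ 2] x : Cl n) := by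
      rw [ofSpin_mul_eq_iff (K := ℝ), eq_unitScalar_mul_iff.1 (hz' σ x hx)]
      rfl
    exact h

lemma IsDDClass.unique (hn : 0 < n) {d d' : H3 M ℤ} (h : IsDDClass m o d) (h' : IsDDClass m o d') :
    d = d' := by
  obtain ⟨U, s, a, r, z, hU, hs, ha, hr, har, hrz, rfl⟩ := h
  obtain ⟨U', s', a', r', z', hU', hs', ha', hr', har', hrz', rfl⟩ := h'
  obtain ⟨V, lam, hV, hVU, hlam, hl⟩ := ha.exists_comparison hn hU hU' hs hs' ha'
  have hov : ∀ {k : ℕ} {σ : Fin (k + 1) → M} {x}, x ∈ overlap V σ →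
      x ∈ overlap U σ ∧ x ∈ overlap U' σ := fun {k σ x} hx => overlap_inter (overlap_mono hVU σ hx)
  refine cechClass_eq_of_log hV hlam (ρ := r' - r) (fun σ => ((hr' σ).mono fun x hx => (hov hx).2).sub
    ((hr σ).mono fun x hx => (hov hx).1)) (fun p q t x hp hq ht => ?_) fun σ x hx => ?_
  · have hx : x ∈ overlap V ![p, q, t] := mem_overlap_three.2 ⟨hp, hq, ht⟩
    have h3 := hl p q t x hp hq ht (expU (r ![p, q, t] x)) (expU (r' ![p, q, t] x))
      (eq_unitScalar_mul_iff.2 (har _ x (hov hx).1)) (eq_unitScalar_mul_iff.2 (har' _ x (hov hx).2))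
    simp only [Pi.sub_apply]
    rw [expU_sub, ← mul_assoc, ← h3, mul_inv_cancel_right]
  · rw [map_sub, Pi.sub_apply, Pi.sub_apply, hrz σ x (hov hx).1, hrz' σ x (hov hx).2, Int.cast_sub]

/-- A sign has half its integral exponent as logarithm. This half is the one in the Bockstein
homomorphism. -/
lemma exp_zlift (a : ZMod 2) :
    Complex.exp (2 * Real.pi * Complex.I * (((zlift a : ℤ) : ℝ) / 2 : ℝ)) = (((-1) ^ a.val : ℝ) : ℂ) := by
  rcases zmod_two_cases a with rfl | rfl
  · simp [zlift]
  · have h : (2 * Real.pi * Complex.I * (((zlift 1 : ℤ) : ℝ) / 2 : ℝ) : ℂ) = Real.pi * Complex.I := by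
      simp [zlift, ZMod.val_one]
      ring
    rw [h, Complex.exp_pi_mul_I]
    simp [ZMod.val_one]

/-- The same local data serve both classes. The lifts to `Spin(n)`, viewed in `Spin^c(n)`, have
scalar logarithm `r = c̃/2`, and `δr = δ(c̃)/2` is the Bockstein cocycle `z` of `w₂`. -/
lemma exists_isDDClass (hn : 0 < n) (ho : IsOrientation o) :
    ∃ d : H3 M ℤ, IsDDClass m o d ∧ IsW3 m o d := by
  obtain ⟨w, hw⟩ := exists_isSW2 (m := m) hn ho
  obtain ⟨U, s, a, c, hU, hs, ha, has, hac, hcw⟩ := id hw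
  obtain ⟨U', z, hU', hc, hz⟩ := exists_integral_lift c
  have hV := hU.inter hU'
  have hov : ∀ {k : ℕ} (σ : Fin (k + 1) → M),
      overlap (fun p => U p ∩ U' p) σ ⊆ overlap U σ := fun σ =>
    overlap_mono (fun p => Set.inter_subset_left) σ
  refine ⟨cechClass z, ⟨fun p => U p ∩ U' p, s, fun σ x => ofSpin ℂ (a σ x),
    fun σ x => (zlift (c.1 σ x) : ℝ) / 2, z, hV, fun p i => (hs p i).mono Set.inter_subset_left,
    isGerbeSections_ofSpin ℂ (fun σ x hx v => mul_inv_eq_iff.1 (ha σ x (hov σ hx) v))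
      fun σ φ => (has σ φ).mono (hov σ), fun σ x hx => ?_, fun σ x hx => ?_, fun σ x hx => ?_, rfl⟩,
    w, hw, U', fun σ x => zlift (c.1 σ x), c, z, hU', ⟨U', hU', fun σ x hx =>
      (hc σ x hx).mono fun y hy => by simp only [hy]⟩, hcw, rfl, fun σ x _ => zlift_cast _, hz⟩
  · refine ContinuousAt.continuousWithinAt (continuousAt_const.congr (f := fun _ =>
      (zlift (c.1 σ x) : ℝ) / 2) ((hc σ x (overlap_inter hx).2).mono fun y hy => by simp only [hy]))
  · rw [exp_zlift]
    exact ofSpin_mul_eq_iff.1 (hac σ x (hov σ hx))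
  -- Doubling moves the identity to the integral cochain, where it is the defining property of `z`.
  · have h1 : (2 : ℝ) * cechDelta (fun σ x => (zlift (c.1 σ x) : ℝ) / 2) σ x = 2 * (z.1 σ x : ℝ) := by
      rw [← Int.cast_two, ← Int.cast_mul, ← hz σ x (overlap_inter hx).2]
      rw [show ((cechDelta (fun σ x => zlift (c.1 σ x)) σ x : ℤ) : ℝ) = _ from
        (delta_map (Int.castAddHom ℝ) (fun σ x => zlift (c.1 σ x)) σ x).symm]
      refine (delta_map (AddMonoidHom.mulLeft (2 : ℝ)) _ σ x).symm.trans ?_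
      refine congrArg (fun r => cechDelta r σ x) (funext₂ fun σ x => ?_)
      simp only [AddMonoidHom.coe_mulLeft, Int.coe_castAddHom]
      ring
    exact mul_left_cancel₀ two_ne_zero h1

lemma IsW3.unique (hn : 0 < n) {d d' : H3 M ℤ} (h : IsW3 m o d) (h' : IsW3 m o d') : d = d' := by
  obtain ⟨w, hw, hd⟩ := h
  obtain ⟨w', hw', hd'⟩ := h'
  obtain rfl := hw.isRealDDClass.unique hn hw'.isRealDDClass
  exact hd.unique hd'

end GerbeClasses

end SpinorGerbe

end

/-! ### The main theorem. -/

open Bundle Manifold ContDiff SpinorGerbe in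
theorem mainTheorem7 {m n : ℕ} (hn : 0 < n)
    {M : Type*} [TopologicalSpace M] [T2Space M] [SecondCountableTopology M]
    [ChartedSpace (Eu m) M] [IsManifold (𝓡 m) ∞ M]
    {E : M → Type*} [TopologicalSpace (TotalSpace (Eu n) E)]
    [∀ x, NormedAddCommGroup (E x)] [∀ x, InnerProductSpace ℝ (E x)]
    [FiberBundle (Eu n) E] [VectorBundle ℝ (Eu n) E]
    [ContMDiffVectorBundle ∞ (Eu n) E (𝓡 m)] [IsContMDiffRiemannianBundle (𝓡 m) ∞ (Eu n) E]
    (o : ∀ x, Orientation ℝ (E x) (Fin n)) (ho : IsOrientation o) :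
    -- the Dixmier–Douady class of the `Spin^c` gerbe is `W₃`, that of the `Spin` gerbe is `w₂`
    (∃ d : H3 M ℤ, ∀ d' : H3 M ℤ, (IsDDClass m o d' ↔ d' = d) ∧ (IsW3 m o d' ↔ d' = d)) ∧
    (∃ w : H2 M (ZMod 2), ∀ w' : H2 M (ZMod 2),
      (IsRealDDClass m o w' ↔ w' = w) ∧ (IsSW2 m o w' ↔ w' = w)) ∧
    -- spinor modules of the `Spin^c` gerbe
    (∃ (V : Type) (_ : AddCommGroup V) (_ : Module ℂ V)
      (ρ : Representation ℂ (spinK ℂ n) V), IsSpinRep ρ ∧ ρ.IsIrreducible) ∧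
    (∀ (V : Type) [AddCommGroup V] [Module ℂ V] (ρ : Representation ℂ (spinK ℂ n) V),
      IsSpinRep ρ → ParametrisedBy m o ρ IsChernClass) ∧
    -- spinor modules of the `Spin` gerbe
    (∃ (V : Type) (_ : AddCommGroup V) (_ : Module ℝ V)
      (ρ : Representation ℝ (spinK ℝ n) V), IsSpinRep ρ ∧ ρ.IsIrreducible) ∧
    (∀ (V : Type) [AddCommGroup V] [Module ℝ V] (ρ : Representation ℝ (spinK ℝ n) V),
      IsSpinRep ρ → ParametrisedBy m o ρ IsSW1) := by
  refine ⟨?_, ?_, exists_irreducible_spinRep ℂ n, ?_, exists_irreducible_spinRep ℝ n, ?_⟩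
  · obtain ⟨d, hd, hd'⟩ := exists_isDDClass (m := m) hn ho
    exact ⟨d, fun d' => ⟨⟨fun h => h.unique hn hd, fun h => h ▸ hd⟩,
      ⟨fun h => h.unique hn hd', fun h => h ▸ hd'⟩⟩⟩
  · obtain ⟨w, hw⟩ := exists_isSW2 (m := m) hn ho
    exact ⟨w, fun w' => ⟨⟨fun h => h.unique hn hw.isRealDDClass, fun h => h ▸ hw.isRealDDClass⟩,
      ⟨fun h => h.isRealDDClass.unique hn hw.isRealDDClass, fun h => h ▸ hw⟩⟩⟩
  · intro V _ _ ρ hρ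
    exact isClassifying_isChern.parametrisedBy hn ho hρ fun hA c => hA.isChernClass_iff c
  · intro V _ _ ρ hρ
    exact isClassifying_isSW1.parametrisedBy hn ho hρ fun hA c => hA.isSW1_iff c
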